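/- Let $d\in\{2,3\}$, $\Omega=(0,1)^d$, $T>0$. Let $(\mathsf u,\mathsf p)$ solve the time-dependent Stokes problem $\partial_t\mathsf u-\Delta\mathsf u+\nabla\mathsf p=f$ in $\Omega\times(0,T]$, $\nabla\cdot\mathsf u=0$ in $\Omega\times[0,T]$, $\mathsf u|_{\partial\Omega}=0$, $\mathsf u|_{t=0}=\mathsf u_0$, where $\mathsf p(t)$ has zero mean. *Operators.* For a set $S$ of coordinate directions let $\partial_S=\prod_{i\in S}\partial_i$. Let $A=\prod_{i=1}^d(1-\partial_{ii})$ with homogeneous Neumann conditions in each direction: in two dimensions $A=(1-\partial_{xx})(1-\partial_{yy})$ with $D(A)$ the set of zero-mean $q\in L^2(\Omega)$ such that $\partial_{yy}q,Aq\in L^2(\Omega)$, $\partial_yq|_{y=0,1}=0$, $\partial_x(1-\partial_{yy})q|_{x=0,1}=0$, and analogously in three dimensions. Let $Y$ be the space of zero-mean $q\in L^2(\Omega)$ with $\partial_Sq\in L^2(\Omega)$ for all $S$, with norm $\|q\|_A=\big(\sum_S\|\partial_Sq\|_{L^2}^2\big)^{1/2}$, the extension of $\langle Aq,q\rangle^{1/2}$.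 For $\tau>0$ let $B=B_\tau=\partial_{xxyy}$ if $d=2$ and $B=B_\tau=\partial_{xxyy}+\partial_{yyzz}+\partial_{zzxx}-\frac\tau2\partial_{xxyyzz}$ if $d=3$, with $D(B)=\{v\in H^1_0(\Omega)^d: Bv\in L^2(\Omega)^d\}$ carrying the graph norm, and $\|v\|_B=\langle v,Bv\rangle^{1/2}$. Put $\|v\|_{H^1}=\|\nabla v\|_{L^2}$. *Scheme (standard form, $\chi=0$).* Let $\tau\in(0,T]$, $t_s=s\tau$, $N=\lfloor T/\tau\rfloor$, $f^{k+\frac12}=f(t_{k+\frac12})$. Given $\phi^\star\in H^1(\Omega)$, set $u^0=\mathsf u_0$, $p^{-\frac12}=\mathsf p(0)$, $\phi^{-\frac12}=\phi^\star$, and for $0\le k<N$ let $p^{\star,k+\frac12}=p^{k-\frac12}+\phi^{k-\frac12}$, and let $u^{k+1}$ be determined as follows. If $d=2$: $$\tfrac{u^{k+\frac12}-u^k}{\tau/2}-\partial_{xx}u^{k+\frac12}-\partial_{yy}u^k+\nabla p^{\star,k+\frac12}=f^{k+\frac12},\quad u^{k+\frac12}|_{x=0,1}=0,$$ $$\tfrac{u^{k+1}-u^{k+\frac12}}{\tau/2}-\partial_{xx}u^{k+\frac12}-\partial_{yy}u^{k+1}+\nabla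 p^{\star,k+\frac12}=f^{k+\frac12},\quad u^{k+1}|_{y=0,1}=0.$$ If $d=3$: $$\tfrac{\xi^{k+1}-u^k}\tau-\Delta u^k+\nabla p^{\star,k+\frac12}=f^{k+\frac12},$$ $$\tfrac{\eta^{k+1}-\xi^{k+1}}\tau-\tfrac12\partial_{xx}(\eta^{k+1}-u^k)=0,\quad \eta^{k+1}|_{x=0,1}=0,$$ $$\tfrac{\zeta^{k+1}-\eta^{k+1}}\tau-\tfrac12\partial_{yy}(\zeta^{k+1}-u^k)=0,\quad \zeta^{k+1}|_{y=0,1}=0,$$ $$\tfrac{u^{k+1}-\zeta^{k+1}}\tau-\tfrac12\partial_{zz}(u^{k+1}-u^k)=0,\quad u^{k+1}|_{z=0,1}=0.$$ Then let $\phi^{k+\frac12}\in D(A)$ solve $A\phi^{k+\frac12}=-\frac1\tau\nabla\cdot u^{k+1}$ and set $p^{k+\frac12}=p^{k-\frac12}+\phi^{k+\frac12}$. *Errors.* Let $e^k=\mathsf u(t_k)-u^k$ for $0\le k\le N$, $\epsilon^{k-\frac12}=\mathsf p(t_{k-\frac12})-p^{k-\frac12}$ for $1\le k\le N$, and $\epsilon^{-\frac12}=\mathsf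 p(0)-p^{-\frac12}=0$. For a sequence $\psi$ let $\delta\psi^k=\psi^k-\psi^{k-1}$, and let $\|\delta e_\tau\|_{\ell^\infty(E)}=\max_{1\le k\le N}\|\delta e^k\|_E$, $\|\delta e_\tau\|_{\ell^2(E)}=\big(\tau\sum_{k=1}^N\|\delta e^k\|_E^2\big)^{1/2}$, $\|\delta\epsilon_\tau\|_{\ell^\infty(E)}=\max_{1\le k\le N}\|\delta\epsilon^{k-\frac12}\|_E$. **Statement.** Assume $\mathsf u\in W^{3,\infty}(0,T;H^2(\Omega)^d)$, $\mathsf u\in W^{2,\infty}(0,T;D(B_\tau))$ for every $\tau>0$, and $\mathsf p\in W^{3,\infty}(0,T;Y)$, and let $c_0\ge0$. Then there is a constant $c$, which depends only on $d$, $T$, $(\mathsf u,\mathsf p)$, $f$ and $c_0$, such that for every $\tau\in(0,T]$, every $\phi^\star$ with $\|\nabla(\mathsf p(\tfrac\tau2)-p^{\star,\frac12})\|_{L^2}\le c_0\tau$ (for instance $\phi^\star=0$ if $c_0$ is large enough), and the corresponding solution of the scheme, $$\|\delta e_\tau\|_{\ell^\infty(L^2)}+\|\delta e_\tau\|_{\ell^2(H^1)}+\tau\|\delta\epsilon_\tau\|_{\ell^\infty(A)}+\tau\|\delta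 e_\tau\|_{\ell^\infty(B)}\le c\,\tau^2 .$$ -/

import Mathlib

open MeasureTheory Filter Topology Set
open scoped ENNReal ContDiff

noncomputable section

namespace DirSplit

/-! ### The cube and its Lebesgue spaces -/

/-- The open unit cube `Ω = (0,1)^d`. -/
def cube (d : ℕ) : Set (Fin d → ℝ) := Set.pi Set.univ (fun _ => Set.Ioo (0 : ℝ) 1)

/-- `L²(Ω)`. -/
abbrev L2 (d : ℕ) : Type := Lp ℝ 2 ((volume : Measure (Fin d → ℝ)).restrict (cube d))

/-- `L²(Ω)^d`, with `‖v‖² = ∑ j, ‖v j‖²`. -/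
abbrev VL2 (d : ℕ) : Type := PiLp 2 (fun _ : Fin d => L2 d)

/-- `∫_Ω v ψ`. -/
def pairing {d : ℕ} (v : L2 d) (ψ : (Fin d → ℝ) → ℝ) : ℝ := ∫ x in cube d, v x * ψ x

/-- `v ∈ L²(Ω)` has zero mean. -/
def ZeroMean {d : ℕ} (v : L2 d) : Prop := ∫ x in cube d, v x = 0

/-! ### Classical and weak derivatives -/

/-- The classical partial derivative `∂ᵢ ψ`. -/
def pd {d : ℕ} (i : Fin d) (ψ : (Fin d → ℝ) → ℝ) : (Fin d → ℝ) → ℝ :=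
  fun x => fderiv ℝ ψ x (Pi.single i 1)

/-- The classical derivative `∂^α ψ` for a multi-index `α`. -/
def mpd {d : ℕ} (α : Fin d → ℕ) (ψ : (Fin d → ℝ) → ℝ) : (Fin d → ℝ) → ℝ :=
  (List.finRange d).foldr (fun i h => (pd i)^[α i] h) ψ

/-- The multi-index of `∂_S = ∏_{i ∈ S} ∂ᵢ`. -/
def ind {d : ℕ} (S : Finset (Fin d)) : Fin d → ℕ := fun i => if i ∈ S then 1 else 0

/-- `ψ ∈ C_c^∞(Ω)`. -/
def IsTest {d : ℕ} (ψ : (Fin d → ℝ) → ℝ) : Prop :=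
  ContDiff ℝ ∞ ψ ∧ HasCompactSupport ψ ∧ tsupport ψ ⊆ cube d

/-- `∂^α v = g` in the sense of distributions on `Ω`. -/
def IsWeakDeriv {d : ℕ} (α : Fin d → ℕ) (v g : L2 d) : Prop :=
  ∀ ψ, IsTest ψ → pairing v (mpd α ψ) = (-1) ^ (∑ i, α i) * pairing g ψ

/-- `∂ᵢ v = g` weakly in `Ω`, and `v` vanishes on the two faces `xᵢ = 0` and `xᵢ = 1`. The trace
condition is expressed by Green's formula: the test functions `ψ` are restrictions to `Ω` of
functions in `C_c^∞(ℝ^d)`, which need not vanish on `∂Ω`, and no boundary term appears. -/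
def IsZeroTraceDeriv {d : ℕ} (i : Fin d) (v g : L2 d) : Prop :=
  ∀ ψ : (Fin d → ℝ) → ℝ, ContDiff ℝ ∞ ψ → HasCompactSupport ψ →
    pairing v (pd i ψ) = - pairing g ψ

/-- `∂ᵢᵢ v = g` with the Dirichlet condition `v = 0` on `xᵢ = 0, 1`. -/
def IsDirichletSecond {d : ℕ} (i : Fin d) (v g : L2 d) : Prop :=
  ∃ w : L2 d, IsZeroTraceDeriv i v w ∧ IsWeakDeriv (Pi.single i 1) w g

/-- `∂ᵢᵢ v = g` with the Neumann condition `∂ᵢ v = 0` on `xᵢ = 0, 1`. -/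
def IsNeumannSecond {d : ℕ} (i : Fin d) (v g : L2 d) : Prop :=
  ∃ w : L2 d, IsWeakDeriv (Pi.single i 1) v w ∧ IsZeroTraceDeriv i w g

/-- `∇ q = G` weakly. -/
def IsWeakGrad {d : ℕ} (q : L2 d) (G : VL2 d) : Prop :=
  ∀ i, IsWeakDeriv (Pi.single i 1) q (G i)

/-- `∇ · v = D` weakly. -/
def IsWeakDiv {d : ℕ} (v : VL2 d) (D : L2 d) : Prop :=
  ∀ ψ, IsTest ψ → ∑ i, pairing (v i) (pd i ψ) = - pairing D ψ

/-- `Δ v = g` weakly, for a vector field `v`. -/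
def IsWeakLaplacian {d : ℕ} (v g : VL2 d) : Prop :=
  ∀ j, ∀ ψ, IsTest ψ → pairing (v j) (fun x => ∑ i, mpd (Pi.single i 2) ψ x) = pairing (g j) ψ

/-- `v ∈ H¹₀(Ω)`: the closure of `C_c^∞(Ω)` in the `W^{1,2}` norm. -/
def MemH10 {d : ℕ} (v : L2 d) : Prop :=
  ∃ (g : Fin d → L2 d) (ψ : ℕ → (Fin d → ℝ) → ℝ), (∀ n, IsTest (ψ n)) ∧
    Tendsto (fun n => eLpNorm (fun x => ψ n x - v x) 2 (volume.restrict (cube d))) atTop (𝓝 0) ∧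
    ∀ i, Tendsto (fun n => eLpNorm (fun x => pd i (ψ n) x - g i x) 2
      (volume.restrict (cube d))) atTop (𝓝 0)

/-! ### The direction splitting operators -/

/-- `φ ∈ D(A)` and `A φ = h`, where `A = (1 - ∂_{11}) ⋯ (1 - ∂_{dd})`. Here `w d = φ`, and
`w i = (1 - ∂ᵢᵢ) w (i+1)` with a homogeneous Neumann condition in the direction `i`, so that the
factor of the last direction acts first and `w 0 = A φ`. -/
def IsA {d : ℕ} (φ h : L2 d) : Prop :=
  ZeroMean φ ∧ ∃ w : Fin (d + 1) → L2 d, w (Fin.last d) = φ ∧ w 0 = h ∧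
    ∀ i : Fin d, ∃ a : L2 d, IsNeumannSecond i (w i.succ) a ∧ w i.castSucc = w i.succ - a

/-- The formal operator `B = ∑_{|S| ≥ 2} (-τ/2)^{|S|-2} ∏_{i ∈ S} ∂ᵢᵢ` on smooth functions, i.e.
`∂_{xxyy}` if `d = 2` and `∂_{xxyy} + ∂_{yyzz} + ∂_{zzxx} - (τ/2) ∂_{xxyyzz}` if `d = 3`. -/
def formalB {d : ℕ} (τ : ℝ) (ψ : (Fin d → ℝ) → ℝ) : (Fin d → ℝ) → ℝ := fun x =>
  ∑ S : Finset (Fin d) with 2 ≤ S.card, (-τ / 2) ^ (S.card - 2) * mpd (2 • ind S) ψ x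

/-- `v ∈ D(B)` and `B v = g`: `v ∈ H¹₀(Ω)^d` and `B v = g ∈ L²(Ω)^d` as distributions
(`B` has even order in each variable, so it is formally self-adjoint). -/
def IsB {d : ℕ} (τ : ℝ) (v g : VL2 d) : Prop :=
  (∀ j, MemH10 (v j)) ∧ ∀ j, ∀ ψ, IsTest ψ → pairing (v j) (formalB τ ψ) = pairing (g j) ψ

/-! ### Norms

These are `[0,∞]`-valued: they are `∞` outside of the space on which the norm lives. The weak
derivatives over which the infima run are unique if they exist. -/

/-- The `L²(Ω)^d` norm. -/
def normL2 {d : ℕ} (v : VL2 d) : ℝ≥0∞ := ENNReal.ofReal ‖v‖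

/-- `‖v‖_{H¹} = ‖∇ v‖_{L²}`. -/
def normH1 {d : ℕ} (v : VL2 d) : ℝ≥0∞ :=
  ⨅ (G : Fin d → VL2 d) (_ : ∀ i j, IsWeakDeriv (Pi.single i 1) (v j) (G i j)),
    ENNReal.ofReal (Real.sqrt (∑ i, ‖G i‖ ^ 2))

/-- The norm `‖q‖_A` of `Y`, the extension of `⟨A q, q⟩^{1/2}`: the space `Y` consists of the
zero-mean `q` with `∂_S q ∈ L²(Ω)` for all sets `S` of directions, and
`‖q‖_A² = ∑_S ‖∂_S q‖²`. -/
def normA {d : ℕ} (q : L2 d) : ℝ≥0∞ :=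
  ⨅ (G : Finset (Fin d) → L2 d) (_ : ZeroMean q ∧ ∀ S, IsWeakDeriv (ind S) q (G S)),
    ENNReal.ofReal (Real.sqrt (∑ S, ‖G S‖ ^ 2))

/-- `‖v‖_B = ⟨v, B v⟩^{1/2}` for `v ∈ D(B)`. -/
def normB {d : ℕ} (τ : ℝ) (v : VL2 d) : ℝ≥0∞ :=
  ⨅ (g : VL2 d) (_ : IsB τ v g), ENNReal.ofReal (Real.sqrt (inner ℝ v g))

/-- The time increment `δψ^k = ψ^k - ψ^{k-1}`, used for `k ≥ 1`. -/
def incr {E : Type*} [AddCommGroup E] (ψ : ℕ → E) (k : ℕ) : E := ψ k - ψ (k - 1)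

/-- The discrete `ℓ^∞` norm over the indices `1, …, N`. -/
def linfNorm {E : Type*} (N : ℕ) (nrm : E → ℝ≥0∞) (ψ : ℕ → E) : ℝ≥0∞ :=
  ⨆ k ∈ Finset.Icc 1 N, nrm (ψ k)

/-- The discrete `ℓ²` norm over the indices `1, …, N`, with time step `τ`. -/
def l2Norm {E : Type*} (τ : ℝ) (N : ℕ) (nrm : E → ℝ≥0∞) (ψ : ℕ → E) : ℝ≥0∞ :=
  (ENNReal.ofReal τ * ∑ k ∈ Finset.Icc 1 N, nrm (ψ k) ^ 2) ^ (1 / 2 : ℝ)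

/-! ### Regularity in time -/

/-- `g ∈ W^{m,∞}(0,T;F)`, `g` being the continuous representative on `[0,T]` (for `m ≥ 1`):
`V j` is the `j`-th derivative. -/
def MemWInfty {F : Type*} [NormedAddCommGroup F] [NormedSpace ℝ F] (m : ℕ) (T : ℝ) (g : ℝ → F) :
    Prop :=
  ∃ V : ℕ → ℝ → F, (∀ t ∈ Icc 0 T, V 0 t = g t) ∧
    (∀ j ≤ m, MemLp (V j) ⊤ (volume.restrict (Icc 0 T))) ∧
    ∀ j < m, ∀ t ∈ Icc 0 T, V j t = V j 0 + ∫ s in (0 : ℝ)..t, V (j + 1) s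

/-- `u ∈ W^{m,∞}(0,T;H²(Ω)^d)`: as `v ↦ (∂^α v)_{|α| ≤ 2}` identifies `H²(Ω)` with a closed
subspace of a power of `L²(Ω)`, this says that all `∂^α u`, `|α| ≤ 2`, are in
`W^{m,∞}(0,T;L²(Ω)^d)`. -/
def MemWInftyH2 {d : ℕ} (m : ℕ) (T : ℝ) (u : ℝ → VL2 d) : Prop :=
  ∀ α : Fin d → ℕ, ∑ i, α i ≤ 2 → ∃ g : ℝ → VL2 d, MemWInfty m T g ∧
    ∀ t ∈ Icc 0 T, ∀ j, IsWeakDeriv α (u t j) (g t j)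

/-- `u ∈ W^{m,∞}(0,T;D(B))`, where `D(B)` has the graph norm: both `u` and `B u` are in
`W^{m,∞}(0,T;L²(Ω)^d)`, and `u(t) ∈ D(B)`. -/
def MemWInftyDB {d : ℕ} (τ : ℝ) (m : ℕ) (T : ℝ) (u : ℝ → VL2 d) : Prop :=
  MemWInfty m T u ∧ ∃ g : ℝ → VL2 d, MemWInfty m T g ∧ ∀ t ∈ Icc 0 T, IsB τ (u t) (g t)

/-- `p ∈ W^{m,∞}(0,T;Y)`: `p(t)` has zero mean, and all `∂_S p` are in `W^{m,∞}(0,T;L²(Ω))`. -/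
def MemWInftyY {d : ℕ} (m : ℕ) (T : ℝ) (p : ℝ → L2 d) : Prop :=
  (∀ t ∈ Icc 0 T, ZeroMean (p t)) ∧
  ∀ S : Finset (Fin d), ∃ g : ℝ → L2 d, MemWInfty m T g ∧
    ∀ t ∈ Icc 0 T, IsWeakDeriv (ind S) (p t) (g t)

/-! ### The Stokes problem -/

/-- `(u, p)` solves the time-dependent Stokes system with source term `f` and initial velocity
`u₀` on `[0,T]`. -/
structure IsStokesSolution {d : ℕ} (T : ℝ) (f : ℝ → VL2 d) (u₀ : VL2 d) (u : ℝ → VL2 d)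
    (p : ℝ → L2 d) : Prop where
  momentum : ∀ t ∈ Ioc 0 T, ∃ ut L G : VL2 d, HasDerivWithinAt u ut (Icc 0 T) t ∧
    IsWeakLaplacian (u t) L ∧ IsWeakGrad (p t) G ∧ ut - L + G = f t
  incompressible : ∀ t ∈ Icc 0 T, IsWeakDiv (u t) 0
  boundary : ∀ t ∈ Ioc 0 T, ∀ j, MemH10 (u t j)
  initial : u 0 = u₀

/-! ### The scheme -/

/-- The velocity update `u^k ↦ u^{k+1}`, with `G = ∇ p^{⋆,k+1/2}` and `F = f^{k+1/2}`:
Peaceman–Rachford if `d = 2`, Douglas if `d = 3`.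

For `d = 2`, `w = u^{k+1/2}`, `a = ∂_{xx} u^{k+1/2}`, `b = ∂_{yy} u^k`, `c = ∂_{yy} u^{k+1}`.
For `d = 3`, `D i = ∂ᵢᵢ u^k` (so that `∑ i, D i = Δ u^k`), `a = ∂_{xx} η`, `b = ∂_{yy} ζ`,
`c = ∂_{zz} u^{k+1}`. The field `ξ` is given explicitly by its equation; no boundary condition
is imposed on it. -/
def VelocityStep : (d : ℕ) → (τ : ℝ) → (uk uk1 G F : VL2 d) → Prop
  | 2 => fun τ uk uk1 G F => ∃ w a b c : VL2 2,
      (∀ j, IsDirichletSecond 0 (w j) (a j)) ∧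
      (∀ j, IsWeakDeriv (Pi.single 1 2) (uk j) (b j)) ∧
      (∀ j, IsDirichletSecond 1 (uk1 j) (c j)) ∧
      (τ / 2)⁻¹ • (w - uk) - a - b + G = F ∧
      (τ / 2)⁻¹ • (uk1 - w) - a - c + G = F
  | 3 => fun τ uk uk1 G F => ∃ (ξ η ζ a b c : VL2 3) (D : Fin 3 → VL2 3),
      (∀ i j, IsWeakDeriv (Pi.single i 2) (uk j) (D i j)) ∧
      (∀ j, IsDirichletSecond 0 (η j) (a j)) ∧
      (∀ j, IsDirichletSecond 1 (ζ j) (b j)) ∧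
      (∀ j, IsDirichletSecond 2 (uk1 j) (c j)) ∧
      τ⁻¹ • (ξ - uk) - ∑ i, D i + G = F ∧
      τ⁻¹ • (η - ξ) - (1 / 2 : ℝ) • (a - D 0) = 0 ∧
      τ⁻¹ • (ζ - η) - (1 / 2 : ℝ) • (b - D 1) = 0 ∧
      τ⁻¹ • (uk1 - ζ) - (1 / 2 : ℝ) • (c - D 2) = 0
  | _ => fun _ _ _ _ _ => False

/-- The direction splitting scheme with parameter `χ`, run for `N` steps of length `τ`.
`U k = u^k`, `P k = p^{k-1/2}`, `Φ k = φ^{k-1/2}`; the pressure predictor is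
`p^{⋆,k+1/2} = P k + Φ k`. -/
structure IsSchemeSolution {d : ℕ} (χ τ : ℝ) (N : ℕ) (f : ℝ → VL2 d) (u₀ : VL2 d)
    (p₀ φstar : L2 d) (U : ℕ → VL2 d) (P Φ : ℕ → L2 d) : Prop where
  init_velocity : U 0 = u₀
  init_pressure : P 0 = p₀
  init_correction : Φ 0 = φstar
  velocity : ∀ k < N, ∃ G : VL2 d, IsWeakGrad (P k + Φ k) G ∧
    VelocityStep d τ (U k) (U (k + 1)) G (f (((k : ℝ) + 1 / 2) * τ))
  penalty : ∀ k < N, ∃ D : L2 d, IsWeakDiv (U (k + 1)) D ∧ IsA (Φ (k + 1)) (-(τ⁻¹ • D))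
  pressure : ∀ k < N, ∃ D : L2 d, IsWeakDiv ((1 / 2 : ℝ) • (U (k + 1) + U k)) D ∧
    P (k + 1) = P k + Φ (k + 1) - χ • D

/-- The velocity error `e^k = u(t_k) - u^k`. -/
def velError {d : ℕ} (τ : ℝ) (u : ℝ → VL2 d) (U : ℕ → VL2 d) (k : ℕ) : VL2 d :=
  u ((k : ℝ) * τ) - U k

/-- The pressure error `ε^{k-1/2} = p(t_{k-1/2}) - p^{k-1/2}` for `k ≥ 1`. As `p^{-1/2}` is the
initial pressure, the error with index `-1/2` is `p(0) - p^{-1/2}`. -/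
def presError {d : ℕ} (τ : ℝ) (p : ℝ → L2 d) (P : ℕ → L2 d) : ℕ → L2 d
  | 0 => p 0 - P 0
  | k + 1 => p (((k : ℝ) + 1 / 2) * τ) - P (k + 1)

end DirSplit

end

/-!
In the sine and cosine expansions, eliminating the intermediate fields turns one step of either
scheme into the perturbed Crank–Nicolson step
`(1 + (τ²/4) B) (u^{k+1} - u^k) - (τ/2) Δ (u^{k+1} + u^k) = τ (f - ∇p⋆)`,
and the pressure correction is `τ⁻¹` times the adjoint of the gradient `Y → L²`, a contraction,
applied to `u^{k+1}`. Conjugation with `(1 + (τ²/4) B)^{1/2}` makes all operators bounded, and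
stability becomes a statement on Hilbert spaces: with `A` the image of `-Δ` and `G` that of the
adjoint of the gradient, the energy of the auxiliary velocity
`(1 - (3/4) G†G)⁻¹ (e + (τ/2) (A e + G†ρ))` is nonincreasing up to the sources.

The increments of the errors solve the same scheme. For them the pressure predictor is the
extrapolation `2 r^k - r^{k-1}`, so that the consistency error of a step is `O(τ³)`, except in the
first two steps, where it is `O(τ²)`. Hence these errors sum to `O(τ²)`.
-/

noncomputable section

namespace DirSplit

open ContinuousLinearMap (adjoint)

/-! ### Stability of perturbed splitting schemes in Hilbert spaces -/

section Stability

open ContinuousLinearMap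

variable {V Y : Type*} [NormedAddCommGroup V] [InnerProductSpace ℝ V]
  [NormedAddCommGroup Y] [InnerProductSpace ℝ Y] {G : V →L[ℝ] Y} {τ : ℝ}

/-- The symmetric form of the operator `1 - (3/4) G† G`. The factor `3/4` is the one for which the
reflection of `IsPerturbedSplitting.shadow_jump` produces the extrapolated pressure `2 r - ρ`. -/
def energyForm (G : V →L[ℝ] Y) : V →L[ℝ] V →L[ℝ] ℝ :=
  innerSL ℝ - (3 / 4 : ℝ) • (innerSL ℝ).bilinearComp G G

lemma energyForm_apply (v w : V) :
    energyForm G v w = inner ℝ v w - 3 / 4 * inner ℝ (G v) (G w) := rfl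

lemma energyForm_comm (v w : V) : energyForm G v w = energyForm G w v := by
  simp only [energyForm_apply, real_inner_comm]

lemma quarter_norm_sq_le_energyForm (hG : ‖G‖ ≤ 1) (v : V) :
    1 / 4 * ‖v‖ ^ 2 ≤ energyForm G v v := by
  have hGv : ‖G v‖ ≤ ‖v‖ := G.le_of_opNorm_le_of_le hG le_rfl |>.trans_eq (one_mul _)
  simp only [energyForm_apply, real_inner_self_eq_norm_sq]
  nlinarith [pow_le_pow_left₀ (norm_nonneg (G v)) hGv 2]

lemma energyForm_self_nonneg (hG : ‖G‖ ≤ 1) (v : V) : 0 ≤ energyForm G v v :=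
  le_trans (by positivity) (quarter_norm_sq_le_energyForm hG v)

lemma exists_forall_energyForm_eq_inner [CompleteSpace V] (hG : ‖G‖ ≤ 1) (F : V) :
    ∃ v : V, ∀ w, energyForm G v w = inner ℝ F w := by
  have hcoercive : IsCoercive (energyForm G) := ⟨1 / 4, by norm_num, fun v => by
    simpa only [sq, mul_assoc] using quarter_norm_sq_le_energyForm hG v⟩
  refine ⟨hcoercive.continuousLinearEquivOfBilin.symm F, fun w => ?_⟩
  rw [← hcoercive.continuousLinearEquivOfBilin_apply, ContinuousLinearEquiv.apply_symm_apply]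

lemma energyForm_self_le_of_source (hG : ‖G‖ ≤ 1) {v F : V}
    (hv : ∀ w, energyForm G v w = inner ℝ F w) : energyForm G v v ≤ (2 * ‖F‖) ^ 2 := by
  have hle : energyForm G v v ≤ ‖F‖ * ‖v‖ := hv v ▸ real_inner_le_norm F v
  nlinarith [quarter_norm_sq_le_energyForm hG v, sq_nonneg (‖v‖ - 4 * ‖F‖)]

/-- The discrete energy of a velocity `v` and a pressure `ρ`, the Lyapunov functional of the
stability proof. -/
def energy (G : V →L[ℝ] Y) (τ : ℝ) (v : V) (ρ : Y) : ℝ :=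
  energyForm G v v + τ ^ 2 * ‖ρ‖ ^ 2

lemma energy_nonneg (hG : ‖G‖ ≤ 1) (v : V) (ρ : Y) : 0 ≤ energy G τ v ρ := by
  have := energyForm_self_nonneg hG v
  unfold energy
  positivity

lemma norm_le_two_mul_sqrt_energy (hG : ‖G‖ ≤ 1) (v : V) (ρ : Y) :
    ‖v‖ ≤ 2 * √(energy G τ v ρ) := by
  have hsq : (‖v‖ / 2) ^ 2 ≤ energy G τ v ρ := by
    have := quarter_norm_sq_le_energyForm hG v
    have : 0 ≤ τ ^ 2 * ‖ρ‖ ^ 2 := by positivity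
    unfold energy
    linarith
  linarith [Real.le_sqrt_of_sq_le hsq]

lemma mul_norm_le_sqrt_energy (hG : ‖G‖ ≤ 1) (v : V) (ρ : Y) :
    τ * ‖ρ‖ ≤ √(energy G τ v ρ) := by
  refine Real.le_sqrt_of_sq_le ?_
  rw [mul_pow, energy, le_add_iff_nonneg_left]
  exact energyForm_self_nonneg hG v

lemma energy_add_smul (t : ℝ) (v w : V) (ρ σ : Y) :
    energy G τ (v + t • w) (ρ + t • σ) = energy G τ w σ * (t * t)
      + 2 * (energyForm G v w + τ ^ 2 * inner ℝ ρ σ) * t + energy G τ v ρ := by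
  simp only [energy, map_add, map_smul, add_apply, smul_apply, smul_eq_mul,
    energyForm_comm w v, ← real_inner_self_eq_norm_sq, inner_add_left, inner_add_right,
    real_inner_smul_left, real_inner_smul_right, real_inner_comm ρ σ]
  ring

lemma sqrt_energy_add_le (hG : ‖G‖ ≤ 1) (v w : V) (ρ σ : Y) :
    √(energy G τ (v + w) (ρ + σ)) ≤ √(energy G τ v ρ) + √(energy G τ w σ) := by
  set b := energyForm G v w + τ ^ 2 * inner ℝ ρ σ
  have hv := energy_nonneg (τ := τ) hG v ρ
  have hw := energy_nonneg (τ := τ) hG w σ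
  have cauchySchwarz : b ^ 2 ≤ energy G τ v ρ * energy G τ w σ := by
    have hdiscrim := discrim_le_zero (fun t => energy_add_smul (G := G) (τ := τ) t v w ρ σ ▸
      energy_nonneg hG (v + t • w) (ρ + t • σ))
    rw [discrim] at hdiscrim
    linarith
  have hb : b ≤ √(energy G τ v ρ) * √(energy G τ w σ) := by
    rw [← Real.sqrt_mul hv]
    exact Real.le_sqrt_of_sq_le cauchySchwarz
  have hexpand := energy_add_smul (G := G) (τ := τ) 1 v w ρ σ
  rw [one_smul, one_smul] at hexpand
  refine Real.sqrt_le_iff.2 ⟨by positivity, ?_⟩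
  rw [hexpand, add_sq, Real.sq_sqrt hv, Real.sq_sqrt hw]
  linarith

lemma sqrt_energy_le_of_source (hG : ‖G‖ ≤ 1) (hτ : 0 ≤ τ) {v F : V}
    (hv : ∀ w, energyForm G v w = inner ℝ F w) (ρ : Y) :
    √(energy G τ v ρ) ≤ 2 * ‖F‖ + τ * ‖ρ‖ := by
  refine Real.sqrt_le_iff.2 ⟨by positivity, ?_⟩
  have : 0 ≤ ‖F‖ * (τ * ‖ρ‖) := by positivity
  rw [energy, add_sq, mul_pow τ]
  linarith [energyForm_self_le_of_source hG hv]

lemma le_and_sum_le_of_dissipation {n : ℕ} {a b c D : ℕ → ℝ} {Γ : ℝ} (ha : ∀ k, 0 ≤ a k)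
    (hb : ∀ k, 0 ≤ b k) (hc : ∀ k, 0 ≤ c k) (hD : ∀ k, 0 ≤ D k) (ha₀ : a 0 = 0)
    (hdiss : ∀ k ≤ n, b k ^ 2 + D k ≤ a k ^ 2) (hjump : ∀ k < n, a (k + 1) ≤ b k + c k)
    (hΓ : ∑ k ∈ Finset.range n, c k ≤ Γ) :
    (∀ k ≤ n, b k ≤ a k ∧ a k ≤ Γ) ∧ ∑ k ∈ Finset.range (n + 1), D k ≤ 2 * Γ ^ 2 := by
  have hba (k) (hk : k ≤ n) : b k ≤ a k :=
    le_of_sq_le_sq (by linarith [hdiss k hk, hD k]) (ha k)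
  have hsum_c (k) (hk : k ≤ n) : ∑ j ∈ Finset.range k, c j ≤ Γ :=
    (Finset.sum_le_sum_of_subset_of_nonneg (Finset.range_mono hk) fun j _ _ => hc j).trans hΓ
  have ha_sum (k) (hk : k ≤ n) : a k ≤ ∑ j ∈ Finset.range k, c j := by
    induction k with
    | zero => simp [ha₀]
    | succ k ih =>
      rw [Finset.sum_range_succ]
      linarith [hjump k hk, hba k (by omega), ih (by omega)]
  have haΓ (k) (hk : k ≤ n) : a k ≤ Γ := (ha_sum k hk).trans (hsum_c k hk)
  have hΓ₀ : 0 ≤ Γ := ha₀ ▸ haΓ 0 n.zero_le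
  have sq_jump (k) (hk : k < n) : a (k + 1) ^ 2 ≤ b k ^ 2 + 2 * Γ * c k := by
    nlinarith [hjump k hk, haΓ (k + 1) hk, hba k hk.le, haΓ k hk.le, ha (k + 1), hb k, hc k]
  have htelescope (k) (hk : k ≤ n) :
      ∑ j ∈ Finset.range k, D j + a k ^ 2 ≤ 2 * Γ * ∑ j ∈ Finset.range k, c j := by
    induction k with
    | zero => simp [ha₀]
    | succ k ih =>
      rw [Finset.sum_range_succ, Finset.sum_range_succ, mul_add]
      linarith [ih (by omega), hdiss k (by omega), sq_jump k hk]
  refine ⟨fun k hk => ⟨hba k hk, haΓ k hk⟩, ?_⟩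
  rw [Finset.sum_range_succ]
  nlinarith [htelescope n le_rfl, hdiss n le_rfl, hsum_c n le_rfl, sq_nonneg (b n)]

variable [CompleteSpace V] [CompleteSpace Y] {A : V →L[ℝ] V}

/-- A time-discrete Stokes problem with incremental pressure penalty, in abstract form: `e` is the
velocity, `r` the pressure, `A` the diffusion, `-G` the divergence and `G†` the gradient. The
sequence `ρ` is the pressure of the previous step, up to the perturbation `σ`, so that `2 r - ρ` is
the extrapolated pressure; `ψ` is the source term. -/
structure IsPerturbedSplitting (G : V →L[ℝ] Y) (A : V →L[ℝ] V) (τ : ℝ) (n : ℕ) (e : ℕ → V)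
    (r ρ σ : ℕ → Y) (ψ : ℕ → V) : Prop where
  velocity_zero : e 0 = 0
  pressure_zero : r 0 = 0
  shift_zero : ρ 0 = 0
  momentum : ∀ k < n, e (k + 1) - e k + (τ / 2) • A (e (k + 1) + e k)
    + τ • adjoint G ((2 : ℝ) • r k - ρ k) = ψ k
  shift : ∀ k < n, ρ (k + 1) = r k + σ k
  penalty : ∀ k < n, r (k + 1) = ρ (k + 1) + τ⁻¹ • G (e (k + 1))

/-- `v` is the auxiliary velocity `(1 - (3/4) G† G)⁻¹ (e + (τ/2) (A e + G† ρ))`, whose energy is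
monotone up to the perturbations although that of `e` is not. -/
def IsShadow (G : V →L[ℝ] Y) (A : V →L[ℝ] V) (τ : ℝ) (e : V) (ρ : Y) (v : V) : Prop :=
  ∀ w, energyForm G v w = inner ℝ (e + (τ / 2) • (A e + adjoint G ρ)) w

lemma exists_isShadow (hG : ‖G‖ ≤ 1) (A : V →L[ℝ] V) (τ : ℝ) (e : V) (ρ : Y) :
    ∃ v, IsShadow G A τ e ρ v :=
  exists_forall_energyForm_eq_inner hG _

lemma IsShadow.energy_reflection {e v : V} {r ρ : Y} (hv : IsShadow G A τ e ρ v)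
    (hG : G e = τ • (r - ρ)) :
    energy G τ ((2 : ℝ) • e - v) r + 2 * τ * inner ℝ (A e) e + 2 * τ ^ 2 * ‖r - ρ‖ ^ 2
      = energy G τ v ρ := by
  have hexpand : energyForm G ((2 : ℝ) • e - v) ((2 : ℝ) • e - v)
      = energyForm G v v + 4 * energyForm G e e - 4 * energyForm G v e := by
    simp only [map_sub, map_smul, sub_apply, smul_apply, smul_eq_mul, energyForm_comm e v]
    ring
  have hee : energyForm G e e = inner ℝ e e - 3 / 4 * τ ^ 2 * ‖r - ρ‖ ^ 2 := by
    rw [energyForm_apply, hG, real_inner_self_eq_norm_sq (τ • _), norm_smul, mul_pow,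
      Real.norm_eq_abs, sq_abs, mul_assoc]
  have hve : energyForm G v e
      = inner ℝ e e + τ / 2 * inner ℝ (A e) e + τ ^ 2 / 2 * (inner ℝ ρ r - ‖ρ‖ ^ 2) := by
    rw [hv, inner_add_left, real_inner_smul_left, inner_add_left, adjoint_inner_left, hG,
      real_inner_smul_right, inner_sub_right, real_inner_self_eq_norm_sq ρ]
    ring
  rw [energy, energy, hexpand, hee, hve, norm_sub_sq_real, real_inner_comm r ρ]
  ring

namespace IsPerturbedSplitting

variable {n : ℕ} {e : ℕ → V} {r ρ σ : ℕ → Y} {ψ : ℕ → V}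

lemma map_velocity (h : IsPerturbedSplitting G A τ n e r ρ σ ψ) (hτ : τ ≠ 0) {k : ℕ}
    (hk : k ≤ n) : G (e k) = τ • (r k - ρ k) := by
  cases k with
  | zero => simp [h.velocity_zero, h.pressure_zero, h.shift_zero]
  | succ k => rw [h.penalty k hk, add_sub_cancel_left, smul_inv_smul₀ hτ]

lemma shadow_jump (h : IsPerturbedSplitting G A τ n e r ρ σ ψ) (hτ : τ ≠ 0) {k : ℕ} (hk : k < n)
    {v v' : V} (hv : IsShadow G A τ (e k) (ρ k) v)
    (hv' : IsShadow G A τ (e (k + 1)) (ρ (k + 1)) v') (w : V) :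
    energyForm G (v' - ((2 : ℝ) • e k - v)) w
      = inner ℝ (ψ k + (τ / 2) • adjoint G (σ k)) w := by
  have hew : energyForm G (e k) w
      = inner ℝ (e k - (3 / 4 * τ) • adjoint G (r k - ρ k)) w := by
    rw [energyForm_apply, h.map_velocity hτ hk.le, inner_sub_left, real_inner_smul_left,
      real_inner_smul_left, adjoint_inner_left, mul_assoc]
  rw [map_sub, map_sub, map_smul, sub_apply, sub_apply, smul_apply, hv, hv', hew,
    h.shift k hk, ← h.momentum k hk]
  simp only [map_add, map_sub, map_smul, inner_add_left, inner_sub_left, real_inner_smul_left,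
    smul_eq_mul]
  ring

lemma sqrt_energy_jump (h : IsPerturbedSplitting G A τ n e r ρ σ ψ) (hG : ‖G‖ ≤ 1) (hτ : 0 < τ)
    {k : ℕ} (hk : k < n) {v v' : V} (hv : IsShadow G A τ (e k) (ρ k) v)
    (hv' : IsShadow G A τ (e (k + 1)) (ρ (k + 1)) v') :
    √(energy G τ v' (ρ (k + 1)))
      ≤ √(energy G τ ((2 : ℝ) • e k - v) (r k)) + (2 * ‖ψ k‖ + 2 * (τ * ‖σ k‖)) := by
  have hsource := sqrt_energy_le_of_source hG hτ.le (h.shadow_jump hτ.ne' hk hv hv') (σ k)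
  have htriangle := sqrt_energy_add_le (τ := τ) hG ((2 : ℝ) • e k - v)
    (v' - ((2 : ℝ) • e k - v)) (r k) (σ k)
  rw [add_sub_cancel, ← h.shift k hk] at htriangle
  have hnorm : ‖ψ k + (τ / 2) • adjoint G (σ k)‖ ≤ ‖ψ k‖ + τ / 2 * ‖σ k‖ := by
    refine norm_add_le_of_le le_rfl ?_
    rw [norm_smul, Real.norm_of_nonneg (by positivity)]
    gcongr
    have hG' : ‖adjoint G‖ ≤ 1 := by rwa [LinearIsometryEquiv.norm_map]
    exact ((adjoint G).le_of_opNorm_le hG' (σ k)).trans_eq (one_mul _)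
  linarith

theorem stability (h : IsPerturbedSplitting G A τ n e r ρ σ ψ) (hG : ‖G‖ ≤ 1)
    (hA : ∀ v, 0 ≤ inner ℝ (A v) v) (hτ : 0 < τ) {Γ : ℝ}
    (hΓ : ∑ k ∈ Finset.range n, (2 * ‖ψ k‖ + 2 * (τ * ‖σ k‖)) ≤ Γ) :
    (∀ k ≤ n, ‖e k‖ ≤ 2 * Γ ∧ τ * ‖r k‖ ≤ Γ) ∧
      τ * ∑ k ∈ Finset.range (n + 1), inner ℝ (A (e k)) (e k) ≤ Γ ^ 2 := by
  choose v hv using fun k => exists_isShadow hG A τ (e k) (ρ k)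
  let a (k : ℕ) := √(energy G τ (v k) (ρ k))
  let b (k : ℕ) := √(energy G τ ((2 : ℝ) • e k - v k) (r k))
  have ha₀ : a 0 = 0 := by
    have hv₀ := hv 0 (v 0)
    simp only [h.velocity_zero, h.shift_zero, map_zero, add_zero, smul_zero,
      inner_zero_left] at hv₀
    simp [a, energy, hv₀, h.shift_zero]
  have hdiss (k) (hk : k ≤ n) : b k ^ 2 + 2 * τ * inner ℝ (A (e k)) (e k) ≤ a k ^ 2 := by
    rw [Real.sq_sqrt (energy_nonneg hG _ _), Real.sq_sqrt (energy_nonneg hG _ _),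
      ← (hv k).energy_reflection (h.map_velocity hτ.ne' hk), le_add_iff_nonneg_right]
    positivity
  obtain ⟨hbound, hsum⟩ := le_and_sum_le_of_dissipation (a := a) (b := b)
    (fun k => Real.sqrt_nonneg _) (fun k => Real.sqrt_nonneg _) (fun k => by positivity)
    (fun k => mul_nonneg (by positivity) (hA (e k))) ha₀ hdiss
    (fun k hk => h.sqrt_energy_jump hG hτ hk (hv k) (hv (k + 1))) hΓ
  refine ⟨fun k hk => ⟨?_, ?_⟩, ?_⟩
  · have hsplit : 2 * ‖e k‖ ≤ ‖(2 : ℝ) • e k - v k‖ + ‖v k‖ := by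
      simpa only [norm_smul, Real.norm_ofNat] using norm_le_norm_sub_add ((2 : ℝ) • e k) (v k)
    linarith [hbound k hk, norm_le_two_mul_sqrt_energy (τ := τ) hG (v k) (ρ k),
      norm_le_two_mul_sqrt_energy (τ := τ) hG ((2 : ℝ) • e k - v k) (r k)]
  · exact (mul_norm_le_sqrt_energy hG _ _).trans ((hbound k hk).1.trans (hbound k hk).2)
  · rw [← Finset.mul_sum] at hsum
    linarith

end IsPerturbedSplitting

end Stability

/-! ### Functions on the cube as elements of `L²` -/

variable {d : ℕ}

/-- Lebesgue measure on the cube. -/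
abbrev cubeMeas (d : ℕ) : Measure (Fin d → ℝ) := volume.restrict (cube d)

lemma cubeMeas_eq_pi (d : ℕ) :
    cubeMeas d = Measure.pi fun _ : Fin d => (volume : Measure ℝ).restrict (Ioo 0 1) := by
  rw [cubeMeas, cube, volume_pi, Measure.restrict_pi_pi]

lemma isOpen_cube (d : ℕ) : IsOpen (cube d) := isOpen_set_pi finite_univ fun _ _ => isOpen_Ioo

lemma measurableSet_cube (d : ℕ) : MeasurableSet (cube d) := (isOpen_cube d).measurableSet

lemma mem_cube {x : Fin d → ℝ} : x ∈ cube d ↔ ∀ i, x i ∈ Ioo (0 : ℝ) 1 := by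
  simp [cube]

lemma ae_mem_cube (d : ℕ) : ∀ᵐ x ∂cubeMeas d, x ∈ cube d := ae_restrict_mem (measurableSet_cube d)

/-- The closed unit cube `[0,1]^d`. -/
def closedCube (d : ℕ) : Set (Fin d → ℝ) := Set.pi univ fun _ => Icc 0 1

lemma isCompact_closedCube (d : ℕ) : IsCompact (closedCube d) :=
  isCompact_univ_pi fun _ => isCompact_Icc

lemma cube_subset_closedCube (d : ℕ) : cube d ⊆ closedCube d :=
  Set.pi_mono fun _ _ => Ioo_subset_Icc_self

instance isFiniteMeasure_cubeMeas (d : ℕ) : IsFiniteMeasure (cubeMeas d) :=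
  isFiniteMeasure_restrict.2
    ((measure_mono (cube_subset_closedCube d)).trans_lt (isCompact_closedCube d).measure_lt_top).ne

lemma memLp_of_continuous {F : (Fin d → ℝ) → ℝ} (hF : Continuous F) (p : ℝ≥0∞) :
    MemLp F p (cubeMeas d) := by
  obtain ⟨C, hC⟩ := (isCompact_closedCube d).exists_bound_of_continuousOn hF.continuousOn
  refine MemLp.of_bound hF.aestronglyMeasurable C ?_
  filter_upwards [ae_mem_cube d] with x hx using hC x (cube_subset_closedCube d hx)

/-- The class in `L²(Ω)` of a square integrable function, and `0` if the function is not square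
integrable. -/
def toL2 (F : (Fin d → ℝ) → ℝ) : L2 d :=
  open Classical in if h : MemLp F 2 (cubeMeas d) then h.toLp F else 0

lemma coeFn_toL2 {F : (Fin d → ℝ) → ℝ} (hF : Continuous F) : toL2 F =ᵐ[cubeMeas d] F := by
  rw [toL2, dif_pos (memLp_of_continuous hF 2)]
  exact MemLp.coeFn_toLp _

lemma inner_L2_eq (v w : L2 d) : inner ℝ v w = ∫ x in cube d, v x * w x := by
  simp only [L2.inner_def, RCLike.inner_apply, conj_trivial, mul_comm]

lemma pairing_eq_inner (v : L2 d) {ψ : (Fin d → ℝ) → ℝ} (hψ : Continuous ψ) :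
    pairing v ψ = inner ℝ v (toL2 ψ) := by
  rw [pairing, inner_L2_eq]
  refine integral_congr_ae ?_
  filter_upwards [coeFn_toL2 hψ] with x hx
  rw [hx]

lemma pairing_toL2 {F : (Fin d → ℝ) → ℝ} (hF : Continuous F) (ψ : (Fin d → ℝ) → ℝ) :
    pairing (toL2 F) ψ = ∫ x in cube d, F x * ψ x := by
  refine integral_congr_ae ?_
  filter_upwards [coeFn_toL2 hF] with x hx
  rw [hx]

lemma inner_toL2 {F G : (Fin d → ℝ) → ℝ} (hF : Continuous F) (hG : Continuous G) :
    inner ℝ (toL2 F : L2 d) (toL2 G) = ∫ x in cube d, F x * G x := by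
  rw [← pairing_eq_inner _ hG, pairing_toL2 hF]

lemma pairing_congr (v : L2 d) {ψ χ : (Fin d → ℝ) → ℝ} (h : EqOn ψ χ (cube d)) :
    pairing v ψ = pairing v χ :=
  setIntegral_congr_fun (measurableSet_cube d) fun x hx => by simp only [h hx]

lemma toL2_add {F G : (Fin d → ℝ) → ℝ} (hF : Continuous F) (hG : Continuous G) :
    toL2 (F + G) = toL2 F + toL2 G := by
  refine Lp.ext ?_
  filter_upwards [coeFn_toL2 hF, coeFn_toL2 hG, coeFn_toL2 (hF.add hG),
    Lp.coeFn_add (toL2 F) (toL2 G)] with x hFx hGx hFGx hsum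
  rw [hsum, hFGx, Pi.add_apply, Pi.add_apply, hFx, hGx]

lemma toL2_smul (c : ℝ) {F : (Fin d → ℝ) → ℝ} (hF : Continuous F) :
    toL2 (c • F) = c • toL2 F := by
  refine Lp.ext ?_
  filter_upwards [coeFn_toL2 hF, coeFn_toL2 (hF.const_smul c),
    Lp.coeFn_smul c (toL2 F)] with x hFx hcFx hsmul
  exact hcFx.trans (by rw [hsmul, Pi.smul_apply, Pi.smul_apply, hFx])

lemma integrable_L2 (v : L2 d) : Integrable v (cubeMeas d) :=
  (Lp.memLp v).integrable one_le_two

lemma tendsto_pairing (v : L2 d) {h : ℕ → (Fin d → ℝ) → ℝ} {h' : (Fin d → ℝ) → ℝ} {C : ℝ}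
    (hcont : ∀ m, Continuous (h m)) (hbound : ∀ m, ∀ x ∈ cube d, |h m x| ≤ C)
    (hlim : ∀ x ∈ cube d, Tendsto (fun m => h m x) atTop (𝓝 (h' x))) :
    Tendsto (fun m => pairing v (h m)) atTop (𝓝 (pairing v h')) := by
  refine tendsto_integral_of_dominated_convergence (fun x => ‖v x‖ * C) (fun m =>
    (Lp.aestronglyMeasurable v).mul (hcont m).aestronglyMeasurable)
    ((integrable_L2 v).norm.mul_const C) (fun m => ?_) ?_
  · filter_upwards [ae_mem_cube d] with x hx
    rw [norm_mul]
    exact mul_le_mul_of_nonneg_left (hbound m x hx) (norm_nonneg _)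
  · filter_upwards [ae_mem_cube d] with x hx using (hlim x hx).const_mul _

/-! ### Products of functions of one variable -/

/-- The tensor product `x ↦ ∏ i, f i (x i)`. -/
def prodFun (f : Fin d → ℝ → ℝ) : (Fin d → ℝ) → ℝ := fun x => ∏ i, f i (x i)

lemma contDiff_prodFun {f : Fin d → ℝ → ℝ} (hf : ∀ i, ContDiff ℝ ∞ (f i)) :
    ContDiff ℝ ∞ (prodFun f) :=
  contDiff_prod fun i _ => (hf i).comp (contDiff_apply ℝ ℝ i)

lemma continuous_prodFun {f : Fin d → ℝ → ℝ} (hf : ∀ i, Continuous (f i)) :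
    Continuous (prodFun f) :=
  continuous_finsetProd _ fun i _ => (hf i).comp (continuous_apply i)

lemma prodFun_update (f : Fin d → ℝ → ℝ) (i : Fin d) (g : ℝ → ℝ) (x : Fin d → ℝ) :
    prodFun (Function.update f i g) x = (∏ j ∈ Finset.univ.erase i, f j (x j)) * g (x i) := by
  rw [prodFun, ← Finset.prod_erase_mul _ _ (Finset.mem_univ i), Function.update_self]
  congr 1
  exact Finset.prod_congr rfl fun j hj => by rw [Function.update_of_ne (Finset.ne_of_mem_erase hj)]

lemma hasFDerivAt_prodFun {f : Fin d → ℝ → ℝ} (hf : ∀ i, Differentiable ℝ (f i))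
    (x : Fin d → ℝ) : HasFDerivAt (prodFun f) (∑ i, (∏ j ∈ Finset.univ.erase i, f j (x j)) •
      deriv (f i) (x i) • (ContinuousLinearMap.proj i : (Fin d → ℝ) →L[ℝ] ℝ)) x :=
  HasFDerivAt.finsetProd fun i _ =>
    (hf i (x i)).hasDerivAt.comp_hasFDerivAt x (hasFDerivAt_apply i x)

lemma pd_prodFun {f : Fin d → ℝ → ℝ} (hf : ∀ i, Differentiable ℝ (f i)) (i : Fin d) :
    pd i (prodFun f) = prodFun (Function.update f i (deriv (f i))) := by
  funext x
  simp [pd, (hasFDerivAt_prodFun hf x).fderiv, prodFun_update, Pi.single_apply]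

lemma contDiff_update_iterate_deriv {f : Fin d → ℝ → ℝ} (hf : ∀ i, ContDiff ℝ ∞ (f i))
    (i : Fin d) (k : ℕ) (j : Fin d) :
    ContDiff ℝ ∞ (Function.update f i (deriv^[k] (f i)) j) := by
  rw [Function.update_apply]
  split_ifs
  exacts [(hf i).iterate_deriv k, hf j]

lemma iterate_pd_prodFun {f : Fin d → ℝ → ℝ} (hf : ∀ i, ContDiff ℝ ∞ (f i)) (i : Fin d) (k : ℕ) :
    (pd i)^[k] (prodFun f) = prodFun (Function.update f i (deriv^[k] (f i))) := by
  induction k with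
  | zero => simp
  | succ k ih =>
    rw [Function.iterate_succ_apply', ih, pd_prodFun fun j =>
      (contDiff_update_iterate_deriv hf i k j).differentiable (by simp), Function.update_idem,
      Function.update_self, Function.iterate_succ_apply']

lemma foldr_pd_prodFun {f : Fin d → ℝ → ℝ} (hf : ∀ i, ContDiff ℝ ∞ (f i)) (α : Fin d → ℕ)
    {l : List (Fin d)} (hl : l.Nodup) :
    l.foldr (fun i h => (pd i)^[α i] h) (prodFun f)
      = prodFun fun i => if i ∈ l then deriv^[α i] (f i) else f i := by
  induction l with
  | nil => simp
  | cons a l ih =>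
    rw [List.nodup_cons] at hl
    have hsmooth (i) : ContDiff ℝ ∞ (if i ∈ l then deriv^[α i] (f i) else f i) := by
      split_ifs
      exacts [(hf i).iterate_deriv _, hf i]
    rw [List.foldr_cons, ih hl.2, iterate_pd_prodFun hsmooth, if_neg hl.1]
    congr 1 with j : 1
    by_cases hj : j = a
    · simp [hj]
    · simp [hj]

lemma mpd_prodFun {f : Fin d → ℝ → ℝ} (hf : ∀ i, ContDiff ℝ ∞ (f i)) (α : Fin d → ℕ) :
    mpd α (prodFun f) = prodFun fun i => deriv^[α i] (f i) := by
  rw [mpd, foldr_pd_prodFun hf α (List.nodup_finRange d)]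
  simp

lemma tsupport_prodFun_subset (f : Fin d → ℝ → ℝ) :
    tsupport (prodFun f) ⊆ Set.pi univ fun i => tsupport (f i) :=
  closure_minimal (fun _ hx i _ => subset_tsupport _ fun h =>
    hx (Finset.prod_eq_zero (Finset.mem_univ i) h))
    (isClosed_set_pi fun _ _ => isClosed_tsupport _)

lemma hasCompactSupport_prodFun {f : Fin d → ℝ → ℝ} (hf : ∀ i, HasCompactSupport (f i)) :
    HasCompactSupport (prodFun f) :=
  (isCompact_univ_pi hf).of_isClosed_subset (isClosed_tsupport _) (tsupport_prodFun_subset f)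

lemma hasCompactSupport_of_tsupport_subset_Ioo {f : ℝ → ℝ} {a b : ℝ} (hf : tsupport f ⊆ Ioo a b) :
    HasCompactSupport f :=
  isCompact_Icc.of_isClosed_subset (isClosed_tsupport _) (hf.trans Ioo_subset_Icc_self)

lemma isTest_prodFun {f : Fin d → ℝ → ℝ} (hf : ∀ i, ContDiff ℝ ∞ (f i))
    (hs : ∀ i, tsupport (f i) ⊆ Ioo 0 1) : IsTest (prodFun f) :=
  ⟨contDiff_prodFun hf,
    hasCompactSupport_prodFun fun i => hasCompactSupport_of_tsupport_subset_Ioo (hs i),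
    (tsupport_prodFun_subset f).trans (Set.pi_mono fun i _ => hs i)⟩

lemma integrable_mul_L2 (v : L2 d) {F : (Fin d → ℝ) → ℝ} (hF : Continuous F) :
    Integrable (fun x => v x * F x) (cubeMeas d) :=
  (Lp.memLp v).integrable_mul (memLp_of_continuous hF 2)

lemma pairing_sum {ι : Type*} (s : Finset ι) (v : L2 d) (c : ι → ℝ) {F : ι → (Fin d → ℝ) → ℝ}
    (hF : ∀ k ∈ s, Continuous (F k)) :
    pairing v (fun x => ∑ k ∈ s, c k * F k x) = ∑ k ∈ s, c k * pairing v (F k) := by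
  simp only [pairing, Finset.mul_sum, mul_left_comm (v _)]
  rw [integral_finsetSum _ fun k hk => (integrable_mul_L2 v (hF k hk)).const_mul (c k)]
  simp only [integral_const_mul]

/-! ### Cut-off functions -/

/-- Bounded pointwise convergence of continuous functions on the unit interval. -/
structure BddTendsto (a : ℕ → ℝ → ℝ) (b : ℝ → ℝ) : Prop where
  continuous : ∀ m, Continuous (a m)
  bounded : ∃ C, ∀ m, ∀ x ∈ Ioo (0 : ℝ) 1, |a m x| ≤ C
  tendsto : ∀ x ∈ Ioo (0 : ℝ) 1, Tendsto (fun m => a m x) atTop (𝓝 (b x))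

namespace BddTendsto

variable {a a' : ℕ → ℝ → ℝ} {b b' : ℝ → ℝ}

lemma const (hb : Continuous b) : BddTendsto (fun _ => b) b where
  continuous _ := hb
  bounded := by
    obtain ⟨C, hC⟩ := isCompact_Icc.exists_bound_of_continuousOn (s := Icc (0 : ℝ) 1)
      hb.continuousOn
    exact ⟨C, fun _ x hx => hC x (Ioo_subset_Icc_self hx)⟩
  tendsto _ _ := tendsto_const_nhds

lemma add (h : BddTendsto a b) (h' : BddTendsto a' b') :
    BddTendsto (fun m => a m + a' m) (b + b') where
  continuous m := (h.continuous m).add (h'.continuous m)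
  bounded := by
    obtain ⟨C, hC⟩ := h.bounded
    obtain ⟨C', hC'⟩ := h'.bounded
    exact ⟨C + C', fun m x hx => (abs_add_le _ _).trans (add_le_add (hC m x hx) (hC' m x hx))⟩
  tendsto x hx := (h.tendsto x hx).add (h'.tendsto x hx)

lemma mul (h : BddTendsto a b) (h' : BddTendsto a' b') :
    BddTendsto (fun m => a m * a' m) (b * b') where
  continuous m := (h.continuous m).mul (h'.continuous m)
  bounded := by
    obtain ⟨C, hC⟩ := h.bounded
    obtain ⟨C', hC'⟩ := h'.bounded
    refine ⟨C * C', fun m x hx => ?_⟩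
    rw [Pi.mul_apply, abs_mul]
    exact mul_le_mul (hC m x hx) (hC' m x hx) (abs_nonneg _) ((abs_nonneg _).trans (hC m x hx))
  tendsto x hx := (h.tendsto x hx).mul (h'.tendsto x hx)

lemma neg (h : BddTendsto a b) : BddTendsto (fun m => -a m) (-b) where
  continuous m := (h.continuous m).neg
  bounded := by simpa only [Pi.neg_apply, abs_neg] using h.bounded
  tendsto x hx := (h.tendsto x hx).neg

lemma comp_one_sub (h : BddTendsto a b) :
    BddTendsto (fun m x => a m (1 - x)) (fun x => b (1 - x)) where
  continuous m := (h.continuous m).comp (continuous_const.sub continuous_id)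
  bounded := by
    obtain ⟨C, hC⟩ := h.bounded
    exact ⟨C, fun m x hx => hC m (1 - x) ⟨by linarith [hx.2], by linarith [hx.1]⟩⟩
  tendsto x hx := h.tendsto (1 - x) ⟨by linarith [hx.2], by linarith [hx.1]⟩

end BddTendsto

lemma deriv_smoothTransition_of_one_lt {x : ℝ} (hx : 1 < x) :
    deriv Real.smoothTransition x = 0 := by
  have h : Real.smoothTransition =ᶠ[𝓝 x] fun _ => 1 := by
    filter_upwards [Ioi_mem_nhds hx] with y hy using Real.smoothTransition.one_of_one_le hy.le
  rw [h.deriv_eq, deriv_const]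

lemma deriv_smoothTransition_of_neg {x : ℝ} (hx : x < 0) :
    deriv Real.smoothTransition x = 0 := by
  have h : Real.smoothTransition =ᶠ[𝓝 x] fun _ => 0 := by
    filter_upwards [Iio_mem_nhds hx] with y hy using Real.smoothTransition.zero_of_nonpos hy.le
  rw [h.deriv_eq, deriv_const]

lemma hasCompactSupport_deriv_smoothTransition :
    HasCompactSupport (deriv Real.smoothTransition) := by
  refine HasCompactSupport.intro (isCompact_Icc (a := (0 : ℝ)) (b := 1)) fun x hx => ?_
  rw [mem_Icc, not_and_or, not_le, not_le] at hx
  exact hx.elim deriv_smoothTransition_of_neg deriv_smoothTransition_of_one_lt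

/-- A smooth function that vanishes near `(-∞,0]` and tends to `1` on `(0,∞)` as `m → ∞`. -/
def edge (m : ℕ) (x : ℝ) : ℝ := Real.smoothTransition ((m + 3) * x - 1)

lemma contDiff_edge (m : ℕ) : ContDiff ℝ ∞ (edge m) :=
  Real.smoothTransition.contDiff.comp (by fun_prop)

lemma deriv_edge (m : ℕ) (x : ℝ) :
    deriv (edge m) x = (m + 3) * deriv Real.smoothTransition ((m + 3) * x - 1) := by
  have hs : DifferentiableAt ℝ Real.smoothTransition ((m + 3) * x - 1) :=
    (Real.smoothTransition.contDiff (n := 1)).differentiable one_ne_zero _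
  have hl : HasDerivAt (fun x : ℝ => (m + 3) * x - 1) (m + 3) x := by
    simpa using ((hasDerivAt_id x).const_mul ((m : ℝ) + 3)).sub_const 1
  exact (hs.hasDerivAt.comp x hl).deriv.trans (mul_comm _ _)

lemma edge_mem_Icc (m : ℕ) (x : ℝ) : edge m x ∈ Icc 0 1 :=
  ⟨Real.smoothTransition.nonneg _, Real.smoothTransition.le_one _⟩

lemma edge_eq_zero {m : ℕ} {x : ℝ} (hx : (m + 3) * x ≤ 1) : edge m x = 0 :=
  Real.smoothTransition.zero_of_nonpos (sub_nonpos.2 hx)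

lemma eventually_two_lt_mul {x : ℝ} (hx : 0 < x) : ∀ᶠ m : ℕ in atTop, 2 < (m + 3) * x :=
  ((tendsto_atTop_add_const_right _ _ tendsto_natCast_atTop_atTop).atTop_mul_const
    hx).eventually_gt_atTop 2

lemma bddTendsto_edge : BddTendsto edge 1 where
  continuous m := (contDiff_edge m).continuous
  bounded := ⟨1, fun m x _ => by
    rw [abs_of_nonneg (edge_mem_Icc m x).1]; exact (edge_mem_Icc m x).2⟩
  tendsto x hx := by
    refine tendsto_const_nhds.congr' ?_
    filter_upwards [eventually_two_lt_mul hx.1] with m hm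
    exact (Real.smoothTransition.one_of_one_le (by linarith)).symm

lemma bddTendsto_edge_one_sub : BddTendsto (fun m x => edge m (1 - x)) 1 :=
  bddTendsto_edge.comp_one_sub

/- With `y = (m + 3) x - 1`, the product `x * deriv (edge m) x` is `(y + 1) * deriv θ y`, where
`θ` is the transition function: this does not depend on `m`. -/
lemma exists_bound_mul_deriv_edge : ∃ C, ∀ m x, |x * deriv (edge m) x| ≤ C := by
  have : Continuous (deriv Real.smoothTransition) :=
    (Real.smoothTransition.contDiff (n := 1)).continuous_deriv le_rfl
  have hcont : Continuous fun y => (y + 1) * deriv Real.smoothTransition y := by fun_prop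
  obtain ⟨C, hC⟩ := hcont.bounded_above_of_compact_support
    (hasCompactSupport_deriv_smoothTransition.mul_left (f := fun y => y + 1))
  refine ⟨C, fun m x => ?_⟩
  rw [deriv_edge, ← mul_assoc, mul_comm x]
  simpa only [sub_add_cancel, Real.norm_eq_abs] using hC ((m + 3) * x - 1)

lemma bddTendsto_mul_deriv_edge {f : ℝ → ℝ} (hf : Continuous f) {L : ℝ}
    (hL : ∀ x ∈ Ioo (0 : ℝ) 1, |f x| ≤ L * x) : BddTendsto (fun m => f * deriv (edge m)) 0 where
  continuous m := hf.mul ((contDiff_edge m).continuous_deriv (by simp))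
  bounded := by
    obtain ⟨C, hC⟩ := exists_bound_mul_deriv_edge
    refine ⟨L * C, fun m x hx => ?_⟩
    have hL₀ : 0 ≤ L := nonneg_of_mul_nonneg_left ((abs_nonneg _).trans (hL x hx)) hx.1
    calc |f x * deriv (edge m) x| = |f x| * |deriv (edge m) x| := abs_mul _ _
      _ ≤ L * x * |deriv (edge m) x| := mul_le_mul_of_nonneg_right (hL x hx) (abs_nonneg _)
      _ = L * |x * deriv (edge m) x| := by rw [abs_mul, abs_of_pos hx.1, mul_assoc]
      _ ≤ L * C := mul_le_mul_of_nonneg_left (hC m x) hL₀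
  tendsto x hx := by
    refine tendsto_const_nhds.congr' ?_
    filter_upwards [eventually_two_lt_mul hx.1] with m hm
    rw [Pi.mul_apply, deriv_edge, deriv_smoothTransition_of_one_lt (by linarith)]
    simp

/-- The product of `f` and a smooth cut-off function with compact support in `(0,1)`, which tends
to `1` as `m → ∞`. -/
def cutFun (f : ℝ → ℝ) (m : ℕ) : ℝ → ℝ := f * (edge m * fun x => edge m (1 - x))

lemma contDiff_cutFun {f : ℝ → ℝ} (hf : ContDiff ℝ ∞ f) (m : ℕ) : ContDiff ℝ ∞ (cutFun f m) :=
  hf.mul ((contDiff_edge m).mul ((contDiff_edge m).comp (contDiff_const.sub contDiff_id)))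

lemma tsupport_cutFun_subset (f : ℝ → ℝ) (m : ℕ) : tsupport (cutFun f m) ⊆ Ioo 0 1 := by
  have hm : (0 : ℝ) < m + 3 := by positivity
  have hpos : 0 < 1 / (m + 3 : ℝ) := by positivity
  have hsub : tsupport (cutFun f m) ⊆ Icc (1 / (m + 3 : ℝ)) (1 - 1 / (m + 3 : ℝ)) := by
    refine closure_minimal (fun x hx => ?_) isClosed_Icc
    simp only [cutFun, Function.mem_support, Pi.mul_apply, mul_ne_zero_iff] at hx
    obtain ⟨-, hleft, hright⟩ := hx
    have hleft := mt edge_eq_zero hleft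
    have hright := mt edge_eq_zero hright
    rw [mul_comm, ← le_div_iff₀ hm, not_le] at hleft hright
    exact ⟨hleft.le, by linarith⟩
  exact hsub.trans fun x hx => ⟨hpos.trans_le hx.1, by linarith [hx.2]⟩

lemma bddTendsto_cutFun {f : ℝ → ℝ} (hf : Continuous f) : BddTendsto (cutFun f) f := by
  have h := (BddTendsto.const hf).mul (bddTendsto_edge.mul bddTendsto_edge_one_sub)
  rwa [mul_one, mul_one] at h

lemma deriv_cutFun {f : ℝ → ℝ} (hf : Differentiable ℝ f) (m : ℕ) :
    deriv (cutFun f m) = cutFun (deriv f) m + (f * deriv (edge m) * (fun x => edge m (1 - x))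
      + edge m * -fun x => f x * deriv (edge m) (1 - x)) := by
  funext x
  have he := (contDiff_edge m).differentiable (by simp)
  have he' : DifferentiableAt ℝ (fun x => edge m (1 - x)) x :=
    (he (1 - x)).comp x (differentiableAt_id.const_sub 1)
  rw [cutFun, deriv_mul (hf x) ((he x).mul he'), deriv_mul (he x) he', deriv_comp_const_sub]
  simp only [cutFun, Pi.add_apply, Pi.mul_apply, Pi.neg_apply]
  ring

lemma exists_forall_abs_sub_le {f : ℝ → ℝ} (hf : ContDiff ℝ 1 f) :
    ∃ L, ∀ x ∈ Icc (0 : ℝ) 1, ∀ y ∈ Icc (0 : ℝ) 1, |f y - f x| ≤ L * |y - x| := by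
  obtain ⟨L, hL⟩ := isCompact_Icc.exists_bound_of_continuousOn (s := Icc (0 : ℝ) 1)
    (hf.continuous_deriv le_rfl).continuousOn
  exact ⟨L, fun x hx y hy => (convex_Icc (0 : ℝ) 1).norm_image_sub_le_of_norm_deriv_le
    (fun z _ => hf.differentiable one_ne_zero z) hL hx hy⟩

/- The derivative of the cut-off function at distance `x` from the boundary is at most of order
`1 / x`, which is compensated by `f`. -/
lemma bddTendsto_deriv_cutFun {f : ℝ → ℝ} (hf : ContDiff ℝ 1 f) (hf₀ : f 0 = 0) (hf₁ : f 1 = 0) :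
    BddTendsto (fun m => deriv (cutFun f m)) (deriv f) := by
  obtain ⟨L, hL⟩ := exists_forall_abs_sub_le hf
  have hleft : BddTendsto (fun m => f * deriv (edge m)) 0 := by
    refine bddTendsto_mul_deriv_edge hf.continuous (L := L) fun x hx => ?_
    simpa [hf₀, abs_of_pos hx.1] using hL 0 (by simp) x (Ioo_subset_Icc_self hx)
  have hright : BddTendsto (fun m x => f x * deriv (edge m) (1 - x)) 0 := by
    have h : BddTendsto _ 0 := (bddTendsto_mul_deriv_edge (f := fun x => f (1 - x)) (L := L)
      (hf.continuous.comp (continuous_const.sub continuous_id)) fun x hx => by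
        simpa [hf₁, abs_of_pos hx.1] using hL 1 (by simp) (1 - x)
          ⟨by linarith [hx.2], by linarith [hx.1]⟩).comp_one_sub
    simpa only [Pi.mul_apply, sub_sub_cancel] using h
  simpa only [deriv_cutFun (hf.differentiable one_ne_zero), zero_mul, mul_zero, neg_zero,
    add_zero] using (bddTendsto_cutFun (hf.continuous_deriv le_rfl)).add
      ((hleft.mul bddTendsto_edge_one_sub).add (bddTendsto_edge.mul hright.neg))

/-! ### Weak identities tested with products that need not have compact support -/

lemma tendsto_pairing_prodFun (v : L2 d) {h : ℕ → Fin d → ℝ → ℝ} {h' : Fin d → ℝ → ℝ}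
    (hh : ∀ i, BddTendsto (fun m => h m i) (h' i)) :
    Tendsto (fun m => pairing v (prodFun (h m))) atTop (𝓝 (pairing v (prodFun h'))) := by
  choose C hC using fun i => (hh i).bounded
  refine tendsto_pairing v (C := ∏ i, C i)
    (fun m => continuous_prodFun fun i => (hh i).continuous m) (fun m x hx => ?_) fun x hx =>
      tendsto_finsetProd _ fun i _ => (hh i).tendsto _ (mem_cube.1 hx i)
  rw [prodFun, Finset.abs_prod]
  exact Finset.prod_le_prod (fun i _ => abs_nonneg _) fun i _ => hC i m _ (mem_cube.1 hx i)

theorem IsWeakDeriv.pairing_prodFun {α : Fin d → ℕ} {v g : L2 d} (h : IsWeakDeriv α v g)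
    (hα : ∀ i, α i ≤ 1) {f : Fin d → ℝ → ℝ} (hf : ∀ i, ContDiff ℝ ∞ (f i))
    (hf₀ : ∀ i, α i = 1 → f i 0 = 0 ∧ f i 1 = 0) :
    pairing v (prodFun fun i => deriv^[α i] (f i)) = (-1) ^ (∑ i, α i) * pairing g (prodFun f) := by
  have hcut (m) : pairing v (prodFun fun i => deriv^[α i] (cutFun (f i) m))
      = (-1) ^ (∑ i, α i) * pairing g (prodFun fun i => cutFun (f i) m) := by
    have hs (i) : ContDiff ℝ ∞ (cutFun (f i) m) := contDiff_cutFun (hf i) m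
    rw [← h _ (isTest_prodFun hs fun i => tsupport_cutFun_subset (f i) m), mpd_prodFun hs]
  have hleft := tendsto_pairing_prodFun v (h := fun m i => deriv^[α i] (cutFun (f i) m))
    (h' := fun i => deriv^[α i] (f i)) fun i => by
      obtain hi | hi := Nat.le_one_iff_eq_zero_or_eq_one.1 (hα i)
      · simpa only [hi, Function.iterate_zero, id] using bddTendsto_cutFun (hf i).continuous
      · simpa only [hi, Function.iterate_one] using
          bddTendsto_deriv_cutFun ((hf i).of_le (by simp)) (hf₀ i hi).1 (hf₀ i hi).2
  have hright := tendsto_pairing_prodFun g fun i => bddTendsto_cutFun (hf i).continuous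
  exact tendsto_nhds_unique (hleft.congr hcut) (hright.const_mul _)

/-- A smooth function equal to `1` near the unit interval. -/
def unitBump : ContDiffBump (1 / 2 : ℝ) := ⟨1, 2, one_pos, one_lt_two⟩

lemma unitBump_eq_one {x : ℝ} (hx : x ∈ Ioo (0 : ℝ) 1) : unitBump x = 1 := by
  refine unitBump.one_of_mem_closedBall ?_
  rw [Metric.mem_closedBall, Real.dist_eq, abs_le, unitBump]
  constructor <;> linarith [hx.1, hx.2]

theorem IsZeroTraceDeriv.pairing_prodFun {i : Fin d} {v g : L2 d} (h : IsZeroTraceDeriv i v g)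
    {f : Fin d → ℝ → ℝ} (hf : ∀ i, ContDiff ℝ ∞ (f i)) :
    pairing v (prodFun (Function.update f i (deriv (f i)))) = - pairing g (prodFun f) := by
  let f' (j : Fin d) (x : ℝ) : ℝ := f j x * unitBump x
  have hsmooth (j) : ContDiff ℝ ∞ (f' j) := (hf j).mul unitBump.contDiff
  have hsupp : HasCompactSupport (prodFun f') :=
    hasCompactSupport_prodFun fun j => unitBump.hasCompactSupport.mul_left
  have hfun (j) : EqOn (f' j) (f j) (Ioo 0 1) := fun x hx => by simp [f', unitBump_eq_one hx]
  have hderiv (j) : EqOn (deriv (f' j)) (deriv (f j)) (Ioo 0 1) := (hfun j).deriv isOpen_Ioo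
  have hweak := h _ (contDiff_prodFun hsmooth) hsupp
  rw [pd_prodFun fun j => (hsmooth j).differentiable (by simp)] at hweak
  rw [pairing_congr g (χ := prodFun f'), ← hweak]
  · refine pairing_congr v fun x hx => Finset.prod_congr rfl fun j _ => ?_
    obtain rfl | hj := eq_or_ne j i
    · simpa using (hderiv j (mem_cube.1 hx j)).symm
    · simpa [hj] using (hfun j (mem_cube.1 hx j)).symm
  · exact fun x hx => Finset.prod_congr rfl fun j _ => (hfun j (mem_cube.1 hx j)).symm

lemma mpd_prodFun_update {f : Fin d → ℝ → ℝ} (hf : ∀ i, ContDiff ℝ ∞ (f i)) (α : Fin d → ℕ)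
    (k : Fin d) {a : ℝ → ℝ} (ha : ContDiff ℝ ∞ a) : mpd α (prodFun (Function.update f k a))
      = prodFun (Function.update (fun i => deriv^[α i] (f i)) k (deriv^[α k] a)) := by
  rw [mpd_prodFun]
  · congr 1 with i : 1
    exact Function.apply_update (fun i => deriv^[α i]) f k a i
  · exact (Function.forall_update_iff f fun _ b => ContDiff ℝ ∞ b).2 ⟨ha, fun i _ => hf i⟩

lemma tendsto_pairing_prodFun_update (v : L2 d) {f : Fin d → ℝ → ℝ} (hf : ∀ i, Continuous (f i))
    (k : Fin d) {a : ℕ → ℝ → ℝ} {b : ℝ → ℝ} (h : BddTendsto a b) :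
    Tendsto (fun m => pairing v (prodFun (Function.update f k (a m)))) atTop
      (𝓝 (pairing v (prodFun (Function.update f k b)))) := by
  refine tendsto_pairing_prodFun v fun i => ?_
  obtain rfl | hi := eq_or_ne i k
  · simpa using h
  · simpa [hi] using BddTendsto.const (hf i)

/- A second derivative in the direction `k` is moved to `v` once, as the second derivatives of the
cut-off functions are not bounded after multiplication by `f k`. -/
lemma tendsto_pairing_mpd_cutFun {v w : L2 d} {k : Fin d} (hw : IsZeroTraceDeriv k v w)
    {f : Fin d → ℝ → ℝ} (hf : ∀ i, ContDiff ℝ ∞ (f i)) (hf₀ : f k 0 = 0) (hf₁ : f k 1 = 0)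
    {α : Fin d → ℕ} (hα : α k ≤ 2) :
    Tendsto (fun m => pairing v (mpd α (prodFun (Function.update f k (cutFun (f k) m))))) atTop
      (𝓝 (pairing v (mpd α (prodFun f)))) := by
  have hD (i) : ContDiff ℝ ∞ (deriv^[α i] (f i)) := (hf i).iterate_deriv _
  have hcont (i) := (hD i).continuous
  have hderiv := bddTendsto_deriv_cutFun ((hf k).of_le (by simp)) hf₀ hf₁
  have hf_eq : pairing v (mpd α (prodFun f)) = pairing v (prodFun (Function.update
      (fun i => deriv^[α i] (f i)) k (deriv^[α k] (f k)))) := by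
    rw [← mpd_prodFun_update hf α k (hf k), Function.update_eq_self]
  simp only [hf_eq, mpd_prodFun_update hf α k (contDiff_cutFun (hf k) _)]
  interval_cases α k
  · exact tendsto_pairing_prodFun_update v hcont k (bddTendsto_cutFun (hf k).continuous)
  · exact tendsto_pairing_prodFun_update v hcont k hderiv
  · have hparts {a : ℝ → ℝ} (ha : ContDiff ℝ ∞ a) :
        pairing v (prodFun (Function.update (fun i => deriv^[α i] (f i)) k (deriv^[2] a)))
          = - pairing w (prodFun (Function.update (fun i => deriv^[α i] (f i)) k (deriv a))) := by
      have h := hw.pairing_prodFun (f := Function.update (fun i => deriv^[α i] (f i)) k (deriv a))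
        ((Function.forall_update_iff _ fun _ b => ContDiff ℝ ∞ b).2
          ⟨ha.iterate_deriv 1, fun i _ => hD i⟩)
      rwa [Function.update_self, Function.update_idem] at h
    simp only [hparts (hf k), hparts (contDiff_cutFun (hf k) _)]
    exact (tendsto_pairing_prodFun_update w hcont k hderiv).neg

/- The cut-off functions are introduced in one direction after the other. -/
theorem sum_pairing_mpd_prodFun_eq {ι : Type*} {s : Finset ι} {c : ι → ℝ} {α : ι → Fin d → ℕ}
    (hα : ∀ n ∈ s, ∀ i, α n i ≤ 2) {v g : L2 d} {w : Fin d → L2 d}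
    (hw : ∀ i, IsZeroTraceDeriv i v (w i))
    (h : ∀ ψ, IsTest ψ → ∑ n ∈ s, c n * pairing v (mpd (α n) ψ) = pairing g ψ)
    {f : Fin d → ℝ → ℝ} (hf : ∀ i, ContDiff ℝ ∞ (f i)) (hf₀ : ∀ i, f i 0 = 0 ∧ f i 1 = 0) :
    ∑ n ∈ s, c n * pairing v (mpd (α n) (prodFun f)) = pairing g (prodFun f) := by
  suffices H : ∀ J : Finset (Fin d), ∀ f : Fin d → ℝ → ℝ, (∀ i, ContDiff ℝ ∞ (f i)) →
      (∀ i ∈ J, f i 0 = 0 ∧ f i 1 = 0) → (∀ i ∉ J, tsupport (f i) ⊆ Ioo 0 1) →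
      ∑ n ∈ s, c n * pairing v (mpd (α n) (prodFun f)) = pairing g (prodFun f) from
    H Finset.univ f hf (fun i _ => hf₀ i) fun i hi => absurd (Finset.mem_univ i) hi
  intro J
  induction J using Finset.induction_on with
  | empty => exact fun f hf _ hs => h _ (isTest_prodFun hf fun i => hs i (Finset.notMem_empty i))
  | insert k J hk ih =>
    intro f hf hf₀ hs
    have hk₀ := hf₀ k (Finset.mem_insert_self k J)
    have hcut (m) := ih (Function.update f k (cutFun (f k) m))
      ((Function.forall_update_iff f fun _ b => ContDiff ℝ ∞ b).2
        ⟨contDiff_cutFun (hf k) m, fun i _ => hf i⟩)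
      (fun i hi => by
        rw [Function.update_of_ne (ne_of_mem_of_not_mem hi hk)]
        exact hf₀ i (Finset.mem_insert_of_mem hi))
      fun i hi => by
        obtain rfl | hik := eq_or_ne i k
        · rw [Function.update_self]
          exact tsupport_cutFun_subset (f i) m
        · rw [Function.update_of_ne hik]
          exact hs i (by simp [hik, hi])
    have hleft := tendsto_finsetSum s fun n hn =>
      (tendsto_pairing_mpd_cutFun (hw k) hf hk₀.1 hk₀.2 (hα n hn k)).const_mul (c n)
    have hright := tendsto_pairing_prodFun_update g (fun i => (hf i).continuous) k
      (bddTendsto_cutFun (hf k).continuous)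
    rw [Function.update_eq_self] at hright
    exact tendsto_nhds_unique (hleft.congr hcut) hright

/-! ### Completeness of the cosine and sine systems -/

lemma integrable_mul_of_continuous {f F : (Fin d → ℝ) → ℝ} (hf : Integrable f (cubeMeas d))
    (hF : Continuous F) : Integrable (fun x => f x * F x) (cubeMeas d) := by
  obtain ⟨C, hC⟩ := (isCompact_closedCube d).exists_bound_of_continuousOn hF.continuousOn
  refine hf.mul_bdd (c := C) hF.aestronglyMeasurable ?_
  filter_upwards [ae_mem_cube d] with x hx using hC x (cube_subset_closedCube d hx)

lemma ae_eq_zero_of_forall_isTest {f : (Fin d → ℝ) → ℝ} (hf : Integrable f (cubeMeas d))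
    (h : ∀ ψ, IsTest ψ → ∫ x in cube d, f x * ψ x = 0) : f =ᵐ[cubeMeas d] 0 := by
  rw [Filter.EventuallyEq, ae_restrict_iff' (measurableSet_cube d)]
  refine (isOpen_cube d).ae_eq_zero_of_integral_contDiff_smul_eq_zero
    (IntegrableOn.locallyIntegrableOn hf) fun ψ hψ hψ_compact hψ_supp => ?_
  rw [← h ψ ⟨hψ, hψ_compact, hψ_supp⟩,
    ← setIntegral_eq_integral_of_forall_compl_eq_zero (s := cube d)]
  · simp only [smul_eq_mul, mul_comm]
  · intro x hx
    rw [image_eq_zero_of_notMem_tsupport fun hx' => hx (hψ_supp hx'), zero_smul]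

lemma eq_of_pairing_test {v w : L2 d} (h : ∀ ψ, IsTest ψ → pairing v ψ = pairing w ψ) : v = w := by
  refine Lp.ext ?_
  have hzero : (fun x => v x - w x) =ᵐ[cubeMeas d] 0 :=
    ae_eq_zero_of_forall_isTest ((integrable_L2 v).sub (integrable_L2 w)) fun ψ hψ => by
      simp only [sub_mul]
      rw [integral_sub (integrable_mul_L2 v hψ.1.continuous)
        (integrable_mul_L2 w hψ.1.continuous)]
      exact sub_eq_zero.2 (h ψ hψ)
  filter_upwards [hzero] with x hx using sub_eq_zero.1 hx

theorem IsWeakDeriv.unique {α : Fin d → ℕ} {v g g' : L2 d} (h : IsWeakDeriv α v g)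
    (h' : IsWeakDeriv α v g') : g = g' :=
  eq_of_pairing_test fun ψ hψ =>
    mul_left_cancel₀ (pow_ne_zero _ (by norm_num)) ((h ψ hψ).symm.trans (h' ψ hψ))

lemma prodFun_sum_mul {ι : Type*} [Fintype ι] (c : Fin d → ι → ℝ)
    (e : Fin d → ι → ℝ → ℝ) (x : Fin d → ℝ) :
    prodFun (fun i y => ∑ j, c i j * e i j y) x
      = ∑ κ : Fin d → ι, (∏ i, c i (κ i)) * prodFun (fun i => e i (κ i)) x := by
  classical simp [prodFun, Finset.prod_univ_sum, Finset.prod_mul_distrib]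

/-- The cosine with frequency `k` on the unit interval. -/
def cosFun (k : ℕ) : ℝ → ℝ := fun x => Real.cos (k * Real.pi * x)

/-- The tensor product of the cosines with frequencies `n i`. -/
def cosProd (n : Fin d → ℕ) : (Fin d → ℝ) → ℝ := prodFun fun i => cosFun (n i)

lemma contDiff_cosFun (k : ℕ) : ContDiff ℝ ∞ (cosFun k) := by
  unfold cosFun; fun_prop

lemma continuous_cosProd (n : Fin d → ℕ) : Continuous (cosProd n) :=
  continuous_prodFun fun i => (contDiff_cosFun (n i)).continuous

lemma cosFun_mul_cosFun (k l : ℕ) (x : ℝ) : cosFun k x * cosFun l x =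
    ∑ j : Fin 2, 1 / 2 * cosFun (![k + l, ((k : ℤ) - l).natAbs] j) x := by
  have hdist : Real.cos (|(k : ℝ) - l| * Real.pi * x)
      = Real.cos (k * Real.pi * x - l * Real.pi * x) := by
    rcases abs_choice ((k : ℝ) - l) with h | h <;> rw [h]
    · ring_nf
    · rw [← Real.cos_neg]
      ring_nf
  simp only [cosFun, Fin.sum_univ_two, Matrix.cons_val_zero, Matrix.cons_val_one, Nat.cast_natAbs,
    Int.cast_abs, Int.cast_sub, Int.cast_natCast, hdist, Nat.cast_add, add_mul, Real.cos_add,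
    Real.cos_sub]
  ring

/-- The projection onto the closed cube, regarded as a compact space. -/
def clamp (x : Fin d → ℝ) : Fin d → Icc (0 : ℝ) 1 := fun i => projIcc 0 1 zero_le_one (x i)

lemma continuous_clamp : Continuous (clamp (d := d)) :=
  continuous_pi fun i => continuous_projIcc.comp (continuous_apply i)

lemma clamp_of_mem {x : Fin d → ℝ} (hx : x ∈ cube d) : (fun i => (clamp x i : ℝ)) = x :=
  funext fun i => by
    rw [clamp, projIcc_of_mem zero_le_one (Ioo_subset_Icc_self (mem_cube.1 hx i))]

/-- The restriction of `cosProd n` to the closed cube. -/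
def cosProdIcc (n : Fin d → ℕ) : C(Fin d → Icc (0 : ℝ) 1, ℝ) :=
  ⟨fun y => cosProd n fun i => y i, (continuous_cosProd n).comp (by fun_prop)⟩

lemma cosProdIcc_zero : cosProdIcc (0 : Fin d → ℕ) = 1 := by
  ext y
  simp [cosProdIcc, cosProd, prodFun, cosFun]

lemma cosProdIcc_mul_mem_span (m n : Fin d → ℕ) :
    cosProdIcc m * cosProdIcc n ∈ Submodule.span ℝ (range (cosProdIcc (d := d))) := by
  have hmul : cosProdIcc m * cosProdIcc n = ∑ κ : Fin d → Fin 2, (∏ _i : Fin d, (1 / 2 : ℝ)) •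
      cosProdIcc fun i => ![m i + n i, ((m i : ℤ) - n i).natAbs] (κ i) := by
    ext y
    simp only [cosProdIcc, cosProd, ContinuousMap.mul_apply, ContinuousMap.coe_mk,
      ContinuousMap.sum_apply, ContinuousMap.smul_apply, smul_eq_mul]
    rw [← prodFun_sum_mul (fun _ _ => 1 / 2) fun i j =>
      cosFun (![m i + n i, ((m i : ℤ) - n i).natAbs] j)]
    simp only [prodFun, ← Finset.prod_mul_distrib, ← cosFun_mul_cosFun]
  rw [hmul]
  exact Submodule.sum_mem _ fun κ _ => Submodule.smul_mem _ _ (Submodule.subset_span ⟨_, rfl⟩)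

/-- The linear span of the products of cosines, which is an algebra by the product-to-sum
formula. -/
def cosSubalgebra (d : ℕ) : Subalgebra ℝ C(Fin d → Icc (0 : ℝ) 1, ℝ) :=
  (Submodule.span ℝ (range cosProdIcc)).toSubalgebra
    (Submodule.subset_span ⟨0, cosProdIcc_zero⟩) fun a b ha hb => by
      induction ha, hb using Submodule.span_induction₂ with
      | mem_mem a b ha hb =>
        obtain ⟨⟨m, rfl⟩, n, rfl⟩ := And.intro ha hb
        exact cosProdIcc_mul_mem_span m n
      | zero_left b _ => simp
      | zero_right a _ => simp
      | add_left a a' b _ _ _ h h' => rw [add_mul]; exact add_mem h h'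
      | add_right a b b' _ _ _ h h' => rw [mul_add]; exact add_mem h h'
      | smul_left c a b _ _ h => rw [smul_mul_assoc]; exact Submodule.smul_mem _ c h
      | smul_right c a b _ _ h => rw [mul_smul_comm]; exact Submodule.smul_mem _ c h

lemma cosSubalgebra_separatesPoints : (cosSubalgebra d).SeparatesPoints := by
  intro x y hxy
  obtain ⟨i, hi⟩ := Function.ne_iff.1 hxy
  have heval (y : Fin d → Icc (0 : ℝ) 1) :
      cosProdIcc (Pi.single i 1) y = Real.cos (Real.pi * y i) := by
    rw [cosProdIcc, ContinuousMap.coe_mk, cosProd, prodFun, Finset.prod_eq_single i]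
    · simp [cosFun]
    · intro j _ hj
      simp [cosFun, hj]
    · simp
  have hmem (y : Icc (0 : ℝ) 1) : Real.pi * y ∈ Icc 0 Real.pi :=
    ⟨mul_nonneg Real.pi_pos.le y.2.1, mul_le_of_le_one_right Real.pi_pos.le y.2.2⟩
  refine ⟨_, ⟨cosProdIcc (Pi.single i 1), Submodule.subset_span ⟨_, rfl⟩, rfl⟩, fun h => hi ?_⟩
  exact Subtype.ext (mul_left_cancel₀ Real.pi_ne_zero
    (Real.injOn_cos (hmem _) (hmem _) ((heval x).symm.trans (h.trans (heval y)))))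

/-- The functional `a ↦ ∫_Ω f a` on the continuous functions on the closed cube. -/
def integralFunctional {f : (Fin d → ℝ) → ℝ} (hf : Integrable f (cubeMeas d)) :
    C(Fin d → Icc (0 : ℝ) 1, ℝ) →L[ℝ] ℝ :=
  have hintegrable (a : C(Fin d → Icc (0 : ℝ) 1, ℝ)) :=
    integrable_mul_of_continuous hf (a.continuous.comp continuous_clamp)
  LinearMap.mkContinuous
    { toFun := fun a => ∫ x in cube d, f x * a (clamp x)
      map_add' := fun a b => by
        simp only [ContinuousMap.add_apply, mul_add]
        exact integral_add (hintegrable a) (hintegrable b)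
      map_smul' := fun c a => by
        simp only [ContinuousMap.smul_apply, smul_eq_mul, RingHom.id_apply, mul_left_comm _ c]
        exact integral_const_mul _ _ }
    (∫ x in cube d, ‖f x‖) fun a => by
      rw [← integral_mul_const]
      refine norm_integral_le_of_norm_le (hf.norm.mul_const _) (Eventually.of_forall fun x => ?_)
      rw [norm_mul]
      exact mul_le_mul_of_nonneg_left (a.norm_coe_le_norm _) (norm_nonneg _)

lemma integralFunctional_apply {f : (Fin d → ℝ) → ℝ} (hf : Integrable f (cubeMeas d))
    {a : C(Fin d → Icc (0 : ℝ) 1, ℝ)} {ψ : (Fin d → ℝ) → ℝ} (ha : ∀ y, a y = ψ fun i => y i) :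
    integralFunctional hf a = ∫ x in cube d, f x * ψ x :=
  setIntegral_congr_fun (measurableSet_cube d) fun x hx => by
    simp only [ha, clamp_of_mem hx]

theorem ae_eq_zero_of_cosProd {f : (Fin d → ℝ) → ℝ} (hf : Integrable f (cubeMeas d))
    (h : ∀ n : Fin d → ℕ, ∫ x in cube d, f x * cosProd n x = 0) : f =ᵐ[cubeMeas d] 0 := by
  have hker : Submodule.span ℝ (range (cosProdIcc (d := d))) ≤ (integralFunctional hf).ker := by
    rw [Submodule.span_le]
    rintro _ ⟨n, rfl⟩
    exact (integralFunctional_apply hf fun _ => rfl).trans (h n)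
  have hclosed : IsClosed ((integralFunctional hf).ker : Set C(Fin d → Icc (0 : ℝ) 1, ℝ)) :=
    (integralFunctional hf).isClosed_ker
  refine ae_eq_zero_of_forall_isTest hf fun ψ hψ => ?_
  have hdense := ContinuousMap.continuousMap_mem_subalgebra_closure_of_separatesPoints _
    (cosSubalgebra_separatesPoints (d := d))
    ⟨fun y => ψ fun i => y i, hψ.1.continuous.comp (by fun_prop)⟩
  exact (integralFunctional_apply hf fun _ => rfl).symm.trans
    (closure_minimal hker hclosed hdense)

lemma eq_zero_of_pairing_cosProd {v : L2 d} (h : ∀ n, pairing v (cosProd n) = 0) : v = 0 :=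
  (Lp.eq_zero_iff_ae_eq_zero).2 (ae_eq_zero_of_cosProd (integrable_L2 v) h)

/-- The sine with frequency `k + 1` on the unit interval, with `L²` norm `1`. -/
def sinFun (k : ℕ) : ℝ → ℝ := fun x => √2 * Real.sin ((k + 1) * Real.pi * x)

/-- The tensor product of the normalized sines with frequencies `n i + 1`. -/
def sinProd (n : Fin d → ℕ) : (Fin d → ℝ) → ℝ := prodFun fun i => sinFun (n i)

lemma contDiff_sinFun (k : ℕ) : ContDiff ℝ ∞ (sinFun k) := by
  unfold sinFun; fun_prop

lemma continuous_sinProd (n : Fin d → ℕ) : Continuous (sinProd n) :=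
  continuous_prodFun fun i => (contDiff_sinFun (n i)).continuous

lemma sinFun_zero (k : ℕ) : sinFun k 0 = 0 := by simp [sinFun]

lemma sinFun_one (k : ℕ) : sinFun k 1 = 0 := by
  have h := Real.sin_nat_mul_pi (k + 1)
  push_cast at h
  simp [sinFun, h]

lemma exists_sin_mul_cosFun_eq (m : ℕ) : ∃ (c : Fin 2 → ℝ) (κ : Fin 2 → ℕ),
    ∀ x, Real.sin (Real.pi * x) * cosFun m x = ∑ j, c j * sinFun (κ j) x := by
  have hsqrt : √(2 : ℝ) ≠ 0 := by positivity
  rcases m with _ | _ | m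
  · refine ⟨![(√2)⁻¹, 0], ![0, 0], fun x => ?_⟩
    simp [cosFun, sinFun, Fin.sum_univ_two]
  · refine ⟨![(2 * √2)⁻¹, 0], ![1, 0], fun x => ?_⟩
    have hdouble := Real.sin_two_mul (Real.pi * x)
    rw [show 2 * (Real.pi * x) = Real.pi * x * (1 + 1) by ring] at hdouble
    simp only [cosFun, sinFun, Fin.sum_univ_two, Matrix.cons_val_zero, Matrix.cons_val_one,
      zero_add, Nat.cast_one, one_mul, zero_mul, add_zero]
    field_simp
    rw [hdouble]
    ring
  · refine ⟨![(2 * √2)⁻¹, -(2 * √2)⁻¹], ![m + 2, m], fun x => ?_⟩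
    have hsum := Real.sin_add ((m + 2) * Real.pi * x) (Real.pi * x)
    have hsub := Real.sin_sub ((m + 2) * Real.pi * x) (Real.pi * x)
    rw [show (m + 2) * Real.pi * x + Real.pi * x = (m + 2 + 1) * Real.pi * x by ring] at hsum
    rw [show (m + 2) * Real.pi * x - Real.pi * x = (m + 1) * Real.pi * x by ring] at hsub
    simp only [cosFun, sinFun, Fin.sum_univ_two, Matrix.cons_val_zero, Matrix.cons_val_one]
    push_cast
    rw [hsum, hsub, show (m : ℝ) + 1 + 1 = m + 2 by ring]
    field_simp
    ring

/- The function `w = ∏ sin (π xᵢ)` is positive, and `w cosProd n` is a linear combination of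
products of sines, so that all cosine coefficients of `v w` vanish. -/
theorem eq_zero_of_pairing_sinProd {v : L2 d} (h : ∀ n, pairing v (sinProd n) = 0) : v = 0 := by
  set w : (Fin d → ℝ) → ℝ := prodFun fun _ x => Real.sin (Real.pi * x) with hw
  have hvw : (fun x => v x * w x) =ᵐ[cubeMeas d] 0 := by
    refine ae_eq_zero_of_cosProd (integrable_mul_L2 v (continuous_prodFun fun _ => by fun_prop))
      fun n => ?_
    choose c κ hcκ using exists_sin_mul_cosFun_eq
    have hexp (x) : w x * cosProd n x = ∑ j : Fin d → Fin 2,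
        (∏ i, c (n i) (j i)) * sinProd (fun i => κ (n i) (j i)) x := by
      simp only [sinProd, hw, cosProd]
      rw [← prodFun_sum_mul (fun i => c (n i)) fun i j => sinFun (κ (n i) j)]
      simp only [prodFun, ← Finset.prod_mul_distrib, hcκ]
    simp only [mul_assoc, hexp]
    exact (pairing_sum _ v _ fun _ _ => continuous_sinProd _).trans (by simp [h])
  rw [Lp.eq_zero_iff_ae_eq_zero]
  filter_upwards [hvw, ae_mem_cube d] with x hx hxc
  have hpos : 0 < w x := Finset.prod_pos fun i _ => by
    obtain ⟨hleft, hright⟩ := mem_cube.1 hxc i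
    exact Real.sin_pos_of_pos_of_lt_pi (mul_pos Real.pi_pos hleft)
      (mul_lt_of_lt_one_right Real.pi_pos hright)
  exact (mul_eq_zero.1 hx).resolve_right hpos.ne'

lemma integral_cos_int_mul_pi (m : ℤ) :
    ∫ x in Ioo (0 : ℝ) 1, Real.cos (m * Real.pi * x) = if m = 0 then 1 else 0 := by
  rw [← integral_Ioc_eq_integral_Ioo, ← intervalIntegral.integral_of_le zero_le_one]
  split_ifs with h
  · simp [h]
  · have hm : (m : ℝ) * Real.pi ≠ 0 := mul_ne_zero (by exact_mod_cast h) Real.pi_ne_zero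
    rw [intervalIntegral.integral_comp_mul_left Real.cos hm, integral_cos]
    simp [Real.sin_int_mul_pi]

lemma integral_sinFun_mul (k l : ℕ) :
    ∫ x in Ioo (0 : ℝ) 1, sinFun k x * sinFun l x = if k = l then 1 else 0 := by
  have hprod (x) : sinFun k x * sinFun l x = Real.cos ((k - l : ℤ) * Real.pi * x)
      - Real.cos ((k + l + 2 : ℤ) * Real.pi * x) := by
    rw [show ((k - l : ℤ) : ℝ) * Real.pi * x = (k + 1) * Real.pi * x - (l + 1) * Real.pi * x by
        push_cast; ring,
      show ((k + l + 2 : ℤ) : ℝ) * Real.pi * x = (k + 1) * Real.pi * x + (l + 1) * Real.pi * x by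
        push_cast; ring, Real.cos_add, Real.cos_sub, sinFun, sinFun]
    linear_combination Real.sin ((k + 1) * Real.pi * x) * Real.sin ((l + 1) * Real.pi * x)
      * Real.mul_self_sqrt (zero_le_two (α := ℝ))
  have hintegrable (m : ℤ) : Integrable (fun x : ℝ => Real.cos (m * Real.pi * x))
      (volume.restrict (Ioo 0 1)) :=
    (Continuous.integrableOn_Icc (by fun_prop)).mono_set Ioo_subset_Icc_self
  simp only [hprod]
  rw [integral_sub (hintegrable _) (hintegrable _), integral_cos_int_mul_pi,
    integral_cos_int_mul_pi,
    if_neg (show (k : ℤ) + l + 2 ≠ 0 by omega), sub_zero]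
  simp only [sub_eq_zero, Nat.cast_inj]

lemma integral_prodFun_mul (f g : Fin d → ℝ → ℝ) :
    ∫ x in cube d, prodFun f x * prodFun g x = ∏ i, ∫ x in Ioo (0 : ℝ) 1, f i x * g i x := by
  change ∫ x, _ ∂(cubeMeas d) = _
  simp only [prodFun, ← Finset.prod_mul_distrib]
  rw [cubeMeas_eq_pi]
  exact integral_fintype_prod_eq_prod fun i y => f i y * g i y

lemma orthonormal_sinProd : Orthonormal ℝ fun n : Fin d → ℕ => (toL2 (sinProd n) : L2 d) := by
  rw [orthonormal_iff_ite]
  intro n m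
  rw [inner_toL2 (continuous_sinProd n) (continuous_sinProd m), sinProd, sinProd,
    integral_prodFun_mul]
  simp only [integral_sinFun_mul, Finset.prod_ite_zero]
  simp [funext_iff]

/-! ### Sine coefficients -/

/-- The coefficients of `v` with respect to the orthonormal basis of products of sines. -/
def coef (v : L2 d) (n : Fin d → ℕ) : ℝ := inner ℝ (toL2 (sinProd n)) v

lemma pairing_sinProd (v : L2 d) (n : Fin d → ℕ) : pairing v (sinProd n) = coef v n := by
  rw [pairing_eq_inner _ (continuous_sinProd n), coef, real_inner_comm]

@[simp] lemma coef_add (v w : L2 d) (n : Fin d → ℕ) : coef (v + w) n = coef v n + coef w n :=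
  inner_add_right _ _ _

@[simp] lemma coef_sub (v w : L2 d) (n : Fin d → ℕ) : coef (v - w) n = coef v n - coef w n :=
  inner_sub_right _ _ _

@[simp] lemma coef_smul (c : ℝ) (v : L2 d) (n : Fin d → ℕ) : coef (c • v) n = c * coef v n :=
  real_inner_smul_right _ _ _

@[simp] lemma coef_zero (n : Fin d → ℕ) : coef (0 : L2 d) n = 0 := inner_zero_right _

lemma coef_ext {v w : L2 d} (h : ∀ n, coef v n = coef w n) : v = w :=
  sub_eq_zero.1 <| eq_zero_of_pairing_sinProd fun n => by
    rw [pairing_sinProd, coef_sub, h, sub_self]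

/-- The Hilbert basis of products of sines. -/
def sinBasis (d : ℕ) : HilbertBasis (Fin d → ℕ) ℝ (L2 d) :=
  HilbertBasis.mkOfOrthogonalEqBot orthonormal_sinProd <| (Submodule.eq_bot_iff _).2 fun _ hv =>
    coef_ext fun n => (hv _ (Submodule.subset_span ⟨n, rfl⟩)).trans (coef_zero n).symm

lemma sinBasis_apply (n : Fin d → ℕ) : sinBasis d n = toL2 (sinProd n) := by
  simp [sinBasis]

lemma hasSum_coef_mul (v w : L2 d) : HasSum (fun n => coef v n * coef w n) (inner ℝ v w) := by
  have h := (sinBasis d).hasSum_inner_mul_inner v w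
  simp only [sinBasis_apply] at h
  exact h.congr_fun fun n => by rw [coef, coef, real_inner_comm v]

lemma exists_coef_eq {a : (Fin d → ℕ) → ℝ} {y : L2 d} {C : ℝ}
    (h : ∀ n, |a n| ≤ C * |coef y n|) :
    ∃ g : L2 d, (∀ n, coef g n = a n) ∧ ‖g‖ ^ 2 ≤ C ^ 2 * ‖y‖ ^ 2 := by
  have hparseval := (hasSum_coef_mul y y).mul_left (C ^ 2)
  have hle (n) : a n ^ 2 ≤ C ^ 2 * (coef y n * coef y n) := by
    rw [← sq_abs (a n), ← abs_mul_abs_self (coef y n), ← sq, ← mul_pow]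
    exact pow_le_pow_left₀ (abs_nonneg _) (h n) 2
  have hmem : Memℓp a 2 := by
    rw [memℓp_gen_iff (by norm_num)]
    simp only [ENNReal.toReal_ofNat, Real.rpow_ofNat, Real.norm_eq_abs, sq_abs]
    exact hparseval.summable.of_nonneg_of_le (fun n => sq_nonneg _) hle
  set g := (sinBasis d).repr.symm ⟨a, hmem⟩ with hg
  have hcoef (n) : coef g n = a n := by
    rw [coef, ← sinBasis_apply, ← HilbertBasis.repr_apply_apply, hg,
      LinearIsometryEquiv.apply_symm_apply]
  have hnorm := hasSum_coef_mul g g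
  rw [real_inner_self_eq_norm_sq] at hnorm hparseval
  refine ⟨g, hcoef, hasSum_le (fun n => ?_) hnorm hparseval⟩
  rw [hcoef, ← sq]
  exact hle n

/-- The eigenvalues of `-∂ₓₓ` with Dirichlet conditions on the unit interval. -/
def eig (k : ℕ) : ℝ := ((k + 1) * Real.pi) ^ 2

lemma one_le_eig (k : ℕ) : 1 ≤ eig k := by
  have : (0 : ℝ) ≤ k := Nat.cast_nonneg k
  exact one_le_pow₀ (by nlinarith [Real.pi_gt_three])

lemma eig_pos (k : ℕ) : 0 < eig k := one_pos.trans_le (one_le_eig k)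

lemma deriv_sinFun (k : ℕ) : deriv (sinFun k)
    = fun x => √2 * ((k + 1) * Real.pi * Real.cos ((k + 1) * Real.pi * x)) := by
  funext x
  have h := (((hasDerivAt_id x).const_mul ((k + 1) * Real.pi)).sin).const_mul (√2)
  refine h.deriv.trans ?_
  simp only [id_eq]
  ring

lemma deriv_deriv_sinFun (k : ℕ) : deriv (deriv (sinFun k)) = fun x => -eig k * sinFun k x := by
  rw [deriv_sinFun]
  funext x
  have h := ((((hasDerivAt_id x).const_mul ((k + 1) * Real.pi)).cos).const_mul
    ((k + 1) * Real.pi)).const_mul (√2)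
  refine h.deriv.trans ?_
  simp only [id_eq, eig, sinFun]
  ring

lemma mpd_two_ind_sinProd (S : Finset (Fin d)) (n : Fin d → ℕ) :
    mpd (2 • ind S) (sinProd n) = fun x => (∏ i ∈ S, -eig (n i)) * sinProd n x := by
  rw [sinProd, mpd_prodFun fun i => contDiff_sinFun (n i)]
  funext x
  have hprod : ∏ i ∈ S, -eig (n i) = ∏ i, if i ∈ S then -eig (n i) else 1 := by
    rw [Finset.prod_ite_mem, Finset.univ_inter]
  rw [prodFun, prodFun, hprod, ← Finset.prod_mul_distrib]
  refine Finset.prod_congr rfl fun i _ => ?_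
  by_cases hi : i ∈ S <;> simp [ind, hi, deriv_deriv_sinFun]

lemma pairing_const_mul (v : L2 d) (c : ℝ) (ψ : (Fin d → ℝ) → ℝ) :
    pairing v (fun x => c * ψ x) = c * pairing v ψ := by
  simp only [pairing, mul_left_comm _ c, integral_const_mul]

theorem coef_even_operator {ι : Type*} {s : Finset ι} {c : ι → ℝ} {S : ι → Finset (Fin d)}
    {v g : L2 d} {w : Fin d → L2 d} (hw : ∀ i, IsZeroTraceDeriv i v (w i))
    (h : ∀ ψ, IsTest ψ → ∑ k ∈ s, c k * pairing v (mpd (2 • ind (S k)) ψ) = pairing g ψ)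
    (n : Fin d → ℕ) :
    coef g n = (∑ k ∈ s, c k * ∏ i ∈ S k, -eig (n i)) * coef v n := by
  have hle (k) : ∀ i, (2 • ind (S k)) i ≤ 2 := fun i => by
    by_cases hi : i ∈ S k <;> simp [ind, hi]
  have hsin := sum_pairing_mpd_prodFun_eq (fun k _ => hle k) hw h
    (fun i => contDiff_sinFun (n i)) fun i => ⟨sinFun_zero _, sinFun_one _⟩
  rw [← pairing_sinProd g, sinProd, ← hsin, Finset.sum_mul]
  refine Finset.sum_congr rfl fun k _ => ?_
  rw [← sinProd, mpd_two_ind_sinProd, pairing_const_mul, pairing_sinProd, mul_assoc]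

/-! ### Integration by parts against test functions -/

lemma contDiff_pd {ψ : (Fin d → ℝ) → ℝ} (hψ : ContDiff ℝ ∞ ψ) (i : Fin d) :
    ContDiff ℝ ∞ (pd i ψ) :=
  (hψ.fderiv_right (by simp)).clm_apply contDiff_const

lemma contDiff_iterate_pd {ψ : (Fin d → ℝ) → ℝ} (hψ : ContDiff ℝ ∞ ψ) (i : Fin d) (k : ℕ) :
    ContDiff ℝ ∞ ((pd i)^[k] ψ) := by
  induction k with
  | zero => exact hψ
  | succ k ih => rw [Function.iterate_succ_apply']; exact contDiff_pd ih i

namespace IsTest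

variable {ψ χ : (Fin d → ℝ) → ℝ}

lemma continuous (hψ : IsTest ψ) : Continuous ψ := hψ.1.continuous

lemma eq_zero (hψ : IsTest ψ) {x : Fin d → ℝ} (hx : x ∉ cube d) : ψ x = 0 :=
  image_eq_zero_of_notMem_tsupport fun h => hx (hψ.2.2 h)

lemma pd (hψ : IsTest ψ) (i : Fin d) : IsTest (pd i ψ) :=
  ⟨contDiff_pd hψ.1 i, hψ.2.1.fderiv_apply ℝ _,
    (tsupport_fderiv_apply_subset ℝ _).trans hψ.2.2⟩

lemma iterate_pd (hψ : IsTest ψ) (i : Fin d) (k : ℕ) : IsTest ((DirSplit.pd i)^[k] ψ) := by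
  induction k with
  | zero => exact hψ
  | succ k ih => rw [Function.iterate_succ_apply']; exact ih.pd i

lemma foldr_pd (hψ : IsTest ψ) (α : Fin d → ℕ) (l : List (Fin d)) :
    IsTest (l.foldr (fun i h => (DirSplit.pd i)^[α i] h) ψ) := by
  induction l with
  | nil => exact hψ
  | cons a l ih => exact ih.iterate_pd a _

lemma mpd (hψ : IsTest ψ) (α : Fin d → ℕ) : IsTest (mpd α ψ) := hψ.foldr_pd α _

lemma add (hψ : IsTest ψ) (hχ : IsTest χ) : IsTest (fun x => ψ x + χ x) :=
  ⟨hψ.1.add hχ.1, hψ.2.1.add hχ.2.1, (tsupport_add ψ χ).trans (union_subset hψ.2.2 hχ.2.2)⟩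

lemma const_mul (hψ : IsTest ψ) (c : ℝ) : IsTest (fun x => c * ψ x) :=
  ⟨contDiff_const.mul hψ.1, hψ.2.1.mul_left,
    (tsupport_mul_subset_right (f := fun _ => c)).trans hψ.2.2⟩

end IsTest

lemma isTest_zero : IsTest (0 : (Fin d → ℝ) → ℝ) :=
  ⟨contDiff_const, HasCompactSupport.zero, by simp [tsupport_eq_empty_iff.2]⟩

lemma integral_mul_pd {F ψ : (Fin d → ℝ) → ℝ} (hF : ContDiff ℝ ∞ F) (hψ : IsTest ψ) (i : Fin d) :
    ∫ x in cube d, F x * pd i ψ x = -∫ x in cube d, pd i F x * ψ x := by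
  rw [setIntegral_eq_integral_of_forall_compl_eq_zero
      fun x hx => by rw [(hψ.pd i).eq_zero hx, mul_zero],
    setIntegral_eq_integral_of_forall_compl_eq_zero
      fun x hx => by rw [hψ.eq_zero hx, mul_zero]]
  refine integral_mul_fderiv_eq_neg_fderiv_mul_of_integrable ?_ ?_ ?_
    (fun x _ => (hF.differentiable (by simp)) x) (fun x _ => (hψ.1.differentiable (by simp)) x)
  · exact ((contDiff_pd hF i).continuous.mul hψ.continuous).integrable_of_hasCompactSupport
      hψ.2.1.mul_left
  · exact (hF.continuous.mul (hψ.pd i).continuous).integrable_of_hasCompactSupport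
      (hψ.pd i).2.1.mul_left
  · exact (hF.continuous.mul hψ.continuous).integrable_of_hasCompactSupport hψ.2.1.mul_left

lemma integral_mul_iterate_pd {F ψ : (Fin d → ℝ) → ℝ} (hF : ContDiff ℝ ∞ F) (hψ : IsTest ψ)
    (i : Fin d) (k : ℕ) :
    ∫ x in cube d, F x * (pd i)^[k] ψ x = (-1) ^ k * ∫ x in cube d, (pd i)^[k] F x * ψ x := by
  induction k generalizing F with
  | zero => simp
  | succ k ih =>
    rw [Function.iterate_succ_apply', integral_mul_pd hF (hψ.iterate_pd i k),
      ih (contDiff_pd hF i), Function.iterate_succ_apply, pow_succ]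
    ring

lemma integral_mul_foldr_pd {F ψ : (Fin d → ℝ) → ℝ} (hF : ContDiff ℝ ∞ F) (hψ : IsTest ψ)
    (α : Fin d → ℕ) (l : List (Fin d)) :
    ∫ x in cube d, F x * l.foldr (fun i h => (pd i)^[α i] h) ψ x
      = (-1) ^ (l.map α).sum
        * ∫ x in cube d, l.reverse.foldr (fun i h => (pd i)^[α i] h) F x * ψ x := by
  induction l generalizing F with
  | nil => simp
  | cons a l ih =>
    rw [List.foldr_cons, integral_mul_iterate_pd hF (hψ.foldr_pd α l),
      ih (contDiff_iterate_pd hF a _), List.map_cons, List.sum_cons, pow_add, List.reverse_cons,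
      List.foldr_append, List.foldr_cons, List.foldr_nil, mul_assoc]

lemma isWeakDeriv_prodFun {f : Fin d → ℝ → ℝ} (hf : ∀ i, ContDiff ℝ ∞ (f i)) (α : Fin d → ℕ) :
    IsWeakDeriv α (toL2 (prodFun f)) (toL2 (prodFun fun i => deriv^[α i] (f i))) := by
  intro ψ hψ
  rw [pairing_toL2 (continuous_prodFun fun i => (hf i).continuous),
    pairing_toL2 (continuous_prodFun fun i => ((hf i).iterate_deriv _).continuous), mpd,
    integral_mul_foldr_pd (contDiff_prodFun hf) hψ,
    foldr_pd_prodFun hf α (List.nodup_reverse.2 (List.nodup_finRange d)), ← List.ofFn_eq_map,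
    List.sum_ofFn]
  simp

lemma mpd_single (i : Fin d) (k : ℕ) (ψ : (Fin d → ℝ) → ℝ) :
    mpd (Pi.single i k) ψ = (pd i)^[k] ψ := by
  have hfoldr (l : List (Fin d)) (hl : l.Nodup) :
      l.foldr (fun j h => (pd j)^[(Pi.single i k : Fin d → ℕ) j] h) ψ
        = if i ∈ l then (pd i)^[k] ψ else ψ := by
    induction l with
    | nil => simp
    | cons a l ih =>
      rw [List.nodup_cons] at hl
      rw [List.foldr_cons, ih hl.2]
      by_cases h : a = i
      · subst h; simp [hl.1]
      · simp [h, Ne.symm h]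
  rw [mpd, hfoldr _ (List.nodup_finRange d), if_pos (List.mem_finRange i)]

lemma mpd_zero (ψ : (Fin d → ℝ) → ℝ) : mpd 0 ψ = ψ := by
  simp [mpd]

lemma ind_singleton (i : Fin d) : ind {i} = Pi.single i 1 := by
  funext j
  simp [ind, Pi.single_apply]

lemma ind_empty : ind (∅ : Finset (Fin d)) = 0 := by
  funext j
  simp [ind]

lemma two_ind_singleton (i : Fin d) : 2 • ind {i} = Pi.single i 2 := by
  funext j
  simp [ind, Pi.single_apply]

lemma isWeakDeriv_single_iff {i : Fin d} {v g : L2 d} :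
    IsWeakDeriv (Pi.single i 1) v g ↔
      ∀ ψ, IsTest ψ → pairing v (pd i ψ) = - pairing g ψ := by
  simp [IsWeakDeriv, mpd_single]

lemma IsZeroTraceDeriv.isWeakDeriv {i : Fin d} {v g : L2 d} (h : IsZeroTraceDeriv i v g) :
    IsWeakDeriv (Pi.single i 1) v g :=
  isWeakDeriv_single_iff.2 fun ψ hψ => h ψ hψ.1 hψ.2.1

/-! ### The space `H¹₀` -/

/-- Pairs `(v, ∇v)` of a function (at `none`) and its gradient (at `some i`), so that the Hilbert
space norm of the pair is the `W^{1,2}` norm of `v`. -/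
abbrev GradSpace (d : ℕ) : Type := PiLp 2 (fun _ : Option (Fin d) => L2 d)

/-- The pair `(ψ, ∇ψ)` of a smooth function. -/
def testGrad (ψ : (Fin d → ℝ) → ℝ) : GradSpace d :=
  WithLp.toLp 2 fun o => o.elim (toL2 ψ) fun i => toL2 (pd i ψ)

@[simp] lemma testGrad_none (ψ : (Fin d → ℝ) → ℝ) : testGrad ψ none = toL2 ψ := rfl

@[simp] lemma testGrad_some (ψ : (Fin d → ℝ) → ℝ) (i : Fin d) :
    testGrad ψ (some i) = toL2 (pd i ψ) := rfl

lemma pd_zero (i : Fin d) : pd i 0 = 0 := by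
  funext x
  simp [pd]

lemma pd_add {ψ χ : (Fin d → ℝ) → ℝ} (hψ : ContDiff ℝ ∞ ψ) (hχ : ContDiff ℝ ∞ χ) (i : Fin d) :
    pd i (fun x => ψ x + χ x) = fun x => pd i ψ x + pd i χ x := by
  funext x
  rw [pd, fderiv_fun_add ((hψ.differentiable (by simp)) x) ((hχ.differentiable (by simp)) x)]
  rfl

lemma pd_const_mul {ψ : (Fin d → ℝ) → ℝ} (hψ : ContDiff ℝ ∞ ψ) (c : ℝ) (i : Fin d) :
    pd i (fun x => c * ψ x) = fun x => c * pd i ψ x := by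
  funext x
  rw [pd, fderiv_const_mul ((hψ.differentiable (by simp)) x)]
  rfl

lemma toL2_zero : toL2 (0 : (Fin d → ℝ) → ℝ) = 0 := by
  simpa using! toL2_smul 0 (continuous_zero : Continuous (0 : (Fin d → ℝ) → ℝ))

/-- The graph of the gradient on `C_c^∞(Ω)`. -/
def testSpace (d : ℕ) : Submodule ℝ (GradSpace d) where
  carrier := {z | ∃ ψ, IsTest ψ ∧ testGrad ψ = z}
  zero_mem' := by
    refine ⟨_, isTest_zero, ?_⟩
    ext1 o
    rcases o with _ | i
    · exact toL2_zero
    · rw [testGrad_some, pd_zero, toL2_zero]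
      rfl
  add_mem' := by
    rintro _ _ ⟨ψ, hψ, rfl⟩ ⟨χ, hχ, rfl⟩
    refine ⟨_, hψ.add hχ, ?_⟩
    ext1 o
    rcases o with _ | i
    · exact toL2_add hψ.continuous hχ.continuous
    · rw [testGrad_some, pd_add hψ.1 hχ.1]
      exact toL2_add (hψ.pd i).continuous (hχ.pd i).continuous
  smul_mem' := by
    rintro c _ ⟨ψ, hψ, rfl⟩
    refine ⟨_, hψ.const_mul c, ?_⟩
    ext1 o
    rcases o with _ | i
    · exact toL2_smul c hψ.continuous
    · rw [testGrad_some, pd_const_mul hψ.1]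
      exact toL2_smul c (hψ.pd i).continuous

/-- The graph of the gradient on `H¹₀(Ω)`, a Hilbert space. -/
def hOneZero (d : ℕ) : Submodule ℝ (GradSpace d) := (testSpace d).topologicalClosure

instance completeSpace_hOneZero : CompleteSpace (hOneZero d) :=
  (Submodule.isClosed_topologicalClosure _).completeSpace_coe

lemma testGrad_mem_hOneZero {ψ : (Fin d → ℝ) → ℝ} (hψ : IsTest ψ) : testGrad ψ ∈ hOneZero d :=
  Submodule.le_topologicalClosure _ ⟨ψ, hψ, rfl⟩

lemma tendsto_toL2_iff {ψ : ℕ → (Fin d → ℝ) → ℝ} (hψ : ∀ n, Continuous (ψ n)) (v : L2 d) :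
    Tendsto (fun n => toL2 (ψ n)) atTop (𝓝 v) ↔
      Tendsto (fun n => eLpNorm (fun x => ψ n x - v x) 2 (volume.restrict (cube d))) atTop
        (𝓝 0) := by
  rw [Lp.tendsto_Lp_iff_tendsto_eLpNorm']
  refine tendsto_congr fun n => eLpNorm_congr_ae ?_
  filter_upwards [coeFn_toL2 (hψ n)] with x hx
  simp [hx]

lemma tendsto_gradSpace_iff {z : ℕ → GradSpace d} {y : GradSpace d} :
    Tendsto z atTop (𝓝 y) ↔ ∀ o, Tendsto (fun n => z n o) atTop (𝓝 (y o)) :=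
  ⟨fun h o => ((PiLp.continuous_apply 2 _ o).tendsto y).comp h, fun h =>
    ((PiLp.continuous_toLp 2 _).tendsto _).comp (tendsto_pi_nhds (f := fun n => (z n).ofLp).2 h)⟩

theorem memH10_iff {v : L2 d} : MemH10 v ↔ ∃ z ∈ hOneZero d, z none = v := by
  constructor
  · rintro ⟨g, ψ, hψ, hv, hg⟩
    refine ⟨WithLp.toLp 2 fun o => o.elim v g, ?_, rfl⟩
    refine mem_closure_of_tendsto (f := fun n => testGrad (ψ n)) (b := atTop) ?_
      (Eventually.of_forall fun n => ⟨ψ n, hψ n, rfl⟩)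
    rw [tendsto_gradSpace_iff]
    rintro (_ | i)
    · exact (tendsto_toL2_iff (fun n => (hψ n).continuous) v).2 hv
    · exact (tendsto_toL2_iff (fun n => ((hψ n).pd i).continuous) (g i)).2 (hg i)
  · rintro ⟨z, hz, rfl⟩
    obtain ⟨y, hy, hyz⟩ := mem_closure_iff_seq_limit.1 hz
    choose ψ hψ hψy using hy
    rw [tendsto_gradSpace_iff] at hyz
    refine ⟨fun i => z (some i), ψ, hψ, ?_, fun i => ?_⟩
    · rw [← tendsto_toL2_iff fun n => (hψ n).continuous]
      simpa [← hψy] using hyz none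
    · rw [← tendsto_toL2_iff fun n => ((hψ n).pd i).continuous]
      simpa [← hψy] using hyz (some i)

lemma eqOn_hOneZero {E : Type*} [TopologicalSpace E] [T2Space E] {F G : GradSpace d → E}
    (hF : Continuous F) (hG : Continuous G) (h : ∀ ψ, IsTest ψ → F (testGrad ψ) = G (testGrad ψ)) :
    EqOn F G (hOneZero d) := by
  refine EqOn.closure ?_ hF hG
  rintro _ ⟨ψ, hψ, rfl⟩
  exact h ψ hψ

lemma continuous_inner_apply {ι : Type*} (o : ι) (w : L2 d) :
    Continuous (fun z : PiLp 2 (fun _ : ι => L2 d) => inner ℝ (z o) w) :=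
  (PiLp.continuous_apply 2 _ o).inner continuous_const

lemma isZeroTraceDeriv_of_mem_hOneZero {z : GradSpace d} (hz : z ∈ hOneZero d) (i : Fin d) :
    IsZeroTraceDeriv i (z none) (z (some i)) := by
  intro χ hχ _
  have hpd := (contDiff_pd hχ i).continuous
  rw [pairing_eq_inner _ hpd, pairing_eq_inner _ hχ.continuous]
  refine eqOn_hOneZero (F := fun z => inner ℝ (z none) (toL2 (pd i χ)))
    (G := fun z => -inner ℝ (z (some i)) (toL2 χ))
    (continuous_inner_apply _ _) (continuous_inner_apply _ _).neg (fun ψ hψ => ?_) hz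
  simp only [testGrad_none, testGrad_some]
  rw [inner_toL2 hψ.continuous hpd, inner_toL2 (hψ.pd i).continuous hχ.continuous]
  simp only [mul_comm (ψ _), mul_comm (pd i ψ _), integral_mul_pd hχ hψ i, neg_neg]

lemma inner_grad_eq_neg {z : GradSpace d} (hz : z ∈ hOneZero d) {i : Fin d} {q q' : L2 d}
    (h : IsWeakDeriv (Pi.single i 1) q q') : inner ℝ (z (some i)) q = -inner ℝ (z none) q' := by
  refine eqOn_hOneZero (F := fun z => inner ℝ (z (some i)) q) (G := fun z => -inner ℝ (z none) q')
    (continuous_inner_apply _ _) (continuous_inner_apply _ _).neg (fun ψ hψ => ?_) hz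
  have hparts := isWeakDeriv_single_iff.1 h ψ hψ
  rw [pairing_eq_inner _ (hψ.pd i).continuous, pairing_eq_inner _ hψ.continuous] at hparts
  simp only [testGrad_none, testGrad_some]
  rw [real_inner_comm, hparts, real_inner_comm q']

/-- The eigenvalues of `-Δ` on the cube, with Dirichlet conditions. -/
def lam (n : Fin d → ℕ) : ℝ := ∑ i, eig (n i)

lemma lam_nonneg (n : Fin d → ℕ) : 0 ≤ lam n := Finset.sum_nonneg fun _ _ => (eig_pos _).le

lemma pairing_laplacian (v : L2 d) {ψ : (Fin d → ℝ) → ℝ} (hψ : IsTest ψ) :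
    pairing v (fun x => ∑ i, mpd (Pi.single i 2) ψ x) = ∑ i, pairing v (mpd (Pi.single i 2) ψ) := by
  simpa using pairing_sum Finset.univ v (fun _ : Fin d => (1 : ℝ))
    fun i _ => (hψ.mpd (Pi.single i 2)).continuous

theorem coef_laplacian {v g : L2 d} {w : Fin d → L2 d} (hw : ∀ i, IsZeroTraceDeriv i v (w i))
    (h : ∀ ψ, IsTest ψ → pairing v (fun x => ∑ i, mpd (Pi.single i 2) ψ x) = pairing g ψ)
    (n : Fin d → ℕ) : coef g n = -lam n * coef v n := by
  have heven := coef_even_operator (s := Finset.univ) (c := fun _ => 1) (S := fun i => {i}) hw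
    (fun ψ hψ => by simpa only [two_ind_singleton, pairing_laplacian v hψ, one_mul] using h ψ hψ) n
  simpa [lam] using heven

theorem coef_second_deriv {v g : L2 d} {w : Fin d → L2 d} (hw : ∀ i, IsZeroTraceDeriv i v (w i))
    {i : Fin d} (h : IsWeakDeriv (Pi.single i 2) v g) (n : Fin d → ℕ) :
    coef g n = -eig (n i) * coef v n := by
  have heven := coef_even_operator (g := g) (s := {i}) (c := fun _ => 1) (S := fun i => {i}) hw
    (fun ψ hψ => by
      rw [Finset.sum_singleton, two_ind_singleton, one_mul, h ψ hψ]
      simp) n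
  simpa using heven

lemma exists_mem_hOneZero_forall_inner_eq (h : L2 d) :
    ∃ z ∈ hOneZero d, ∀ w ∈ hOneZero d, inner ℝ z w = inner ℝ h (w none) := by
  let ℓ : hOneZero d →L[ℝ] ℝ :=
    innerSL ℝ h ∘L PiLp.proj 2 (fun _ : Option (Fin d) => L2 d) none ∘L (hOneZero d).subtypeL
  refine ⟨(InnerProductSpace.toDual ℝ (hOneZero d)).symm ℓ, Subtype.coe_prop _, fun w hw => ?_⟩
  exact InnerProductSpace.toDual_symm_apply (x := (⟨w, hw⟩ : hOneZero d)) (y := ℓ)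

lemma inner_gradSpace (z w : GradSpace d) :
    inner ℝ z w = inner ℝ (z none) (w none) + ∑ i, inner ℝ (z (some i)) (w (some i)) := by
  rw [PiLp.inner_apply, Fintype.sum_option]

lemma pairing_laplacian_of_mem_hOneZero {z : GradSpace d} (hz : z ∈ hOneZero d)
    {ψ : (Fin d → ℝ) → ℝ} (hψ : IsTest ψ) :
    pairing (z none) (fun x => ∑ i, mpd (Pi.single i 2) ψ x)
      = -∑ i, inner ℝ (z (some i)) (toL2 (pd i ψ)) := by
  rw [pairing_laplacian _ hψ, ← Finset.sum_neg_distrib]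
  refine Finset.sum_congr rfl fun i _ => ?_
  rw [mpd_single, ← pairing_eq_inner _ (hψ.pd i).continuous]
  exact isZeroTraceDeriv_of_mem_hOneZero hz i _ (hψ.pd i).1 (hψ.pd i).2.1

/- The weak solution `z` of `z - Δ z = h` has the sine coefficients of `v`. -/
theorem exists_mem_hOneZero_of_coef {v h : L2 d} (hv : ∀ n, coef h n = (1 + lam n) * coef v n) :
    ∃ z ∈ hOneZero d, z none = v ∧ ∑ i, ‖z (some i)‖ ^ 2 = inner ℝ h v - ‖v‖ ^ 2 := by
  obtain ⟨z, hz, hweak⟩ := exists_mem_hOneZero_forall_inner_eq h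
  have hlap (ψ) (hψ : IsTest ψ) :
      pairing (z none) (fun x => ∑ i, mpd (Pi.single i 2) ψ x) = pairing (z none - h) ψ := by
    have htest := hweak _ (testGrad_mem_hOneZero hψ)
    rw [inner_gradSpace] at htest
    simp only [testGrad_none, testGrad_some] at htest
    rw [pairing_laplacian_of_mem_hOneZero hz hψ, pairing_eq_inner _ hψ.continuous,
      inner_sub_left]
    linarith
  have hzv : z none = v := by
    refine coef_ext fun n => ?_
    have hcoef := coef_laplacian (isZeroTraceDeriv_of_mem_hOneZero hz) hlap n
    rw [coef_sub, hv] at hcoef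
    have hpos : 0 < 1 + lam n := by linarith [lam_nonneg n]
    exact mul_left_cancel₀ hpos.ne' (by linarith)
  have henergy := hweak z hz
  rw [inner_gradSpace, hzv] at henergy
  simp only [real_inner_self_eq_norm_sq] at henergy
  exact ⟨z, hz, hzv, by linarith⟩

lemma coef_toL2_mpd_two_ind {ψ : (Fin d → ℝ) → ℝ} (hψ : IsTest ψ) (S : Finset (Fin d))
    (n : Fin d → ℕ) :
    coef (toL2 (mpd (2 • ind S) ψ)) n = (∏ i ∈ S, -eig (n i)) * coef (toL2 ψ) n := by
  have hcoef {χ : (Fin d → ℝ) → ℝ} (hχ : Continuous χ) :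
      coef (toL2 χ) n = pairing (toL2 (sinProd n)) χ := by
    rw [coef, pairing_eq_inner _ hχ]
  have hsmul : toL2 (fun x => (∏ i ∈ S, -eig (n i)) * sinProd n x)
      = (∏ i ∈ S, -eig (n i)) • toL2 (sinProd n) := toL2_smul _ (continuous_sinProd n)
  have hparts := isWeakDeriv_prodFun (fun i => contDiff_sinFun (n i)) (2 • ind S) ψ hψ
  rw [← mpd_prodFun fun i => contDiff_sinFun (n i), ← sinProd, mpd_two_ind_sinProd,
    hsmul] at hparts
  have heven : (-1 : ℝ) ^ ∑ i, (2 • ind S) i = 1 := by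
    simp [← Finset.mul_sum, pow_mul]
  rw [hcoef (hψ.mpd _).continuous, hcoef hψ.continuous, hparts, heven, one_mul,
    pairing_eq_inner _ hψ.continuous, pairing_eq_inner _ hψ.continuous, real_inner_smul_left]

theorem pairing_even_operator_of_coef {ι : Type*} {s : Finset ι} {c : ι → ℝ}
    {S : ι → Finset (Fin d)} {v g : L2 d}
    (h : ∀ n, coef g n = (∑ k ∈ s, c k * ∏ i ∈ S k, -eig (n i)) * coef v n)
    {ψ : (Fin d → ℝ) → ℝ} (hψ : IsTest ψ) :
    ∑ k ∈ s, c k * pairing v (mpd (2 • ind (S k)) ψ) = pairing g ψ := by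
  simp only [pairing_eq_inner _ (hψ.mpd _).continuous, pairing_eq_inner _ hψ.continuous]
  have hsum := hasSum_sum fun k (_ : k ∈ s) =>
    (hasSum_coef_mul v (toL2 (mpd (2 • ind (S k)) ψ))).mul_left (c k)
  refine hsum.unique ((hasSum_coef_mul g _).congr_fun fun n => ?_)
  simp only [h, coef_toL2_mpd_two_ind hψ, Finset.sum_mul]
  exact Finset.sum_congr rfl fun k _ => by ring

/-! ### The pressure space -/

/-- Families `(∂_S q)_S` of mixed derivatives, the derivative with `S = ∅` being `q` itself. -/
abbrev MixedSpace (d : ℕ) : Type := PiLp 2 (fun _ : Finset (Fin d) => L2 d)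

lemma zeroMean_iff {v : L2 d} : ZeroMean v ↔ inner ℝ v (toL2 (fun _ => 1)) = 0 := by
  rw [← pairing_eq_inner v continuous_const]
  simp [ZeroMean, pairing]

lemma isWeakDeriv_iff {α : Fin d → ℕ} {v g : L2 d} : IsWeakDeriv α v g ↔ ∀ ψ, IsTest ψ →
    inner ℝ v (toL2 (mpd α ψ)) = (-1) ^ (∑ i, α i) * inner ℝ g (toL2 ψ) :=
  forall₂_congr fun ψ hψ => by
    rw [pairing_eq_inner _ (hψ.mpd α).continuous, pairing_eq_inner _ hψ.continuous]

/-- The space `Y`, as the graph of `q ↦ (∂_S q)_S`. -/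
def presSpace (d : ℕ) : Submodule ℝ (MixedSpace d) where
  carrier := {y | ZeroMean (y ∅) ∧ ∀ S, IsWeakDeriv (ind S) (y ∅) (y S)}
  zero_mem' := by
    simp [zeroMean_iff, isWeakDeriv_iff]
  add_mem' := by
    intro a b ha hb
    simp only [Set.mem_ofPred_eq, zeroMean_iff, isWeakDeriv_iff, PiLp.add_apply,
      inner_add_left] at *
    refine ⟨by rw [ha.1, hb.1, add_zero], fun S ψ hψ => ?_⟩
    rw [ha.2 S ψ hψ, hb.2 S ψ hψ]
    ring
  smul_mem' := by
    intro c a ha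
    simp only [Set.mem_ofPred_eq, zeroMean_iff, isWeakDeriv_iff, PiLp.smul_apply,
      real_inner_smul_left] at *
    refine ⟨by rw [ha.1, mul_zero], fun S ψ hψ => ?_⟩
    rw [ha.2 S ψ hψ]
    ring

lemma isClosed_presSpace : IsClosed (presSpace d : Set (MixedSpace d)) := by
  have heq : (presSpace d : Set (MixedSpace d)) = {y | ZeroMean (y ∅)} ∩
      ⋂ S, {y | IsWeakDeriv (ind S) (y ∅) (y S)} := by
    ext y
    simp [presSpace]
  rw [heq]
  refine IsClosed.inter ?_ (isClosed_iInter fun S => ?_)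
  · simp only [zeroMean_iff]
    exact isClosed_eq (continuous_inner_apply _ _) continuous_const
  · simp only [isWeakDeriv_iff, ofPred_forall]
    exact isClosed_iInter fun ψ => isClosed_iInter fun _ =>
      isClosed_eq (continuous_inner_apply _ _) ((continuous_inner_apply _ _).const_mul _)

instance completeSpace_presSpace : CompleteSpace (presSpace d) :=
  isClosed_presSpace.completeSpace_coe

lemma presSpace_norm_sq (q : presSpace d) : ‖q‖ ^ 2 = ∑ S, ‖(q : MixedSpace d) S‖ ^ 2 :=
  PiLp.norm_sq_eq_of_L2 _ (q : MixedSpace d)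

/-- The gradient as a bounded operator from `Y` to `L²(Ω)^d`. -/
def presGrad (d : ℕ) : presSpace d →L[ℝ] VL2 d :=
  LinearMap.mkContinuous
    { toFun := fun q => WithLp.toLp 2 fun i => (q : MixedSpace d) {i}
      map_add' := fun _ _ => rfl
      map_smul' := fun _ _ => rfl } 1 fun q => by
    rw [one_mul, ← sq_le_sq₀ (norm_nonneg _) (norm_nonneg _), PiLp.norm_sq_eq_of_L2,
      presSpace_norm_sq]
    change ∑ i : Fin d, ‖(q : MixedSpace d) {i}‖ ^ 2 ≤ _
    refine (Finset.sum_map Finset.univ ⟨singleton, Finset.singleton_injective⟩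
      fun S => ‖(q : MixedSpace d) S‖ ^ 2).symm.trans_le ?_
    exact Finset.sum_le_univ_sum_of_nonneg fun S => sq_nonneg _

lemma norm_presGrad_le : ‖presGrad d‖ ≤ 1 :=
  LinearMap.mkContinuous_norm_le _ zero_le_one _

lemma isWeakGrad_presGrad (q : presSpace d) :
    IsWeakGrad ((q : MixedSpace d) ∅) (presGrad d q) := fun i => by
  rw [← ind_singleton]
  exact q.2.2 {i}

lemma IsWeakGrad.unique {q : L2 d} {G G' : VL2 d} (h : IsWeakGrad q G) (h' : IsWeakGrad q G') :
    G = G' :=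
  PiLp.ext fun i => (h i).unique (h' i)

/-! ### The operator `A` -/

/-- The eigenvalues of `-∂ₓₓ` on `(0,1)` with Neumann conditions. -/
def neig (k : ℕ) : ℝ := (k * Real.pi) ^ 2

lemma neig_nonneg (k : ℕ) : 0 ≤ neig k := sq_nonneg _

lemma deriv_cosFun (k : ℕ) :
    deriv (cosFun k) = fun x => -(k * Real.pi * Real.sin (k * Real.pi * x)) := by
  funext x
  refine ((hasDerivAt_id x).const_mul (k * Real.pi)).cos.deriv.trans ?_
  simp only [id_eq]
  ring

lemma deriv_deriv_cosFun (k : ℕ) : deriv (deriv (cosFun k)) = fun x => -neig k * cosFun k x := by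
  rw [deriv_cosFun]
  funext x
  refine ((((hasDerivAt_id x).const_mul (k * Real.pi)).sin).const_mul
    (k * Real.pi)).fun_neg.deriv.trans ?_
  simp only [id_eq, neig, cosFun]
  ring

lemma deriv_cosFun_zero (k : ℕ) : deriv (cosFun k) 0 = 0 := by simp [deriv_cosFun]

lemma deriv_cosFun_one (k : ℕ) : deriv (cosFun k) 1 = 0 := by
  simp [deriv_cosFun, Real.sin_nat_mul_pi]

/-- The mixed derivative `∂_S` of the product of the cosines with frequencies `n`. -/
def cosDeriv (S : Finset (Fin d)) (n : Fin d → ℕ) : (Fin d → ℝ) → ℝ :=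
  prodFun fun i => deriv^[ind S i] (cosFun (n i))

lemma continuous_cosDeriv (S : Finset (Fin d)) (n : Fin d → ℕ) : Continuous (cosDeriv S n) :=
  continuous_prodFun fun i => ((contDiff_cosFun (n i)).iterate_deriv _).continuous

lemma cosDeriv_empty (n : Fin d → ℕ) : cosDeriv ∅ n = cosProd n := by
  simp [cosDeriv, cosProd, ind]

lemma prodFun_iterate_deriv_iterate_deriv_cosFun (S : Finset (Fin d)) (n : Fin d → ℕ) :
    prodFun (fun i => deriv^[ind S i] (deriv^[ind S i] (cosFun (n i))))
      = fun x => (∏ i ∈ S, -neig (n i)) * cosProd n x := by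
  funext x
  have hprod : ∏ i ∈ S, -neig (n i) = ∏ i, if i ∈ S then -neig (n i) else 1 := by
    rw [Finset.prod_ite_mem, Finset.univ_inter]
  rw [prodFun, cosProd, prodFun, hprod, ← Finset.prod_mul_distrib]
  refine Finset.prod_congr rfl fun i _ => ?_
  by_cases hi : i ∈ S <;> simp [ind, hi, deriv_deriv_cosFun]

lemma IsWeakDeriv.pairing_cosDeriv {S : Finset (Fin d)} {v g : L2 d} (h : IsWeakDeriv (ind S) v g)
    (n : Fin d → ℕ) :
    pairing g (cosDeriv S n) = (∏ i ∈ S, neig (n i)) * pairing v (cosProd n) := by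
  have hind (i) : ind S i ≤ 1 := by rw [ind]; split_ifs <;> simp
  have hparts := h.pairing_prodFun hind (f := fun i => deriv^[ind S i] (cosFun (n i)))
    (fun i => (contDiff_cosFun (n i)).iterate_deriv _)
    fun i hi => by simp [hi, deriv_cosFun_zero, deriv_cosFun_one]
  have hcard : ∑ i, ind S i = S.card := by simp [ind]
  rw [prodFun_iterate_deriv_iterate_deriv_cosFun, pairing_const_mul, Finset.prod_neg, hcard,
    mul_assoc] at hparts
  exact (mul_left_cancel₀ (by simp) hparts).symm

lemma IsNeumannSecond.pairing_cosProd {i : Fin d} {v a : L2 d} (h : IsNeumannSecond i v a)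
    (n : Fin d → ℕ) : pairing a (cosProd n) = -neig (n i) * pairing v (cosProd n) := by
  obtain ⟨w, hvw, hwa⟩ := h
  have hupdate : cosDeriv {i} n
      = prodFun (Function.update (fun i => cosFun (n i)) i (deriv (cosFun (n i)))) := by
    refine congrArg prodFun (funext fun j => ?_)
    obtain rfl | hj := eq_or_ne j i
    · simp [ind]
    · simp [ind, hj]
  have hfirst := (ind_singleton i ▸ hvw).pairing_cosDeriv n
  rw [hupdate, hwa.pairing_prodFun fun i => contDiff_cosFun (n i), Finset.prod_singleton] at hfirst
  rw [neg_mul, ← hfirst, neg_neg, cosProd]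

lemma pairing_sub_left (v w : L2 d) {ψ : (Fin d → ℝ) → ℝ} (hψ : Continuous ψ) :
    pairing (v - w) ψ = pairing v ψ - pairing w ψ := by
  simp only [pairing_eq_inner _ hψ, inner_sub_left]

lemma eq_prod_mul_of_chain {M : Type*} [CommMonoid M] : ∀ {m : ℕ} {F : Fin (m + 1) → M}
    {κ : Fin m → M}, (∀ i, F i.castSucc = κ i * F i.succ) → F 0 = (∏ i, κ i) * F (Fin.last m)
  | 0, F, κ, _ => by simp
  | m + 1, F, κ, h => by
    have ih := eq_prod_mul_of_chain (F := fun i => F i.succ) (κ := fun i => κ i.succ)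
      fun i => h i.succ
    rw [Fin.prod_univ_succ, mul_assoc, ← Fin.succ_last, ← ih]
    exact h 0

lemma IsA.pairing_cosProd {φ h : L2 d} (hA : IsA φ h) (n : Fin d → ℕ) :
    pairing h (cosProd n) = (∏ i, (1 + neig (n i))) * pairing φ (cosProd n) := by
  obtain ⟨-, w, rfl, rfl, hw⟩ := hA
  refine eq_prod_mul_of_chain (F := fun k => pairing (w k) (cosProd n)) fun i => ?_
  obtain ⟨a, ha, hwi⟩ := hw i
  rw [hwi, pairing_sub_left _ _ (continuous_cosProd n), ha.pairing_cosProd]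
  ring

/-- The family of mixed derivatives `∂_S` of a product of cosines. -/
def cosMixed (n : Fin d → ℕ) : MixedSpace d := WithLp.toLp 2 fun S => toL2 (cosDeriv S n)

lemma cosMixed_empty (n : Fin d → ℕ) : cosMixed n ∅ = toL2 (cosProd n) :=
  congrArg toL2 (cosDeriv_empty n)

lemma integral_cosProd {n : Fin d → ℕ} (hn : n ≠ 0) : ∫ x in cube d, cosProd n x = 0 := by
  obtain ⟨i, hi⟩ := Function.ne_iff.1 hn
  have hcos : ∫ x in Ioo (0 : ℝ) 1, cosFun (n i) x = 0 :=
    (integral_cos_int_mul_pi (n i)).trans (if_neg (by simpa using hi))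
  have hprod := integral_prodFun_mul (fun i => cosFun (n i)) fun _ _ => 1
  simp only [prodFun, Finset.prod_const_one, mul_one] at hprod
  exact hprod.trans (Finset.prod_eq_zero (Finset.mem_univ i) hcos)

lemma cosMixed_mem {n : Fin d → ℕ} (hn : n ≠ 0) : cosMixed n ∈ presSpace d := by
  refine ⟨?_, fun S => ?_⟩
  · rw [cosMixed_empty, zeroMean_iff, inner_toL2 (continuous_cosProd n) continuous_const]
    simpa using integral_cosProd hn
  · rw [cosMixed_empty]
    exact isWeakDeriv_prodFun (fun i => contDiff_cosFun (n i)) (ind S)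

lemma inner_cosMixed (q : presSpace d) (n : Fin d → ℕ) : inner ℝ (q : MixedSpace d) (cosMixed n)
    = (∏ i, (1 + neig (n i))) * pairing ((q : MixedSpace d) ∅) (cosProd n) := by
  rw [PiLp.inner_apply, Finset.prod_one_add, Finset.sum_mul, Finset.powerset_univ]
  refine Finset.sum_congr rfl fun S _ => ?_
  rw [← (q.2.2 S).pairing_cosDeriv n, pairing_eq_inner _ (continuous_cosDeriv S n), cosMixed]

lemma exists_presSpace_forall_inner_eq (h : L2 d) :
    ∃ y : presSpace d, ∀ q : presSpace d, inner ℝ y q = inner ℝ h ((q : MixedSpace d) ∅) :=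
  ⟨(InnerProductSpace.toDual ℝ (presSpace d)).symm
    ((innerSL ℝ h ∘L (PiLp.proj 2 (fun _ : Finset (Fin d) => L2 d) ∅ : MixedSpace d →L[ℝ] L2 d)) ∘L
      (presSpace d).subtypeL), fun _ => InnerProductSpace.toDual_symm_apply⟩

/- Both `φ` and the weak solution have the same cosine coefficients: for the former they are read
off the chain of one-dimensional Neumann problems, for the latter by testing with cosines. -/
theorem IsA.exists_presSpace {φ h : L2 d} (hA : IsA φ h) : ∃ y : presSpace d,
    (y : MixedSpace d) ∅ = φ ∧
      ∀ q : presSpace d, inner ℝ y q = inner ℝ h ((q : MixedSpace d) ∅) := by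
  obtain ⟨y, hy⟩ := exists_presSpace_forall_inner_eq h
  refine ⟨y, sub_eq_zero.1 (eq_zero_of_pairing_cosProd fun n => ?_), hy⟩
  rw [pairing_sub_left _ _ (continuous_cosProd n), sub_eq_zero]
  obtain rfl | hn := eq_or_ne n 0
  · have hone : cosProd (0 : Fin d → ℕ) = fun _ => 1 := by
      funext x; simp [cosProd, prodFun, cosFun]
    have hmean {v : L2 d} (hv : ZeroMean v) : pairing v (cosProd 0) = 0 := by
      rwa [hone, pairing_eq_inner _ continuous_const, ← zeroMean_iff]
    rw [hmean y.2.1, hmean hA.1]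
  · have hweak := hy ⟨cosMixed n, cosMixed_mem hn⟩
    rw [Submodule.coe_inner, inner_cosMixed y n, cosMixed_empty,
      ← pairing_eq_inner _ (continuous_cosProd n), hA.pairing_cosProd n] at hweak
    refine mul_left_cancel₀ (Finset.prod_ne_zero_iff.2 fun i _ => ?_) hweak
    linarith [neig_nonneg (n i)]

theorem IsWeakDiv.inner_eq {U : VL2 d} {D : L2 d} (hD : IsWeakDiv U D) (hU : ∀ j, MemH10 (U j))
    (q : presSpace d) : inner ℝ D ((q : MixedSpace d) ∅) = -inner ℝ U (presGrad d q) := by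
  choose z hz hzU using fun j => memH10_iff.1 (hU j)
  have hdiv : D = ∑ j, z j (some j) := by
    refine eq_of_pairing_test fun ψ hψ => ?_
    have hparts (j) : pairing (U j) (pd j ψ) = -pairing (z j (some j)) ψ := by
      rw [← hzU j]
      exact isZeroTraceDeriv_of_mem_hOneZero (hz j) j ψ hψ.1 hψ.2.1
    have hweak := hD ψ hψ
    simp only [hparts, Finset.sum_neg_distrib, neg_inj] at hweak
    rw [← hweak, pairing_eq_inner _ hψ.continuous, sum_inner]
    simp only [pairing_eq_inner _ hψ.continuous]
  rw [hdiv, sum_inner, PiLp.inner_apply, ← Finset.sum_neg_distrib]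
  refine Finset.sum_congr rfl fun j _ => ?_
  rw [← hzU j]
  exact inner_grad_eq_neg (hz j) (isWeakGrad_presGrad q j)

/-! ### Functions with bounded derivatives in time -/

section Time

variable {F : Type*} [NormedAddCommGroup F] {T : ℝ}

lemma intervalIntegrable_of_memLp_top {V' : ℝ → F} (hV' : MemLp V' ⊤ (volume.restrict (Icc 0 T)))
    {a b : ℝ} (ha : a ∈ Icc 0 T) (hb : b ∈ Icc 0 T) : IntervalIntegrable V' volume a b :=
  intervalIntegrable_iff.2 <| IntegrableOn.mono_set (hV'.integrable (by simp))
    (uIoc_subset_uIcc.trans (uIcc_subset_Icc ha hb))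

variable [NormedSpace ℝ F]

lemma sub_eq_integral_of_memLp_top {V V' : ℝ → F}
    (hV' : MemLp V' ⊤ (volume.restrict (Icc 0 T)))
    (hV : ∀ t ∈ Icc 0 T, V t = V 0 + ∫ s in (0 : ℝ)..t, V' s)
    {a b : ℝ} (ha : a ∈ Icc 0 T) (hb : b ∈ Icc 0 T) : V b - V a = ∫ s in a..b, V' s := by
  have h₀ : (0 : ℝ) ∈ Icc 0 T := ⟨le_rfl, ha.1.trans ha.2⟩
  rw [hV a ha, hV b hb, add_sub_add_left_eq_sub, intervalIntegral.integral_interval_sub_left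
    (intervalIntegrable_of_memLp_top hV' h₀ hb) (intervalIntegrable_of_memLp_top hV' h₀ ha)]

lemma exists_lipschitz_of_memLp_top {V V' : ℝ → F}
    (hV' : MemLp V' ⊤ (volume.restrict (Icc 0 T)))
    (hV : ∀ t ∈ Icc 0 T, V t = V 0 + ∫ s in (0 : ℝ)..t, V' s) :
    ∃ M : ℝ, 0 ≤ M ∧ ∀ a ∈ Icc 0 T, ∀ b ∈ Icc 0 T, ‖V b - V a‖ ≤ M * |b - a| := by
  refine ⟨(eLpNorm V' ⊤ (volume.restrict (Icc 0 T))).toReal, ENNReal.toReal_nonneg,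
    fun a ha b hb => ?_⟩
  rw [sub_eq_integral_of_memLp_top hV' hV ha hb]
  refine intervalIntegral.norm_integral_le_of_norm_le_const_ae ?_
  filter_upwards [(ae_restrict_iff' measurableSet_Icc).1 (ae_le_eLpNormEssSup (f := V'))]
    with s hs hsab
  have hbound := hs (uIcc_subset_Icc ha hb (uIoc_subset_uIcc hsab))
  rw [← eLpNorm_exponent_top] at hbound
  simpa using ENNReal.toReal_mono hV'.2.ne hbound

lemma norm_sub_sub_smul_le [CompleteSpace F] {V V' : ℝ → F} {L : ℝ} (hL : 0 ≤ L)
    (hV' : MemLp V' ⊤ (volume.restrict (Icc 0 T)))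
    (hV : ∀ t ∈ Icc 0 T, V t = V 0 + ∫ s in (0 : ℝ)..t, V' s)
    (hlip : ∀ a ∈ Icc 0 T, ∀ b ∈ Icc 0 T, ‖V' b - V' a‖ ≤ L * |b - a|)
    {a b : ℝ} (ha : a ∈ Icc 0 T) (hb : b ∈ Icc 0 T) :
    ‖V b - V a - (b - a) • V' a‖ ≤ L * |b - a| ^ 2 := by
  have hremainder : V b - V a - (b - a) • V' a = ∫ s in a..b, (V' s - V' a) := by
    rw [intervalIntegral.integral_sub (intervalIntegrable_of_memLp_top hV' ha hb)
      intervalIntegrable_const, ← sub_eq_integral_of_memLp_top hV' hV ha hb,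
      intervalIntegral.integral_const]
  rw [hremainder, sq, ← mul_assoc]
  refine intervalIntegral.norm_integral_le_of_norm_le_const fun s hs => ?_
  have hs' := uIoc_subset_uIcc hs
  exact (hlip a ha s (uIcc_subset_Icc ha hb hs')).trans
    (mul_le_mul_of_nonneg_left (abs_sub_left_of_mem_uIcc hs') hL)

lemma mem_Icc_of_sub_add {t h : ℝ} (h₀ : 0 ≤ h) (hl : t - h ∈ Icc 0 T) (hr : t + h ∈ Icc 0 T) :
    t ∈ Icc 0 T :=
  ⟨by linarith [hl.1], by linarith [hr.2]⟩

lemma norm_sub_sub_two_mul_smul_le [CompleteSpace F] {V V' V'' : ℝ → F} {L : ℝ} (hL : 0 ≤ L)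
    (hV' : MemLp V' ⊤ (volume.restrict (Icc 0 T)))
    (hV'' : MemLp V'' ⊤ (volume.restrict (Icc 0 T)))
    (hV : ∀ t ∈ Icc 0 T, V t = V 0 + ∫ s in (0 : ℝ)..t, V' s)
    (hVV : ∀ t ∈ Icc 0 T, V' t = V' 0 + ∫ s in (0 : ℝ)..t, V'' s)
    (hlip : ∀ a ∈ Icc 0 T, ∀ b ∈ Icc 0 T, ‖V'' b - V'' a‖ ≤ L * |b - a|)
    {t h : ℝ} (h₀ : 0 ≤ h) (hl : t - h ∈ Icc 0 T) (hr : t + h ∈ Icc 0 T) :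
    ‖V (t + h) - V (t - h) - (2 * h) • V' t‖ ≤ 2 * L * h ^ 3 := by
  have ht := mem_Icc_of_sub_add h₀ hl hr
  have hodd : ∫ s in (t - h)..(t + h), (s - t) • V'' t = 0 := by
    rw [intervalIntegral.integral_smul_const, intervalIntegral.integral_sub
      intervalIntegral.intervalIntegrable_id intervalIntegrable_const, integral_id,
      intervalIntegral.integral_const, smul_eq_mul]
    ring_nf
    exact zero_smul ℝ _
  have hintegrable := intervalIntegrable_of_memLp_top hV' hl hr
  have hremainder : V (t + h) - V (t - h) - (2 * h) • V' t
      = ∫ s in (t - h)..(t + h), (V' s - V' t - (s - t) • V'' t) := by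
    rw [intervalIntegral.integral_sub (hintegrable.sub intervalIntegrable_const)
      (Continuous.intervalIntegrable (by fun_prop) _ _), hodd, sub_zero,
      intervalIntegral.integral_sub hintegrable intervalIntegrable_const,
      sub_eq_integral_of_memLp_top hV' hV hl hr, intervalIntegral.integral_const]
    congr 2
    ring
  rw [hremainder]
  refine (intervalIntegral.norm_integral_le_of_norm_le_const (C := L * h ^ 2) fun s hs => ?_).trans
    (le_of_eq ?_)
  · rw [uIoc_of_le (by linarith)] at hs
    refine (norm_sub_sub_smul_le hL hV'' hVV hlip ht
      ⟨hl.1.trans hs.1.le, hs.2.trans hr.2⟩).trans (mul_le_mul_of_nonneg_left ?_ hL)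
    exact pow_le_pow_left₀ (abs_nonneg _) (abs_le.2 ⟨by linarith [hs.1], by linarith [hs.2]⟩) 2
  · rw [show t + h - (t - h) = 2 * h by ring, abs_of_nonneg (by positivity)]
    ring

lemma hasDerivWithinAt_of_norm_sub_sub_smul_le {g : ℝ → F} {g' : F} {s : Set ℝ} {t L : ℝ}
    (h : ∀ x ∈ s, ‖g x - g t - (x - t) • g'‖ ≤ L * |x - t| ^ 2) : HasDerivWithinAt g g' s t := by
  rw [hasDerivWithinAt_iff_isLittleO]
  have hquadratic : (fun x => g x - g t - (x - t) • g') =O[𝓝[s] t] fun x => (x - t) ^ 2 := by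
    refine Asymptotics.IsBigO.of_bound L ?_
    filter_upwards [self_mem_nhdsWithin] with x hx
    simpa using h x hx
  have hlimit : Tendsto (fun x : ℝ => x - t) (𝓝 t) (𝓝 0) :=
    tendsto_sub_nhds_zero_iff.2 tendsto_id
  exact hquadratic.trans_isLittleO <|
    ((Asymptotics.isLittleO_pow_id one_lt_two).comp_tendsto hlimit).mono nhdsWithin_le_nhds

lemma MemWInfty.mono {m k : ℕ} {g : ℝ → F} (h : MemWInfty m T g) (hk : k ≤ m) :
    MemWInfty k T g := by
  obtain ⟨V, hV₀, hbound, hV⟩ := h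
  exact ⟨V, hV₀, fun j hj => hbound j (hj.trans hk), fun j hj => hV j (hj.trans_le hk)⟩

lemma MemWInfty.congr {m : ℕ} {g g' : ℝ → F} (h : MemWInfty m T g)
    (hg : ∀ t ∈ Icc 0 T, g t = g' t) : MemWInfty m T g' := by
  obtain ⟨V, hV₀, hV⟩ := h
  exact ⟨V, fun t ht => (hV₀ t ht).trans (hg t ht), hV⟩

lemma MemWInfty.exists_lipschitz {m : ℕ} (hm : 1 ≤ m) {g : ℝ → F} (h : MemWInfty m T g) :
    ∃ M : ℝ, 0 ≤ M ∧ ∀ a ∈ Icc 0 T, ∀ b ∈ Icc 0 T, ‖g b - g a‖ ≤ M * |b - a| := by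
  obtain ⟨V, hV₀, hbound, hV⟩ := h
  obtain ⟨M, hM, hlip⟩ := exists_lipschitz_of_memLp_top (hbound 1 hm) (hV 0 (by lia))
  exact ⟨M, hM, fun a ha b hb => by simpa only [hV₀ a ha, hV₀ b hb] using hlip a ha b hb⟩

lemma MemWInfty.exists_second_difference [CompleteSpace F] {m : ℕ} (hm : 2 ≤ m) {g : ℝ → F}
    (h : MemWInfty m T g) :
    ∃ M : ℝ, 0 ≤ M ∧ ∀ t h, 0 ≤ h → t - h ∈ Icc 0 T → t + h ∈ Icc 0 T →
      ‖g (t + h) + g (t - h) - (2 : ℝ) • g t‖ ≤ M * h ^ 2 := by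
  obtain ⟨V, hV₀, hbound, hV⟩ := h
  obtain ⟨L, hL, hlip⟩ := exists_lipschitz_of_memLp_top (hbound 2 hm) (hV 1 (by lia))
  refine ⟨2 * L, by positivity, fun t h h₀ hl hr => ?_⟩
  have ht := mem_Icc_of_sub_add h₀ hl hr
  have htaylor {s} := norm_sub_sub_smul_le (b := s) hL (hbound 1 (by lia)) (hV 0 (by lia)) hlip ht
  have hsplit : V 0 (t + h) + V 0 (t - h) - (2 : ℝ) • V 0 t
      = (V 0 (t + h) - V 0 t - (t + h - t) • V 1 t)
        + (V 0 (t - h) - V 0 t - (t - h - t) • V 1 t) := by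
    module
  rw [← hV₀ _ hl, ← hV₀ _ hr, ← hV₀ _ ht, hsplit]
  refine (norm_add_le_of_le (htaylor hr) (htaylor hl)).trans_eq ?_
  rw [sq_abs, sq_abs]
  ring

lemma MemWInfty.exists_deriv_central_difference [CompleteSpace F] {m : ℕ} (hm : 3 ≤ m) {g : ℝ → F}
    (h : MemWInfty m T g) : ∃ (g' : ℝ → F) (M : ℝ), 0 ≤ M ∧
      (∀ t ∈ Icc 0 T, HasDerivWithinAt g (g' t) (Icc 0 T) t) ∧
      ∀ t h, 0 ≤ h → t - h ∈ Icc 0 T → t + h ∈ Icc 0 T →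
        ‖g (t + h) - g (t - h) - (2 * h) • g' t‖ ≤ M * h ^ 3 := by
  obtain ⟨V, hV₀, hbound, hV⟩ := h
  obtain ⟨L, hL, hlip₁⟩ := exists_lipschitz_of_memLp_top (hbound 2 (by lia)) (hV 1 (by lia))
  obtain ⟨K, hK, hlip₂⟩ := exists_lipschitz_of_memLp_top (hbound 3 hm) (hV 2 (by lia))
  refine ⟨V 1, 2 * K, by positivity, fun t ht => ?_, fun t h h₀ hl hr => ?_⟩
  · refine hasDerivWithinAt_of_norm_sub_sub_smul_le (L := L) fun s hs => ?_
    rw [← hV₀ s hs, ← hV₀ t ht]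
    exact norm_sub_sub_smul_le hL (hbound 1 (by lia)) (hV 0 (by lia)) hlip₁ ht hs
  · rw [← hV₀ _ hl, ← hV₀ _ hr]
    exact norm_sub_sub_two_mul_smul_le hK (hbound 1 (by lia)) (hbound 2 (by lia)) (hV 0 (by lia))
      (hV 1 (by lia)) hlip₂ h₀ hl hr

end Time

/-! ### Fourier multipliers on vector fields -/

lemma hasSum_inner_coef (v w : VL2 d) :
    HasSum (fun n => ∑ j, coef (v j) n * coef (w j) n) (inner ℝ v w) := by
  rw [PiLp.inner_apply]
  exact hasSum_sum fun j _ => hasSum_coef_mul (v j) (w j)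

lemma inner_congr_coef {v w v' w' : VL2 d}
    (h : ∀ j n, coef (v j) n * coef (w j) n = coef (v' j) n * coef (w' j) n) :
    inner ℝ v w = inner ℝ v' w' := by
  refine (hasSum_inner_coef v w).unique ?_
  simp only [h]
  exact hasSum_inner_coef v' w'

lemma inner_mono_coef {v w v' w' : VL2 d}
    (h : ∀ j n, coef (v j) n * coef (w j) n ≤ coef (v' j) n * coef (w' j) n) :
    inner ℝ v w ≤ inner ℝ v' w' :=
  hasSum_le (fun n => Finset.sum_le_sum fun j _ => h j n) (hasSum_inner_coef v w)
    (hasSum_inner_coef v' w')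

lemma vcoef_ext {v w : VL2 d} (h : ∀ j n, coef (v j) n = coef (w j) n) : v = w :=
  PiLp.ext fun j => coef_ext (h j)

lemma exists_vcoef_eq {a : Fin d → (Fin d → ℕ) → ℝ} {y : VL2 d} {C : ℝ}
    (h : ∀ j n, |a j n| ≤ C * |coef (y j) n|) :
    ∃ g : VL2 d, (∀ j n, coef (g j) n = a j n) ∧ ‖g‖ ^ 2 ≤ C ^ 2 * ‖y‖ ^ 2 := by
  choose g hg hn using fun j => exists_coef_eq (h j)
  refine ⟨WithLp.toLp 2 g, hg, ?_⟩
  rw [PiLp.norm_sq_eq_of_L2, PiLp.norm_sq_eq_of_L2, Finset.mul_sum]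
  exact Finset.sum_le_sum fun j _ => hn j

/-- `g` is the image of `v` under the Fourier multiplier with the (possibly unbounded) symbol `c` in
the sine basis. -/
def IsMultiplier (c : (Fin d → ℕ) → ℝ) (v g : VL2 d) : Prop :=
  ∀ j n, coef (g j) n = c n * coef (v j) n

lemma IsMultiplier.exists_of_abs_le {c c' : (Fin d → ℕ) → ℝ} {v g : VL2 d}
    (h : IsMultiplier c v g) {C : ℝ} (hc : ∀ n, |c' n| ≤ C * |c n|) :
    ∃ g', IsMultiplier c' v g' := by
  obtain ⟨g', hg', -⟩ := exists_vcoef_eq (a := fun j n => c' n * coef (v j) n) (y := g) (C := C)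
    fun j n => by
      rw [h j n, abs_mul, abs_mul, ← mul_assoc]
      exact mul_le_mul_of_nonneg_right (hc n) (abs_nonneg _)
  exact ⟨g', hg'⟩

theorem exists_multiplier {c : (Fin d → ℕ) → ℝ} {C : ℝ} (hc : ∀ n, |c n| ≤ C) :
    ∃ M : VL2 d →L[ℝ] VL2 d, ‖M‖ ≤ C ∧ ∀ v, IsMultiplier c v (M v) := by
  have hC : 0 ≤ C := (abs_nonneg _).trans (hc 0)
  have hbound (v : VL2 d) (j n) : |c n * coef (v j) n| ≤ C * |coef (v j) n| := by
    rw [abs_mul]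
    exact mul_le_mul_of_nonneg_right (hc n) (abs_nonneg _)
  choose g hg hn using fun v => exists_vcoef_eq (hbound v)
  let L : VL2 d →ₗ[ℝ] VL2 d :=
    { toFun := g
      map_add' := fun v w => vcoef_ext fun j n => by
        simp only [hg, PiLp.add_apply, coef_add]
        ring
      map_smul' := fun a v => vcoef_ext fun j n => by
        simp only [hg, PiLp.smul_apply, coef_smul, RingHom.id_apply]
        ring }
  have hL (v) : ‖L v‖ ≤ C * ‖v‖ := le_of_sq_le_sq (by rw [mul_pow]; exact hn v) (by positivity)
  exact ⟨L.mkContinuous C hL, L.mkContinuous_norm_le hC hL, hg⟩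

lemma IsMultiplier.add {c : (Fin d → ℕ) → ℝ} {v w g h : VL2 d} (hv : IsMultiplier c v g)
    (hw : IsMultiplier c w h) : IsMultiplier c (v + w) (g + h) := fun j n => by
  simp only [PiLp.add_apply, coef_add, hv j n, hw j n, mul_add]

lemma IsMultiplier.sub {c : (Fin d → ℕ) → ℝ} {v w g h : VL2 d} (hv : IsMultiplier c v g)
    (hw : IsMultiplier c w h) : IsMultiplier c (v - w) (g - h) := fun j n => by
  simp only [PiLp.sub_apply, coef_sub, hv j n, hw j n, mul_sub]

lemma IsMultiplier.smul {c : (Fin d → ℕ) → ℝ} {v g : VL2 d} (hv : IsMultiplier c v g) (a : ℝ) :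
    IsMultiplier c (a • v) (a • g) := fun j n => by
  simp only [PiLp.smul_apply, coef_smul, hv j n, mul_left_comm]

lemma IsMultiplier.norm_le {c c' : (Fin d → ℕ) → ℝ} {v g g' : VL2 d} (h : IsMultiplier c v g)
    (h' : IsMultiplier c' v g') {C : ℝ} (hC : 0 ≤ C) (hc : ∀ n, |c' n| ≤ C * |c n|) :
    ‖g'‖ ≤ C * ‖g‖ := by
  have hinner : inner ℝ g' g' ≤ inner ℝ (C • g) (C • g) := inner_mono_coef fun j n => by
    rw [h' j n, PiLp.smul_apply, coef_smul, h j n, ← sq, ← sq, sq_le_sq]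
    simp only [abs_mul, abs_of_nonneg hC, ← mul_assoc]
    gcongr
    exact hc n
  rw [real_inner_self_eq_norm_sq, real_inner_self_eq_norm_sq] at hinner
  exact (le_of_sq_le_sq hinner (norm_nonneg _)).trans_eq (norm_smul_of_nonneg hC g)

/-! ### The operator `B` and the norms in terms of sine coefficients -/

/-- The symbol of `B` in the sine basis. -/
def symB (τ : ℝ) (n : Fin d → ℕ) : ℝ :=
  ∑ S : Finset (Fin d) with 2 ≤ S.card, (-τ / 2) ^ (S.card - 2) * ∏ i ∈ S, -eig (n i)

lemma symB_eq_sum (τ : ℝ) (n : Fin d → ℕ) : symB τ n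
    = ∑ S : Finset (Fin d) with 2 ≤ S.card, (τ / 2) ^ (S.card - 2) * ∏ i ∈ S, eig (n i) := by
  refine Finset.sum_congr rfl fun S hS => ?_
  obtain ⟨m, hm⟩ := Nat.exists_eq_add_of_le (Finset.mem_filter.1 hS).2
  rw [Finset.prod_neg, hm, Nat.add_sub_cancel_left, neg_div, neg_pow, pow_add]
  have hsign : ((-1 : ℝ) ^ m) * (-1) ^ m = 1 := by rw [← mul_pow]; simp
  linear_combination ((τ / 2) ^ m * ∏ i ∈ S, eig (n i)) * hsign

lemma symB_nonneg {τ : ℝ} (hτ : 0 ≤ τ) (n : Fin d → ℕ) : 0 ≤ symB τ n := by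
  rw [symB_eq_sum]
  exact Finset.sum_nonneg fun S _ =>
    mul_nonneg (by positivity) (Finset.prod_nonneg fun i _ => (eig_pos _).le)

lemma eig_le_symB (hd : 2 ≤ d) {τ : ℝ} (hτ : 0 ≤ τ) (n : Fin d → ℕ) (i : Fin d) :
    eig (n i) ≤ symB τ n := by
  have : Nontrivial (Fin d) := Fin.nontrivial_iff_two_le.2 hd
  obtain ⟨j, hj⟩ := exists_ne i
  have hcard : ({i, j} : Finset (Fin d)).card = 2 := Finset.card_pair hj.symm
  calc eig (n i) ≤ eig (n i) * eig (n j) :=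
        le_mul_of_one_le_right (eig_pos _).le (one_le_eig _)
    _ = (τ / 2) ^ (({i, j} : Finset (Fin d)).card - 2) * ∏ k ∈ {i, j}, eig (n k) := by
        rw [hcard, Finset.prod_pair hj.symm, Nat.sub_self, pow_zero, one_mul]
    _ ≤ symB τ n := by
        rw [symB_eq_sum]
        exact Finset.single_le_sum
          (f := fun S : Finset (Fin d) => (τ / 2) ^ (S.card - 2) * ∏ k ∈ S, eig (n k))
          (fun S _ => mul_nonneg (by positivity) (Finset.prod_nonneg fun k _ => (eig_pos _).le))
          (Finset.mem_filter.2 ⟨Finset.mem_univ _, hcard.ge⟩)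

lemma lam_le_symB (hd : 2 ≤ d) {τ : ℝ} (hτ : 0 ≤ τ) (n : Fin d → ℕ) : lam n ≤ d * symB τ n := by
  simpa [lam] using Finset.sum_le_card_nsmul Finset.univ _ _ fun i _ => eig_le_symB hd hτ n i

lemma symB_mono {τ τ' : ℝ} (hτ : 0 ≤ τ) (h : τ ≤ τ') (n : Fin d → ℕ) : symB τ n ≤ symB τ' n := by
  rw [symB_eq_sum, symB_eq_sum]
  gcongr with S
  exact Finset.prod_nonneg fun i _ => (eig_pos _).le

/-- The symbol of `I + (τ² / 4) B`. -/
def symM (τ : ℝ) (n : Fin d → ℕ) : ℝ := 1 + τ ^ 2 / 4 * symB τ n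

lemma one_le_symM {τ : ℝ} (hτ : 0 ≤ τ) (n : Fin d → ℕ) : 1 ≤ symM τ n :=
  le_add_of_nonneg_right (mul_nonneg (by positivity) (symB_nonneg hτ n))

lemma symM_pos {τ : ℝ} (hτ : 0 ≤ τ) (n : Fin d → ℕ) : 0 < symM τ n :=
  one_pos.trans_le (one_le_symM hτ n)

/- The identity `I + (τ²/4) B - (τ/2) Δ = ∏ᵢ (I - (τ/2) ∂ᵢᵢ)` behind direction splitting. -/
lemma symM_add_lam (τ : ℝ) (n : Fin d → ℕ) :
    symM τ n + τ / 2 * lam n = ∏ i, (1 + τ / 2 * eig (n i)) := by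
  have hsmall : ({S | ¬2 ≤ S.card} : Finset (Finset (Fin d)))
      = insert ∅ (Finset.univ.map ⟨singleton, Finset.singleton_injective⟩) := by
    ext S
    rw [Finset.mem_filter_univ, not_le, Nat.lt_succ_iff, Nat.le_one_iff_eq_zero_or_eq_one,
      Finset.card_eq_zero, Finset.card_eq_one]
    simp [eq_comm]
  rw [Finset.prod_one_add, Finset.powerset_univ,
    ← Finset.sum_filter_add_sum_filter_not _ (fun S : Finset (Fin d) => 2 ≤ S.card), hsmall,
    Finset.sum_insert (by simp), Finset.sum_map, symM, symB_eq_sum, lam, Finset.mul_sum,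
    Finset.mul_sum]
  simp only [Finset.prod_empty, Function.Embedding.coeFn_mk, Finset.prod_singleton]
  have hlarge : ∀ S ∈ ({S | 2 ≤ S.card} : Finset (Finset (Fin d))),
      τ ^ 2 / 4 * ((τ / 2) ^ (S.card - 2) * ∏ i ∈ S, eig (n i)) = ∏ i ∈ S, τ / 2 * eig (n i) := by
    intro S hS
    rw [Finset.prod_mul_distrib, Finset.prod_const,
      ← Nat.sub_add_cancel (Finset.mem_filter.1 hS).2, pow_add, Nat.add_sub_cancel]
    ring
  rw [Finset.sum_congr rfl hlarge]
  ring

lemma MemH10.exists_isZeroTraceDeriv {v : L2 d} (h : MemH10 v) :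
    ∃ w : Fin d → L2 d, ∀ i, IsZeroTraceDeriv i v (w i) := by
  obtain ⟨z, hz, rfl⟩ := memH10_iff.1 h
  exact ⟨fun i => z (some i), isZeroTraceDeriv_of_mem_hOneZero hz⟩

lemma pairing_formalB (τ : ℝ) (v : L2 d) {ψ : (Fin d → ℝ) → ℝ} (hψ : IsTest ψ) :
    pairing v (formalB τ ψ) = ∑ S : Finset (Fin d) with 2 ≤ S.card,
      (-τ / 2) ^ (S.card - 2) * pairing v (mpd (2 • ind S) ψ) :=
  pairing_sum _ v _ fun S _ => (hψ.mpd (2 • ind S)).continuous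

lemma exists_hOneZero_of_isMultiplier {v y : VL2 d} (h : IsMultiplier lam v y) :
    ∃ z : Fin d → GradSpace d, (∀ j, z j ∈ hOneZero d) ∧ (∀ j, z j none = v j) ∧
      ∑ j, ∑ i, ‖z j (some i)‖ ^ 2 = inner ℝ y v := by
  have hcoef (j n) : coef (v j + y j) n = (1 + lam n) * coef (v j) n := by
    rw [coef_add, h j n]
    ring
  choose z hz hv hnorm using fun j => exists_mem_hOneZero_of_coef (hcoef j)
  refine ⟨z, hz, hv, ?_⟩
  rw [PiLp.inner_apply]
  refine Finset.sum_congr rfl fun j _ => ?_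
  rw [hnorm, inner_add_left, real_inner_self_eq_norm_sq, add_sub_cancel_left]

lemma IsMultiplier.exists_lam (hd : 2 ≤ d) {τ : ℝ} (hτ : 0 ≤ τ) {v g : VL2 d}
    (h : IsMultiplier (symB τ) v g) : ∃ y, IsMultiplier lam v y :=
  h.exists_of_abs_le fun n => by
    rw [abs_of_nonneg (lam_nonneg n), abs_of_nonneg (symB_nonneg hτ n)]
    exact lam_le_symB hd hτ n

lemma IsB.isMultiplier {τ : ℝ} {v g : VL2 d} (h : IsB τ v g) : IsMultiplier (symB τ) v g := by
  intro j
  obtain ⟨w, hw⟩ := (h.1 j).exists_isZeroTraceDeriv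
  exact coef_even_operator hw fun ψ hψ => by rw [← pairing_formalB τ _ hψ, h.2 j ψ hψ]

theorem isB_iff (hd : 2 ≤ d) {τ : ℝ} (hτ : 0 ≤ τ) {v g : VL2 d} :
    IsB τ v g ↔ IsMultiplier (symB τ) v g := by
  refine ⟨IsB.isMultiplier, fun h => ?_⟩
  obtain ⟨y, hy⟩ := h.exists_lam hd hτ
  obtain ⟨z, hz, hv, -⟩ := exists_hOneZero_of_isMultiplier hy
  refine ⟨fun j => memH10_iff.2 ⟨z j, hz j, hv j⟩, fun j ψ hψ => ?_⟩
  rw [pairing_formalB τ _ hψ]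
  exact pairing_even_operator_of_coef (h j) hψ

/-- The domain of `B`. -/
def domB (τ : ℝ) : Set (VL2 d) := {v | ∃ g, IsB τ v g}

lemma sub_mem_domB (hd : 2 ≤ d) {τ : ℝ} (hτ : 0 ≤ τ) {v w : VL2 d} (hv : v ∈ domB τ)
    (hw : w ∈ domB τ) : v - w ∈ domB τ := by
  obtain ⟨g, hg⟩ := hv
  obtain ⟨h, hh⟩ := hw
  refine ⟨g - h, (isB_iff hd hτ).2 fun j n => ?_⟩
  simp only [PiLp.sub_apply, coef_sub, hg.isMultiplier j n, hh.isMultiplier j n]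
  ring

lemma normH1_le {v y : VL2 d} (h : IsMultiplier lam v y) :
    normH1 v ≤ ENNReal.ofReal (√(inner ℝ y v)) := by
  obtain ⟨z, hz, hv, hnorm⟩ := exists_hOneZero_of_isMultiplier h
  refine iInf₂_le_of_le (fun i => WithLp.toLp 2 fun j => z j (some i)) (fun i j => ?_) ?_
  · rw [← hv]
    exact (isZeroTraceDeriv_of_mem_hOneZero (hz j) i).isWeakDeriv
  · rw [← hnorm, Finset.sum_comm]
    simp only [PiLp.norm_sq_eq_of_L2, le_refl]

lemma normA_le (q : presSpace d) : normA ((q : MixedSpace d) ∅) ≤ ENNReal.ofReal ‖q‖ := by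
  refine iInf₂_le_of_le (fun S => (q : MixedSpace d) S) q.2 ?_
  rw [← presSpace_norm_sq, Real.sqrt_sq (norm_nonneg _)]

/-! ### The velocity step in terms of sine coefficients -/

lemma IsDirichletSecond.coef_eq {i : Fin d} {v g : L2 d} (h : IsDirichletSecond i v g)
    (n : Fin d → ℕ) : coef g n = -eig (n i) * coef v n := by
  obtain ⟨w, hvw, hwg⟩ := h
  set f : Fin d → ℝ → ℝ := Function.update (fun j => sinFun (n j)) i (deriv (sinFun (n i)))
    with hf
  have hfirst : pairing w (prodFun f) = -coef g n := by
    have hind : f = fun j => deriv^[ind {i} j] (sinFun (n j)) := by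
      funext j
      obtain rfl | hj := eq_or_ne j i
      · simp [hf, ind]
      · simp [hf, ind, hj]
    rw [← ind_singleton] at hwg
    have hparts := hwg.pairing_prodFun (fun j => by rw [ind]; split_ifs <;> simp)
      (fun j => contDiff_sinFun (n j)) fun j _ => ⟨sinFun_zero _, sinFun_one _⟩
    rw [hind, hparts, ← sinProd, pairing_sinProd]
    simp [ind]
  have hsecond : prodFun (Function.update f i (deriv (f i)))
      = fun x => (∏ j ∈ {i}, -eig (n j)) * sinProd n x := by
    rw [← mpd_two_ind_sinProd, sinProd, mpd_prodFun fun j => contDiff_sinFun (n j)]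
    refine congrArg prodFun (funext fun j => ?_)
    obtain rfl | hj := eq_or_ne j i
    · simp [hf, ind]
    · simp [hf, ind, hj]
  have hparts := hvw.pairing_prodFun (f := f)
    ((Function.forall_update_iff _ fun _ b => ContDiff ℝ ∞ b).2
      ⟨(contDiff_sinFun (n i)).iterate_deriv 1, fun j _ => contDiff_sinFun (n j)⟩)
  rw [hsecond, pairing_const_mul, pairing_sinProd, hfirst, neg_neg, Finset.prod_singleton] at hparts
  exact hparts.symm

lemma VelocityStep.eq_two_or_three {τ : ℝ} {uk uk1 G F : VL2 d}
    (h : VelocityStep d τ uk uk1 G F) : d = 2 ∨ d = 3 := by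
  match d, uk, uk1, G, F, h with
  | 2, _, _, _, _, _ => exact .inl rfl
  | 3, _, _, _, _, _ => exact .inr rfl

/-- The fields `v₀` and `v₁` satisfy `(I + (τ² / 4) B) (v₁ - v₀) - (τ / 2) Δ (v₁ + v₀) = τ F`. The
intermediate stages of the scheme are eliminated in this form of a velocity step, which is stated
for the sine coefficients. -/
def IsUnsplitStep (τ : ℝ) (v₀ v₁ F : VL2 d) : Prop :=
  ∀ j n, symM τ n * (coef (v₁ j) n - coef (v₀ j) n)
    + τ / 2 * lam n * (coef (v₁ j) n + coef (v₀ j) n) = τ * coef (F j) n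

lemma IsUnsplitStep.sub {τ : ℝ} {v₀ v₁ F w₀ w₁ H : VL2 d} (hv : IsUnsplitStep τ v₀ v₁ F)
    (hw : IsUnsplitStep τ w₀ w₁ H) : IsUnsplitStep τ (v₀ - w₀) (v₁ - w₁) (F - H) := fun j n => by
  simp only [PiLp.sub_apply, coef_sub]
  linear_combination hv j n - hw j n

lemma isUnsplitStep_of_velocityStep_two {τ : ℝ} (hτ : τ ≠ 0) {uk uk1 G F : VL2 2}
    (h : VelocityStep 2 τ uk uk1 G F) (hk : ∀ j, MemH10 (uk j)) :
    IsUnsplitStep τ uk uk1 (F - G) := fun j n => by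
  obtain ⟨z, hz⟩ := (hk j).exists_isZeroTraceDeriv
  obtain ⟨w, a, b, c, ha, hb, hc, hfirst, hsecond⟩ := h
  replace hfirst := congrArg (fun v : VL2 2 => coef (v j) n) hfirst
  replace hsecond := congrArg (fun v : VL2 2 => coef (v j) n) hsecond
  simp only [PiLp.add_apply, PiLp.sub_apply, PiLp.smul_apply, coef_add, coef_sub, coef_smul,
    (ha j).coef_eq n, (hc j).coef_eq n, coef_second_deriv hz (hb j) n] at hfirst hsecond
  field_simp at hfirst hsecond
  have hsymbol := symM_add_lam τ n
  rw [Fin.prod_univ_two, lam, Fin.sum_univ_two] at hsymbol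
  rw [lam, Fin.sum_univ_two, PiLp.sub_apply, coef_sub]
  linear_combination (1 - τ / 2 * eig (n 0)) * hfirst / 2 + (1 + τ / 2 * eig (n 0)) * hsecond / 2
    + (coef (uk1 j) n - coef (uk j) n) * hsymbol

lemma isUnsplitStep_of_velocityStep_three {τ : ℝ} (hτ : τ ≠ 0) {uk uk1 G F : VL2 3}
    (h : VelocityStep 3 τ uk uk1 G F) (hk : ∀ j, MemH10 (uk j)) :
    IsUnsplitStep τ uk uk1 (F - G) := fun j n => by
  obtain ⟨z, hz⟩ := (hk j).exists_isZeroTraceDeriv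
  obtain ⟨ξ, η, ζ, a, b, c, D, hD, ha, hb, hc, hξ, hη, hζ, hu⟩ := h
  rw [Fin.sum_univ_three] at hξ
  replace hξ := congrArg (fun v : VL2 3 => coef (v j) n) hξ
  replace hη := congrArg (fun v : VL2 3 => coef (v j) n) hη
  replace hζ := congrArg (fun v : VL2 3 => coef (v j) n) hζ
  replace hu := congrArg (fun v : VL2 3 => coef (v j) n) hu
  simp only [PiLp.add_apply, PiLp.sub_apply, PiLp.smul_apply, coef_add, coef_sub, coef_smul,
    (ha j).coef_eq n, (hb j).coef_eq n, (hc j).coef_eq n, coef_second_deriv hz (hD _ j) n,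
    PiLp.zero_apply, coef_zero] at hξ hη hζ hu
  field_simp at hξ hη hζ hu
  have hsymbol := symM_add_lam τ n
  rw [Fin.prod_univ_three, lam, Fin.sum_univ_three] at hsymbol
  rw [lam, Fin.sum_univ_three, PiLp.sub_apply, coef_sub]
  linear_combination hξ + hη / 2 + (1 + τ / 2 * eig (n 0)) * hζ / 2
    + (1 + τ / 2 * eig (n 0)) * (1 + τ / 2 * eig (n 1)) * hu / 2
    + (coef (uk1 j) n - coef (uk j) n) * hsymbol

theorem VelocityStep.isUnsplitStep {τ : ℝ} (hτ : τ ≠ 0) {uk uk1 G F : VL2 d}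
    (h : VelocityStep d τ uk uk1 G F) (hk : ∀ j, MemH10 (uk j)) :
    IsUnsplitStep τ uk uk1 (F - G) := by
  obtain rfl | rfl := h.eq_two_or_three
  · exact isUnsplitStep_of_velocityStep_two hτ h hk
  · exact isUnsplitStep_of_velocityStep_three hτ h hk

lemma VelocityStep.mem_domB {τ : ℝ} (hτ : 0 < τ) {uk uk1 G F : VL2 d}
    (h : VelocityStep d τ uk uk1 G F) (hk : uk ∈ domB τ) : uk1 ∈ domB τ := by
  have hd : 2 ≤ d := by have := h.eq_two_or_three; lia
  obtain ⟨g, hg⟩ := hk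
  obtain ⟨y, hy⟩ := hg.isMultiplier.exists_lam hd hτ.le
  have hsolve : IsMultiplier (fun n => symM τ n + τ / 2 * lam n) uk1
      (uk + (τ ^ 2 / 4) • g - (τ / 2) • y + τ • (F - G)) := fun j n => by
    have hstep := h.isUnsplitStep hτ.ne' hg.1 j n
    simp only [PiLp.add_apply, PiLp.sub_apply, PiLp.smul_apply, coef_add, coef_sub, coef_smul,
      hg.isMultiplier j n, hy j n, symM] at hstep ⊢
    linear_combination -hstep
  obtain ⟨g', hg'⟩ := hsolve.exists_of_abs_le (c' := symB τ) (C := 4 / τ ^ 2) fun n => by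
    have hsymB := symB_nonneg hτ.le n
    have hlam := lam_nonneg n
    rw [abs_of_nonneg hsymB, symM, abs_of_nonneg (by positivity), div_mul_eq_mul_div,
      le_div_iff₀ (by positivity)]
    nlinarith [mul_nonneg hτ.le hlam]
  exact ⟨g', (isB_iff hd hτ.le).2 hg'⟩

/-! ### Stability of the scheme -/

lemma linfNorm_le {E : Type*} {N : ℕ} {nrm : E → ℝ≥0∞} {ψ : ℕ → E} {a : ℝ≥0∞}
    (h : ∀ k ≤ N, nrm (ψ k) ≤ a) : linfNorm N nrm ψ ≤ a :=
  iSup₂_le fun k hk => h k (Finset.mem_Icc.1 hk).2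

lemma mul_linfNorm_le {E : Type*} {N : ℕ} {nrm : E → ℝ≥0∞} {ψ : ℕ → E} {a c : ℝ≥0∞}
    (h : ∀ k ≤ N, c * nrm (ψ k) ≤ a) : c * linfNorm N nrm ψ ≤ a := by
  simpa only [linfNorm, ENNReal.mul_iSup] using linfNorm_le (nrm := fun v => c * nrm v) h

lemma l2Norm_le {E : Type*} {N : ℕ} {τ Γ : ℝ} (hτ : 0 ≤ τ) (hΓ : 0 ≤ Γ) {nrm : E → ℝ≥0∞}
    {ψ : ℕ → E} {a : ℕ → ℝ} (ha : ∀ k, 0 ≤ a k) (h : ∀ k ≤ N, nrm (ψ k) ≤ ENNReal.ofReal √(a k))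
    (hsum : τ * ∑ k ∈ Finset.range (N + 1), a k ≤ Γ ^ 2) :
    l2Norm τ N nrm ψ ≤ ENNReal.ofReal Γ := by
  have hsq (k) (hk : k ≤ N) : nrm (ψ k) ^ 2 ≤ ENNReal.ofReal (a k) := by
    refine (pow_le_pow_left' (h k hk) 2).trans_eq ?_
    rw [← ENNReal.ofReal_pow (Real.sqrt_nonneg _), Real.sq_sqrt (ha k)]
  have hle : ENNReal.ofReal τ * ∑ k ∈ Finset.Icc 1 N, nrm (ψ k) ^ 2 ≤ ENNReal.ofReal (Γ ^ 2) :=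
    calc ENNReal.ofReal τ * ∑ k ∈ Finset.Icc 1 N, nrm (ψ k) ^ 2
        ≤ ENNReal.ofReal τ * ∑ k ∈ Finset.range (N + 1), nrm (ψ k) ^ 2 := by
          gcongr
          intro k hk
          exact Finset.mem_range_succ_iff.2 (Finset.mem_Icc.1 hk).2
      _ ≤ ENNReal.ofReal τ * ∑ k ∈ Finset.range (N + 1), ENNReal.ofReal (a k) := by
          gcongr with k hk
          exact hsq k (Finset.mem_range_succ_iff.1 hk)
      _ = ENNReal.ofReal (τ * ∑ k ∈ Finset.range (N + 1), a k) := by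
          rw [ENNReal.ofReal_mul hτ, ENNReal.ofReal_sum_of_nonneg fun k _ => ha k]
      _ ≤ ENNReal.ofReal (Γ ^ 2) := ENNReal.ofReal_le_ofReal hsum
  calc l2Norm τ N nrm ψ ≤ ENNReal.ofReal (Γ ^ 2) ^ (1 / 2 : ℝ) :=
        ENNReal.rpow_le_rpow hle (by norm_num)
    _ = ENNReal.ofReal Γ := by
        rw [ENNReal.ofReal_rpow_of_nonneg (sq_nonneg _) (by norm_num), ← Real.sqrt_eq_rpow,
          Real.sqrt_sq hΓ]

lemma IsMultiplier.inner_nonneg {c : (Fin d → ℕ) → ℝ} {v g : VL2 d} (h : IsMultiplier c v g)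
    (hc : ∀ n, 0 ≤ c n) : 0 ≤ inner ℝ g v := by
  rw [← inner_zero_left (𝕜 := ℝ) v]
  refine inner_mono_coef fun j n => ?_
  rw [h j n, PiLp.zero_apply, coef_zero, zero_mul, mul_assoc]
  exact mul_nonneg (hc n) (mul_self_nonneg _)

lemma adjoint_eq_of_isMultiplier {c : (Fin d → ℕ) → ℝ} {M : VL2 d →L[ℝ] VL2 d}
    (hM : ∀ v, IsMultiplier c v (M v)) : ContinuousLinearMap.adjoint M = M := by
  refine ((ContinuousLinearMap.eq_adjoint_iff M M).2 fun v w => inner_congr_coef fun j n => ?_).symm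
  rw [hM, hM]
  ring

lemma lam_le_symM (hd : 2 ≤ d) {τ : ℝ} (hτ : 0 < τ) (n : Fin d → ℕ) :
    lam n ≤ 4 * d / τ ^ 2 * symM τ n :=
  calc lam n ≤ d * symB τ n := lam_le_symB hd hτ.le n
    _ ≤ d * symB τ n + 4 * d / τ ^ 2 := le_add_of_nonneg_right (by positivity)
    _ = 4 * d / τ ^ 2 * symM τ n := by rw [symM]; field_simp; ring

lemma one_le_sqrt_symM {τ : ℝ} (hτ : 0 ≤ τ) (n : Fin d → ℕ) : 1 ≤ √(symM τ n) :=
  Real.one_le_sqrt.2 (one_le_symM hτ n)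

lemma sqrt_symM_mul_self {τ : ℝ} (hτ : 0 ≤ τ) (n : Fin d → ℕ) :
    √(symM τ n) * √(symM τ n) = symM τ n :=
  Real.mul_self_sqrt (symM_pos hτ n).le

/-- The fields `v` and `w` are related by `w = (I + (τ² / 4) B)^{1/2} v`. -/
def IsSqrtM (τ : ℝ) (v w : VL2 d) : Prop := IsMultiplier (fun n => √(symM τ n)) v w

lemma exists_isSqrtM {τ : ℝ} (hτ : 0 ≤ τ) {v : VL2 d} (hv : v ∈ domB τ) :
    ∃ w, IsSqrtM τ v w := by
  obtain ⟨g, hg⟩ := hv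
  have hM : IsMultiplier (symM τ) v (v + (τ ^ 2 / 4) • g) := fun j n => by
    simp only [PiLp.add_apply, PiLp.smul_apply, coef_add, coef_smul, hg.isMultiplier j n, symM]
    ring
  refine hM.exists_of_abs_le (C := 1) fun n => ?_
  rw [one_mul, abs_of_nonneg (Real.sqrt_nonneg _), abs_of_pos (symM_pos hτ n)]
  exact Real.sqrt_le_self_iff.2 (.inr (one_le_symM hτ n))

lemma exists_inv_sqrt_symM {τ : ℝ} (hτ : 0 ≤ τ) : ∃ i : VL2 d →L[ℝ] VL2 d, ‖i‖ ≤ 1 ∧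
    ∀ v, IsMultiplier (fun n => (√(symM τ n))⁻¹) v (i v) := by
  refine exists_multiplier fun n => ?_
  rw [abs_of_nonneg (by positivity)]
  exact inv_le_one_of_one_le₀ (one_le_sqrt_symM hτ n)

lemma exists_lam_div_symM (hd : 2 ≤ d) {τ : ℝ} (hτ : 0 < τ) : ∃ A : VL2 d →L[ℝ] VL2 d,
    ∀ v, IsMultiplier (fun n => lam n / symM τ n) v (A v) := by
  obtain ⟨A, -, hA⟩ := exists_multiplier (c := fun n : Fin d → ℕ => lam n / symM τ n)
    (C := 4 * d / τ ^ 2) fun n => by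
      have hpos := symM_pos hτ.le n
      rw [abs_of_nonneg (div_nonneg (lam_nonneg n) hpos.le), div_le_iff₀ hpos]
      exact lam_le_symM hd hτ n
  exact ⟨A, hA⟩

lemma IsSqrtM.eq_of_isMultiplier_inv {τ : ℝ} (hτ : 0 ≤ τ) {v w v' : VL2 d} (h : IsSqrtM τ v w)
    (hv' : IsMultiplier (fun n => (√(symM τ n))⁻¹) w v') : v' = v := vcoef_ext fun j n => by
  have hpos : 0 < √(symM τ n) := one_pos.trans_le (one_le_sqrt_symM hτ n)
  rw [hv' j n, h j n, inv_mul_cancel_left₀ hpos.ne']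

lemma IsSqrtM.mul_normB_le {τ : ℝ} (hτ : 0 < τ) {v w : VL2 d} (h : IsSqrtM τ v w)
    (hv : v ∈ domB τ) : ENNReal.ofReal τ * normB τ v ≤ ENNReal.ofReal (2 * ‖w‖) := by
  obtain ⟨g, hg⟩ := hv
  have hinner : inner ℝ v g ≤ inner ℝ ((4 / τ ^ 2) • w) w := inner_mono_coef fun j n => by
    have hsymB : symB τ n ≤ 4 / τ ^ 2 * symM τ n := by
      rw [symM, div_mul_eq_mul_div, le_div_iff₀ (by positivity)]
      linarith
    have := mul_le_mul_of_nonneg_right hsymB (mul_self_nonneg (coef (v j) n))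
    rw [← sqrt_symM_mul_self hτ.le] at this
    rw [PiLp.smul_apply, coef_smul, hg.isMultiplier j n, h j n]
    linarith
  have hle : inner ℝ v g ≤ (2 * ‖w‖ / τ) ^ 2 := by
    rw [real_inner_smul_left, real_inner_self_eq_norm_sq] at hinner
    exact hinner.trans_eq (by ring)
  calc ENNReal.ofReal τ * normB τ v
      ≤ ENNReal.ofReal τ * ENNReal.ofReal √(inner ℝ v g) := by gcongr; exact iInf₂_le g hg
    _ ≤ ENNReal.ofReal τ * ENNReal.ofReal (2 * ‖w‖ / τ) := by
        gcongr
        exact Real.sqrt_le_iff.2 ⟨by positivity, hle⟩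
    _ = ENNReal.ofReal (2 * ‖w‖) := by
        rw [← ENNReal.ofReal_mul hτ.le, mul_div_cancel₀ _ hτ.ne']

lemma IsSqrtM.normH1_le (hd : 2 ≤ d) {τ : ℝ} (hτ : 0 ≤ τ) {v w y : VL2 d} (h : IsSqrtM τ v w)
    (hv : v ∈ domB τ) (hy : IsMultiplier (fun n => lam n / symM τ n) w y) :
    normH1 v ≤ ENNReal.ofReal √(inner ℝ y w) := by
  obtain ⟨g, hg⟩ := hv
  obtain ⟨l, hl⟩ := hg.isMultiplier.exists_lam hd hτ
  have hinner : inner ℝ l v = inner ℝ y w := inner_congr_coef fun j n => by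
    have hpos := (symM_pos hτ n).ne'
    rw [hl j n, hy j n, h j n]
    field_simp
    rw [Real.sq_sqrt (symM_pos hτ n).le]
  exact hinner ▸ DirSplit.normH1_le hl

open ContinuousLinearMap in
/-- The sequences `E` and `r` satisfy the equations for the increments of the velocity and of the
pressure of the scheme, perturbed by `g` and `σ`. The shift `ρ` is the lagged pressure, so that
`2 r - ρ` is the extrapolated pressure in the velocity equation. -/
structure IsPerturbedScheme (τ : ℝ) (N : ℕ) (E : ℕ → VL2 d) (r ρ σ : ℕ → presSpace d)
    (g : ℕ → VL2 d) : Prop where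
  velocity_zero : E 0 = 0
  pressure_zero : r 0 = 0
  shift_zero : ρ 0 = 0
  mem_domB : ∀ k ≤ N, E k ∈ domB τ
  velocity : ∀ k < N,
    IsUnsplitStep τ (E k) (E (k + 1)) (g k - presGrad d ((2 : ℝ) • r k - ρ k))
  shift : ∀ k < N, ρ (k + 1) = r k + σ k
  penalty : ∀ k < N, r (k + 1) = ρ (k + 1) + τ⁻¹ • adjoint (presGrad d) (E (k + 1))

namespace IsPerturbedScheme

variable {τ : ℝ} {N : ℕ} {E : ℕ → VL2 d} {r ρ σ : ℕ → presSpace d} {g : ℕ → VL2 d}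

open ContinuousLinearMap in
/- Conjugation with `(I + (τ²/4) B)^{1/2}` removes the splitting term, and turns the Laplacian
into a bounded operator. -/
lemma isPerturbedSplitting (h : IsPerturbedScheme τ N E r ρ σ g) (hτ : 0 < τ) {w : ℕ → VL2 d}
    (hw : ∀ k ≤ N, IsSqrtM τ (E k) (w k)) {i A : VL2 d →L[ℝ] VL2 d}
    (hi : ∀ v, IsMultiplier (fun n => (√(symM τ n))⁻¹) v (i v))
    (hA : ∀ v, IsMultiplier (fun n => lam n / symM τ n) v (A v)) :
    IsPerturbedSplitting (adjoint (presGrad d) ∘L i) A τ N w r ρ σ fun k => τ • i (g k) where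
  velocity_zero := vcoef_ext fun j n => by
    rw [hw 0 N.zero_le j n, h.velocity_zero, PiLp.zero_apply, coef_zero, mul_zero]
  pressure_zero := h.pressure_zero
  shift_zero := h.shift_zero
  momentum k hk := by
    rw [adjoint_comp, adjoint_adjoint, adjoint_eq_of_isMultiplier hi, comp_apply]
    refine vcoef_ext fun j n => ?_
    have hstep := h.velocity k hk j n
    simp only [PiLp.add_apply, PiLp.sub_apply, PiLp.smul_apply, coef_add, coef_sub, coef_smul,
      hA _ j n, hi _ j n, hw k hk.le j n, hw (k + 1) hk j n] at hstep ⊢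
    have hpos : 0 < √(symM τ n) := one_pos.trans_le (one_le_sqrt_symM hτ.le n)
    rw [← sqrt_symM_mul_self hτ.le] at hstep ⊢
    simp only [Real.sqrt_mul_self hpos.le]
    field_simp
    linear_combination 2 * hstep
  shift := h.shift
  penalty k hk := by
    rw [comp_apply, (hw (k + 1) hk).eq_of_isMultiplier_inv hτ.le (hi _), h.penalty k hk]

open ContinuousLinearMap in
lemma stability (h : IsPerturbedScheme τ N E r ρ σ g) (hd : 2 ≤ d) (hτ : 0 < τ) {Γ : ℝ}
    (hΓ : ∑ k ∈ Finset.range N, (2 * (τ * ‖g k‖) + 2 * (τ * ‖σ k‖)) ≤ Γ) :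
    linfNorm N normL2 E + l2Norm τ N normH1 E
      + ENNReal.ofReal τ * linfNorm N normA (fun k => (r k : MixedSpace d) ∅)
      + ENNReal.ofReal τ * linfNorm N (normB τ) E ≤ ENNReal.ofReal (8 * Γ) := by
  choose! w hw using fun k hk => exists_isSqrtM hτ.le (h.mem_domB k hk)
  obtain ⟨i, hi_norm, hi⟩ := exists_inv_sqrt_symM (d := d) hτ.le
  obtain ⟨A, hA⟩ := exists_lam_div_symM hd hτ
  have hi_le (v) : ‖i v‖ ≤ ‖v‖ := i.le_of_opNorm_le_of_le hi_norm le_rfl |>.trans_eq (one_mul _)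
  have hA_nonneg (v) : 0 ≤ inner ℝ (A v) v :=
    (hA v).inner_nonneg fun n => div_nonneg (lam_nonneg n) (symM_pos hτ.le n).le
  have hG : ‖adjoint (presGrad d) ∘L i‖ ≤ 1 := by
    refine (opNorm_comp_le _ _).trans (mul_le_one₀ ?_ (norm_nonneg _) hi_norm)
    rw [LinearIsometryEquiv.norm_map]
    exact norm_presGrad_le
  have hsum : ∑ k ∈ Finset.range N, (2 * ‖τ • i (g k)‖ + 2 * (τ * ‖σ k‖)) ≤ Γ := by
    refine le_trans ?_ hΓ
    gcongr with k
    rw [norm_smul_of_nonneg hτ.le]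
    exact mul_le_mul_of_nonneg_left (hi_le _) hτ.le
  have hΓ₀ : 0 ≤ Γ := le_trans (by positivity) hsum
  obtain ⟨hbound, henergy⟩ := (h.isPerturbedSplitting hτ hw hi hA).stability hG hA_nonneg hτ hsum
  have hvelocity : linfNorm N normL2 E ≤ ENNReal.ofReal (2 * Γ) := linfNorm_le fun k hk =>
    ENNReal.ofReal_le_ofReal <| (hw k hk).eq_of_isMultiplier_inv hτ.le (hi _) ▸
      (hi_le (w k)).trans (hbound k hk).1
  have hgradient : l2Norm τ N normH1 E ≤ ENNReal.ofReal Γ :=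
    l2Norm_le hτ.le hΓ₀ (fun k => hA_nonneg (w k))
      (fun k hk => (hw k hk).normH1_le hd hτ.le (h.mem_domB k hk) (hA _)) henergy
  have hpressure : ENNReal.ofReal τ * linfNorm N normA (fun k => (r k : MixedSpace d) ∅) ≤
      ENNReal.ofReal Γ := mul_linfNorm_le fun k hk => by
    refine (mul_le_mul_right (normA_le (r k)) _).trans ?_
    rw [← ENNReal.ofReal_mul hτ.le]
    exact ENNReal.ofReal_le_ofReal (hbound k hk).2
  have hsplitting : ENNReal.ofReal τ * linfNorm N (normB τ) E ≤ ENNReal.ofReal (4 * Γ) :=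
    mul_linfNorm_le fun k hk => ((hw k hk).mul_normB_le hτ (h.mem_domB k hk)).trans <|
      ENNReal.ofReal_le_ofReal (by linarith [(hbound k hk).1])
  refine (add_le_add (add_le_add (add_le_add hvelocity hgradient) hpressure) hsplitting).trans ?_
  rw [← ENNReal.ofReal_add (by positivity) hΓ₀, ← ENNReal.ofReal_add (by positivity) hΓ₀,
    ← ENNReal.ofReal_add (by positivity) (by positivity)]
  exact ENNReal.ofReal_le_ofReal (by linarith)

end IsPerturbedScheme

/-! ### Truncation errors of the velocity step -/

lemma adjoint_presGrad_eq_zero {v : VL2 d} (hv : ∀ j, MemH10 (v j)) (hdiv : IsWeakDiv v 0) :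
    adjoint (presGrad d) v = 0 := by
  refine ext_inner_right ℝ fun q => ?_
  rw [ContinuousLinearMap.adjoint_inner_left, inner_zero_left, ← neg_eq_zero,
    ← hdiv.inner_eq hv q, inner_zero_left]

lemma IsStokesSolution.deriv_add_eq {T : ℝ} (hT : 0 < T) {f : ℝ → VL2 d} {u₀ : VL2 d}
    {u : ℝ → VL2 d} {p : ℝ → L2 d} (hsol : IsStokesSolution T f u₀ u p) {t : ℝ} (ht : t ∈ Ioc 0 T)
    {v' l G : VL2 d} (hv' : HasDerivWithinAt u v' (Icc 0 T) t) (hl : IsMultiplier lam (u t) l)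
    (hG : IsWeakGrad (p t) G) : v' + l = f t - G := by
  obtain ⟨ut, L, G', hut, hL, hG', hmomentum⟩ := hsol.momentum t ht
  have hderiv : ut = v' := (uniqueDiffOn_Icc hT t (Ioc_subset_Icc_self ht)).eq_deriv _ hut hv'
  have hlaplacian : L = -l := vcoef_ext fun j n => by
    obtain ⟨w, hw⟩ := (hsol.boundary t ht j).exists_isZeroTraceDeriv
    rw [coef_laplacian hw (hL j) n, PiLp.neg_apply, ← neg_one_smul ℝ (l j), coef_smul, hl j n]
    ring
  rw [← hmomentum, hlaplacian, hderiv, hG'.unique hG]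
  abel

lemma isUnsplitStep_of_isMultiplier {τ : ℝ} (hτ : τ ≠ 0) {v₀ v₁ l₀ l₁ b₀ b₁ : VL2 d}
    (hl₀ : IsMultiplier lam v₀ l₀) (hl₁ : IsMultiplier lam v₁ l₁)
    (hb₀ : IsMultiplier (symB τ) v₀ b₀) (hb₁ : IsMultiplier (symB τ) v₁ b₁) (v' l : VL2 d) :
    IsUnsplitStep τ v₀ v₁ (v' + l + (τ⁻¹ • (v₁ - v₀ - τ • v')
      + (1 / 2 : ℝ) • (l₁ + l₀ - (2 : ℝ) • l) + (τ / 4) • (b₁ - b₀))) := fun j n => by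
  simp only [PiLp.add_apply, PiLp.sub_apply, PiLp.smul_apply, coef_add, coef_sub, coef_smul,
    hl₀ j n, hl₁ j n, hb₀ j n, hb₁ j n, symM]
  field_simp
  ring

lemma norm_truncation_le {τ M₁ M₂ M₃ : ℝ} (hτ : 0 < τ) {v l b : VL2 d} (hv : ‖v‖ ≤ M₁ * τ ^ 3)
    (hl : ‖l‖ ≤ M₂ * τ ^ 2) (hb : ‖b‖ ≤ M₃ * τ) :
    ‖τ⁻¹ • v + (1 / 2 : ℝ) • l + (τ / 4) • b‖ ≤ (M₁ + M₂ / 2 + M₃ / 4) * τ ^ 2 :=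
  calc ‖τ⁻¹ • v + (1 / 2 : ℝ) • l + (τ / 4) • b‖
      ≤ τ⁻¹ * ‖v‖ + 1 / 2 * ‖l‖ + τ / 4 * ‖b‖ := by
        refine norm_add₃_le.trans_eq ?_
        rw [norm_smul_of_nonneg (by positivity), norm_smul_of_nonneg (by positivity),
          norm_smul_of_nonneg (by positivity)]
    _ ≤ τ⁻¹ * (M₁ * τ ^ 3) + 1 / 2 * (M₂ * τ ^ 2) + τ / 4 * (M₃ * τ) := by gcongr
    _ = (M₁ + M₂ / 2 + M₃ / 4) * τ ^ 2 := by field_simp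

/- As `lam ≤ d * symB T` and `symB τ ≤ symB T`, the regularity of `u` in `D(B_T)` controls both the
Laplacian of `u` and `B_τ u`, uniformly in `τ ≤ T`. -/
theorem IsStokesSolution.exists_truncation (hd : 2 ≤ d) {T : ℝ} (hT : 0 < T) {f : ℝ → VL2 d}
    {u₀ : VL2 d} {u : ℝ → VL2 d} {p : ℝ → L2 d} (hsol : IsStokesSolution T f u₀ u p)
    (hu : MemWInfty 3 T u) (huB : MemWInftyDB T 2 T u) : ∃ C : ℝ, 0 ≤ C ∧
      ∀ τ t, 0 < τ → t - τ / 2 ∈ Icc 0 T → t + τ / 2 ∈ Icc 0 T → ∃ R : VL2 d, ‖R‖ ≤ C * τ ^ 2 ∧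
        ∀ G, IsWeakGrad (p t) G →
          IsUnsplitStep τ (u (t - τ / 2)) (u (t + τ / 2)) (f t - G + R) := by
  obtain ⟨-, b, hb, hub⟩ := huB
  obtain ⟨u', M₁, hM₁, hu', hcentral⟩ := hu.exists_deriv_central_difference le_rfl
  obtain ⟨M₂, hM₂, hsecond⟩ := hb.exists_second_difference le_rfl
  obtain ⟨M₃, hM₃, hlip⟩ := hb.exists_lipschitz one_le_two
  refine ⟨M₁ + d * M₂ / 2 + M₃ / 4, by positivity, fun τ t hτ hl hr => ?_⟩
  have ht : t ∈ Ioc 0 T := ⟨by linarith [hl.1], by linarith [hr.2]⟩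
  have hτT : τ ≤ T := by linarith [hl.1, hr.2]
  have hB (s) (hs : s ∈ Icc 0 T) : IsMultiplier (symB T) (u s) (b s) := (hub s hs).isMultiplier
  choose! l hl_mul using fun s hs => (hB s hs).exists_lam hd hT.le
  have hsymB (n : Fin d → ℕ) : |symB τ n| ≤ 1 * |symB T n| := by
    rw [one_mul, abs_of_nonneg (symB_nonneg hτ.le n), abs_of_nonneg (symB_nonneg hT.le n)]
    exact symB_mono hτ.le hτT n
  have hlam (n : Fin d → ℕ) : |lam n| ≤ d * |symB T n| := by
    rw [abs_of_nonneg (lam_nonneg n), abs_of_nonneg (symB_nonneg hT.le n)]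
    exact lam_le_symB hd hT.le n
  choose! bτ hbτ using fun s hs => (hB s hs).exists_of_abs_le hsymB
  have htI : t ∈ Icc 0 T := Ioc_subset_Icc_self ht
  refine ⟨_, norm_truncation_le hτ (v := u (t + τ / 2) - u (t - τ / 2) - τ • u' t)
    (l := l (t + τ / 2) + l (t - τ / 2) - (2 : ℝ) • l t)
    (b := bτ (t + τ / 2) - bτ (t - τ / 2)) ?_ ?_ ?_, fun G hG => ?_⟩
  · have hbound := hcentral t (τ / 2) (by positivity) hl hr
    rw [mul_div_cancel₀ τ two_ne_zero, div_pow, mul_div_assoc'] at hbound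
    exact hbound.trans (div_le_self (by positivity) (by norm_num))
  · refine ((((hB _ hr).add (hB _ hl)).sub ((hB _ htI).smul 2)).norm_le
      (((hl_mul _ hr).add (hl_mul _ hl)).sub ((hl_mul _ htI).smul 2)) d.cast_nonneg hlam).trans ?_
    rw [mul_assoc]
    gcongr
    refine (hsecond t (τ / 2) (by positivity) hl hr).trans ?_
    gcongr
    linarith
  · refine (((hB _ hr).sub (hB _ hl)).norm_le ((hbτ _ hr).sub (hbτ _ hl)) zero_le_one
      hsymB).trans ?_
    rw [one_mul]
    refine (hlip _ hl _ hr).trans_eq ?_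
    rw [add_sub_sub_cancel, add_halves, abs_of_pos hτ]
  · rw [← hsol.deriv_add_eq hT ht (hu' t htI) (hl_mul t htI) hG]
    exact isUnsplitStep_of_isMultiplier hτ.ne' (hl_mul _ hl) (hl_mul _ hr) (hbτ _ hl) (hbτ _ hr)
      _ _

/-! ### Regularity of the exact solution -/

lemma MemWInfty.toLp {ι : Type*} [Fintype ι] {F : ι → Type*} [∀ i, NormedAddCommGroup (F i)]
    [∀ i, NormedSpace ℝ (F i)] [∀ i, CompleteSpace (F i)] {m : ℕ} {T : ℝ} {g : ∀ i, ℝ → F i}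
    (h : ∀ i, MemWInfty m T (g i)) :
    MemWInfty m T fun t => (WithLp.toLp 2 fun i => g i t : PiLp 2 F) := by
  choose V hV₀ hbound hV using h
  refine ⟨fun j t => WithLp.toLp 2 fun i => V i j t, fun t ht => ?_,
    fun j hj => memLp_piLp_iff.2 fun i => hbound i j hj, fun j hj t ht => PiLp.ext fun i => ?_⟩
  · exact PiLp.ext fun i => hV₀ i t ht
  · have hintegrable (i) : IntegrableOn (V i (j + 1)) (Ioc 0 t) :=
      (intervalIntegrable_of_memLp_top (hbound i (j + 1) hj) ⟨le_rfl, ht.1.trans ht.2⟩ ht).1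
    rw [intervalIntegral.integral_of_le ht.1, PiLp.add_apply, eval_integral_piLp hintegrable,
      ← intervalIntegral.integral_of_le ht.1]
    exact hV i j hj t ht

lemma isWeakDeriv_zero (v : L2 d) : IsWeakDeriv 0 v v := fun ψ _ => by
  simp [mpd_zero]

lemma MemWInftyH2.memWInfty {m : ℕ} {T : ℝ} {u : ℝ → VL2 d} (h : MemWInftyH2 m T u) :
    MemWInfty m T u := by
  obtain ⟨g, hg, hug⟩ := h 0 (by simp)
  exact hg.congr fun t ht => PiLp.ext fun j => (hug t ht j).unique (isWeakDeriv_zero _)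

lemma MemWInftyY.mono {m k : ℕ} {T : ℝ} {p : ℝ → L2 d} (h : MemWInftyY m T p) (hk : k ≤ m) :
    MemWInftyY k T p :=
  ⟨h.1, fun S => (h.2 S).imp fun _ hg => ⟨hg.1.mono hk, hg.2⟩⟩

lemma MemWInftyY.exists_presSpace {m : ℕ} {T : ℝ} {p : ℝ → L2 d} (h : MemWInftyY m T p) :
    ∃ q : ℝ → presSpace d, (∀ t ∈ Icc 0 T, (q t : MixedSpace d) ∅ = p t) ∧
      MemWInfty m T fun t => (q t : MixedSpace d) := by
  obtain ⟨hmean, hderiv⟩ := h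
  choose g hg hpg using hderiv
  have hempty (t) (ht : t ∈ Icc 0 T) : g ∅ t = p t :=
    (hpg ∅ t ht).unique (ind_empty ▸ isWeakDeriv_zero _)
  have hmem (t) (ht : t ∈ Icc 0 T) : ∃ y : presSpace d,
      (y : MixedSpace d) = WithLp.toLp 2 fun S => g S t := by
    refine ⟨⟨_, ?_, fun S => ?_⟩, rfl⟩
    · simpa only [hempty t ht] using hmean t ht
    · simpa only [hempty t ht] using hpg S t ht
  choose! q hq using hmem
  exact ⟨q, fun t ht => by rw [hq t ht, ← hempty t ht],
    (MemWInfty.toLp hg).congr fun t ht => (hq t ht).symm⟩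

/-! ### The equations for the errors -/

/-- The errors `e` and `ε` of the velocity and the pressure solve the scheme up to truncation
errors: `R` for the velocity, and `σ` for the extrapolation of the pressure. The field `Z k` is the
gradient of the error of the pressure predictor, which for `k = 0` is determined by the initial
guess. -/
structure IsErrorSequence (τ : ℝ) (N : ℕ) (e : ℕ → VL2 d) (ε σ : ℕ → presSpace d)
    (R Z : ℕ → VL2 d) : Prop where
  velocity_zero : e 0 = 0
  pressure_zero : ε 0 = 0
  mem_domB : ∀ k ≤ N, e k ∈ domB τ
  velocity : ∀ k < N, IsUnsplitStep τ (e k) (e (k + 1)) (R k - Z k)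
  predictor : ∀ k, k + 1 < N → Z (k + 1) = presGrad d (ε (k + 1) + incr ε (k + 1) + σ (k + 1))
  penalty : ∀ k < N, incr ε (k + 1)
    = incr ε k + σ k + τ⁻¹ • adjoint (presGrad d) (incr e (k + 1))

/-- The lagged pressure increments of the perturbed scheme. -/
def lag {E : Type*} [AddCommGroup E] (r σ : ℕ → E) : ℕ → E
  | 0 => 0
  | k + 1 => r k + σ k

/-- The sources in the equations for the increments of the velocity error. The first two differ
from the rest, as the first pressure predictor is not an extrapolation. -/
def incrSource (R : ℕ → VL2 d) (Z₀ : VL2 d) (σ : ℕ → presSpace d) : ℕ → VL2 d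
  | 0 => R 0 - Z₀
  | 1 => R 1 - R 0 + Z₀ - presGrad d (σ 1 + σ 0)
  | k + 2 => R (k + 2) - R (k + 1) - presGrad d (σ (k + 2))

lemma incr_zero {E : Type*} [AddCommGroup E] (ψ : ℕ → E) : incr ψ 0 = 0 := sub_self _

lemma incr_succ {E : Type*} [AddCommGroup E] (ψ : ℕ → E) (k : ℕ) :
    incr ψ (k + 1) = ψ (k + 1) - ψ k := rfl

namespace IsErrorSequence

variable {τ : ℝ} {N : ℕ} {e : ℕ → VL2 d} {ε σ : ℕ → presSpace d} {R Z : ℕ → VL2 d}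

lemma velocity_incr (h : IsErrorSequence τ N e ε σ R Z) : ∀ k < N,
    IsUnsplitStep τ (incr e k) (incr e (k + 1)) (incrSource R (Z 0) σ k
      - presGrad d ((2 : ℝ) • incr ε k - lag (incr ε) σ k))
  | 0, hk => by
    simpa [incr_zero, incr_succ, incrSource, lag, h.velocity_zero] using h.velocity 0 hk
  | 1, hk => by
    have hε : ε 1 = incr ε 1 := by rw [incr_succ, h.pressure_zero, sub_zero]
    have hrhs : incrSource R (Z 0) σ 1 - presGrad d ((2 : ℝ) • incr ε 1 - lag (incr ε) σ 1)
        = R 1 - Z 1 - (R 0 - Z 0) := by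
      rw [h.predictor 0 hk, zero_add, hε, incrSource, lag, incr_zero]
      simp only [map_add, map_sub, map_smul, map_zero]
      module
    exact hrhs ▸ (h.velocity 1 hk).sub (h.velocity 0 (by lia))
  | k + 2, hk => by
    have hrhs : incrSource R (Z 0) σ (k + 2)
          - presGrad d ((2 : ℝ) • incr ε (k + 2) - lag (incr ε) σ (k + 2))
        = R (k + 2) - Z (k + 2) - (R (k + 1) - Z (k + 1)) := by
      rw [h.predictor (k + 1) hk, h.predictor k (by lia), incrSource, lag, incr_succ, incr_succ]
      simp only [map_add, map_sub, map_smul]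
      module
    exact hrhs ▸ (h.velocity (k + 2) hk).sub (h.velocity (k + 1) (by lia))

lemma isPerturbedScheme (h : IsErrorSequence τ N e ε σ R Z) (hd : 2 ≤ d) (hτ : 0 ≤ τ) :
    IsPerturbedScheme τ N (incr e) (incr ε) (lag (incr ε) σ) σ (incrSource R (Z 0) σ) where
  velocity_zero := incr_zero e
  pressure_zero := incr_zero ε
  shift_zero := rfl
  mem_domB k hk := sub_mem_domB hd hτ (h.mem_domB k hk) (h.mem_domB (k - 1) (by lia))
  velocity := h.velocity_incr
  shift _ _ := rfl
  penalty := h.penalty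

end IsErrorSequence

lemma sum_le_of_two_large {N : ℕ} {a : ℕ → ℝ} {A B : ℝ} (hA : 0 ≤ A) (hB : 0 ≤ B)
    (h : ∀ k < N, a k ≤ if k < 2 then A else B) :
    ∑ k ∈ Finset.range N, a k ≤ 2 * A + N * B :=
  calc ∑ k ∈ Finset.range N, a k
      ≤ ∑ k ∈ Finset.range N, ((if k < 2 then A else 0) + B) := by
        gcongr with k hk
        refine (h k (Finset.mem_range.1 hk)).trans ?_
        split_ifs <;> linarith
    _ = ({k ∈ Finset.range N | k < 2}.card : ℝ) * A + N * B := by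
        rw [Finset.sum_add_distrib, ← Finset.sum_filter]
        simp
    _ ≤ 2 * A + N * B := by
        gcongr
        have hsub : {k ∈ Finset.range N | k < 2} ⊆ Finset.range 2 := fun k hk =>
          Finset.mem_range.2 (Finset.mem_filter.1 hk).2
        exact_mod_cast Finset.card_le_card hsub

lemma sum_incrSource_le {T τ K : ℝ} (hτ : 0 ≤ τ) (hτT : τ ≤ T) (hK : 0 ≤ K) {N : ℕ}
    (hN : N * τ ≤ T) {R : ℕ → VL2 d} {Z₀ : VL2 d} {σ : ℕ → presSpace d}
    (hR : ∀ k < N, ‖R k‖ ≤ K * τ ^ 2) (hZ₀ : ‖Z₀‖ ≤ K * τ) (hσ : ∀ k < N, ‖σ k‖ ≤ K * τ)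
    (hσ' : ∀ k, k + 2 < N → ‖σ (k + 2)‖ ≤ K * τ ^ 2) :
    ∑ k ∈ Finset.range N, (2 * (τ * ‖incrSource R Z₀ σ k‖) + 2 * (τ * ‖σ k‖))
      ≤ 16 * (1 + T) * K * τ ^ 2 := by
  have hgrad (q : presSpace d) : ‖presGrad d q‖ ≤ ‖q‖ :=
    ((presGrad d).le_of_opNorm_le norm_presGrad_le q).trans_eq (one_mul _)
  have hfactor (a b : ℝ) : 2 * (τ * a) + 2 * (τ * b) = 2 * τ * (a + b) := by ring
  have hT : 0 ≤ T := hτ.trans hτT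
  have hlarge : 2 * τ * (4 * (K * τ) + 2 * (K * τ ^ 2)) ≤ (8 + 4 * T) * K * τ ^ 2 := by
    have := mul_le_mul_of_nonneg_right hτT (by positivity : 0 ≤ K * τ ^ 2)
    linarith
  refine (sum_le_of_two_large (A := (8 + 4 * T) * K * τ ^ 2) (B := 2 * τ * (4 * (K * τ ^ 2)))
    (by positivity) (by positivity) fun k hk => ?_).trans ?_
  · rw [hfactor]
    match k with
    | 0 =>
      rw [if_pos two_pos, incrSource]
      refine (mul_le_mul_of_nonneg_left ?_ (by positivity)).trans hlarge
      have : 0 ≤ K * τ ^ 2 := by positivity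
      linarith [norm_sub_le (R 0) Z₀, hR 0 hk, hσ 0 hk, (norm_nonneg _).trans hZ₀]
    | 1 =>
      rw [if_pos one_lt_two, incrSource]
      refine (mul_le_mul_of_nonneg_left ?_ (by positivity)).trans hlarge
      have hZ := norm_add_le (R 1 - R 0) Z₀
      have hσ₀₁ := (hgrad _).trans (norm_add_le (σ 1) (σ 0))
      linarith [norm_sub_le (R 1 - R 0 + Z₀) (presGrad d (σ 1 + σ 0)), norm_sub_le (R 1) (R 0),
        hR 0 (by lia), hR 1 hk, hσ 0 (by lia), hσ 1 hk]
    | k + 2 =>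
      rw [if_neg (by lia), incrSource]
      gcongr
      linarith [norm_sub_le (R (k + 2) - R (k + 1)) (presGrad d (σ (k + 2))),
        norm_sub_le (R (k + 2)) (R (k + 1)), hgrad (σ (k + 2)), hR (k + 1) (by lia),
        hR (k + 2) hk, hσ' k hk]
  · have := mul_le_mul_of_nonneg_right hN (by positivity : 0 ≤ K * τ ^ 2)
    linarith

/-! ### Lifting the scheme to the pressure space -/

lemma IsWeakGrad.sub {q q' : L2 d} {G G' : VL2 d} (h : IsWeakGrad q G) (h' : IsWeakGrad q' G') :
    IsWeakGrad (q - q') (G - G') := fun i => by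
  have hq := h i
  have hq' := h' i
  rw [isWeakDeriv_iff] at hq hq' ⊢
  intro ψ hψ
  rw [PiLp.sub_apply, inner_sub_left, inner_sub_left, hq ψ hψ, hq' ψ hψ]
  ring

lemma domB_subset (hd : 2 ≤ d) {τ τ' : ℝ} (hτ : 0 ≤ τ) (h : τ ≤ τ') :
    (domB τ' : Set (VL2 d)) ⊆ domB τ := fun v ⟨g, hg⟩ => by
  have hsymB (n : Fin d → ℕ) : |symB τ n| ≤ 1 * |symB τ' n| := by
    rw [one_mul, abs_of_nonneg (symB_nonneg hτ n), abs_of_nonneg (symB_nonneg (hτ.trans h) n)]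
    exact symB_mono hτ h n
  obtain ⟨g', hg'⟩ := hg.isMultiplier.exists_of_abs_le hsymB
  exact ⟨g', (isB_iff hd hτ).2 hg'⟩

lemma IsA.eq_smul_adjoint_presGrad {τ : ℝ} {U : VL2 d} {D φ : L2 d} (hA : IsA φ (-(τ⁻¹ • D)))
    (hD : IsWeakDiv U D) (hU : ∀ j, MemH10 (U j)) :
    φ = ((τ⁻¹ • adjoint (presGrad d) U : presSpace d) : MixedSpace d) ∅ := by
  obtain ⟨y, rfl, hy⟩ := hA.exists_presSpace
  have : y = τ⁻¹ • adjoint (presGrad d) U := by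
    refine ext_inner_right ℝ fun q => ?_
    rw [hy, inner_neg_left, real_inner_smul_left, hD.inner_eq hU, ← map_smul,
      ContinuousLinearMap.adjoint_inner_left, real_inner_smul_left, mul_neg, neg_neg]
  rw [this]

/-- The pressure `p^{k-1/2}` of the scheme as an element of `presSpace d`. -/
def presLift (τ : ℝ) (q₀ : presSpace d) (U : ℕ → VL2 d) (k : ℕ) : presSpace d :=
  q₀ + ∑ l ∈ Finset.range k, τ⁻¹ • adjoint (presGrad d) (U (l + 1))

lemma presLift_succ (τ : ℝ) (q₀ : presSpace d) (U : ℕ → VL2 d) (k : ℕ) :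
    presLift τ q₀ U (k + 1)
      = presLift τ q₀ U k + τ⁻¹ • adjoint (presGrad d) (U (k + 1)) := by
  rw [presLift, Finset.sum_range_succ, ← add_assoc, presLift]

lemma incr_presLift {τ : ℝ} {q₀ : presSpace d} {U : ℕ → VL2 d}
    (h : adjoint (presGrad d) (U 0) = 0) (k : ℕ) :
    incr (presLift τ q₀ U) k = τ⁻¹ • adjoint (presGrad d) (U k) := by
  cases k with
  | zero => rw [incr_zero, h, smul_zero]
  | succ k => rw [incr_succ, presLift_succ, add_sub_cancel_left]

namespace IsSchemeSolution

variable {τ : ℝ} {N : ℕ} {f : ℝ → VL2 d} {u₀ : VL2 d} {p₀ φstar : L2 d} {U : ℕ → VL2 d}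
  {P Φ : ℕ → L2 d}

lemma mem_domB {χ : ℝ} (h : IsSchemeSolution χ τ N f u₀ p₀ φstar U P Φ) (hτ : 0 < τ)
    (hu₀ : u₀ ∈ domB τ) : ∀ k ≤ N, U k ∈ domB τ
  | 0, _ => h.init_velocity ▸ hu₀
  | k + 1, hk => by
    obtain ⟨G, -, hG⟩ := h.velocity k hk
    exact hG.mem_domB hτ (h.mem_domB hτ hu₀ k (by lia))

lemma correction_eq {χ : ℝ} (h : IsSchemeSolution χ τ N f u₀ p₀ φstar U P Φ) (hτ : 0 < τ)
    (hu₀ : u₀ ∈ domB τ) {k : ℕ} (hk : k < N) : Φ (k + 1)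
      = ((τ⁻¹ • adjoint (presGrad d) (U (k + 1)) : presSpace d) :
          MixedSpace d) ∅ := by
  obtain ⟨D, hD, hA⟩ := h.penalty k hk
  obtain ⟨g, hg⟩ := h.mem_domB hτ hu₀ (k + 1) hk
  exact hA.eq_smul_adjoint_presGrad hD hg.1

lemma pressure_eq {q₀ : presSpace d}
    (h : IsSchemeSolution 0 τ N f u₀ ((q₀ : MixedSpace d) ∅) φstar U P Φ) (hτ : 0 < τ)
    (hu₀ : u₀ ∈ domB τ) : ∀ k ≤ N, P k = (presLift τ q₀ U k : MixedSpace d) ∅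
  | 0, _ => by rw [h.init_pressure, presLift, Finset.sum_range_zero, add_zero]
  | k + 1, hk => by
    obtain ⟨D, -, hP⟩ := h.pressure k hk
    rw [hP, zero_smul, sub_zero, h.pressure_eq hτ hu₀ k (by lia), h.correction_eq hτ hu₀ hk,
      presLift_succ]
    rfl

lemma isWeakGrad_predictor {q₀ : presSpace d}
    (h : IsSchemeSolution 0 τ N f u₀ ((q₀ : MixedSpace d) ∅) φstar U P Φ) (hτ : 0 < τ)
    (hu₀ : u₀ ∈ domB τ) {k : ℕ} (hk : k < N) : IsWeakGrad (P (k + 1) + Φ (k + 1))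
      (presGrad d (presLift τ q₀ U (k + 1) + incr (presLift τ q₀ U) (k + 1))) := by
  rw [h.pressure_eq hτ hu₀ _ hk, h.correction_eq hτ hu₀ hk, incr_succ (presLift τ q₀ U),
    presLift_succ τ q₀ U k, add_sub_cancel_left, ← PiLp.add_apply, ← Submodule.coe_add]
  exact isWeakGrad_presGrad _

end IsSchemeSolution

/-- The velocities `v k` and pressures `Q k` satisfy the unsplit scheme with source term `f` up to
the truncation errors `R k`. As for the scheme itself, `Q (k + 1)` is the pressure at time
`(k + 1/2) τ`. -/
structure IsConsistentSequence (τ : ℝ) (N : ℕ) (f : ℝ → VL2 d) (v : ℕ → VL2 d)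
    (Q : ℕ → presSpace d) (R : ℕ → VL2 d) : Prop where
  mem_domB : ∀ k ≤ N, v k ∈ domB τ
  divergence_free : ∀ k ≤ N, adjoint (presGrad d) (v k) = 0
  velocity : ∀ k < N, IsUnsplitStep τ (v k) (v (k + 1))
    (f (((k : ℝ) + 1 / 2) * τ) - presGrad d (Q (k + 1)) + R k)

namespace IsConsistentSequence

variable {τ : ℝ} {N : ℕ} {f : ℝ → VL2 d} {v U : ℕ → VL2 d} {Q : ℕ → presSpace d}
  {R : ℕ → VL2 d} {φstar : L2 d} {P Φ : ℕ → L2 d}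

theorem exists_isErrorSequence (hv : IsConsistentSequence τ N f v Q R) (hd : 2 ≤ d) (hτ : 0 < τ)
    (hS : IsSchemeSolution 0 τ N f (v 0) ((Q 0 : MixedSpace d) ∅) φstar U P Φ) :
    ∃ Z : ℕ → VL2 d,
      IsErrorSequence τ N (fun k => v k - U k) (fun k => Q k - presLift τ (Q 0) U k)
        (fun k => incr Q (k + 1) - incr Q k) R Z ∧
      (0 < N → IsWeakGrad ((Q 1 : MixedSpace d) ∅ - ((Q 0 : MixedSpace d) ∅ + φstar)) (Z 0)) := by
  have hv₀ := hv.mem_domB 0 N.zero_le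
  have hU := hS.mem_domB hτ hv₀
  have hU₀ : adjoint (presGrad d) (U 0) = 0 :=
    hS.init_velocity ▸ hv.divergence_free 0 N.zero_le
  choose! G hG hstep using hS.velocity
  refine ⟨fun k => presGrad d (Q (k + 1)) - G k, ⟨?_, ?_, fun k hk => ?_, fun k hk => ?_,
    fun k hk => ?_, fun k hk => ?_⟩, fun hN => ?_⟩
  · rw [hS.init_velocity, sub_self]
  · rw [presLift, Finset.sum_range_zero, add_zero, sub_self]
  · exact sub_mem_domB hd hτ.le (hv.mem_domB k hk) (hU k hk)
  · obtain ⟨g, hg⟩ := hU k hk.le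
    convert (hv.velocity k hk).sub ((hstep k hk).isUnsplitStep hτ.ne' hg.1) using 1
    abel
  · rw [(hG (k + 1) hk).unique (hS.isWeakGrad_predictor hτ hv₀ hk.le), ← map_sub]
    congr 1
    simp only [incr_succ]
    abel
  · have hincr (l : ℕ) : incr (fun k => Q k - presLift τ (Q 0) U k) l
        = incr Q l - τ⁻¹ • adjoint (presGrad d) (U l) := by
      rw [← incr_presLift hU₀, incr, incr, incr]
      abel
    have hdiv : adjoint (presGrad d) (incr (fun k => v k - U k) (k + 1))
        = adjoint (presGrad d) (U k)
          - adjoint (presGrad d) (U (k + 1)) := by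
      rw [incr_succ (fun k => v k - U k), map_sub, map_sub, map_sub, hv.divergence_free _ hk,
        hv.divergence_free _ hk.le, zero_sub, zero_sub, neg_sub_neg]
    rw [hincr, hincr, hdiv, smul_sub]
    abel
  · have hpred := hG 0 hN
    rw [hS.init_pressure, hS.init_correction] at hpred
    exact (isWeakGrad_presGrad _).sub hpred

end IsConsistentSequence

/-! ### The error estimate -/

/-- The times `0, τ/2, 3τ/2, …` at which the discrete pressures live. -/
def presTime (τ : ℝ) : ℕ → ℝ
  | 0 => 0
  | k + 1 => ((k : ℝ) + 1 / 2) * τ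

lemma presTime_succ_succ (τ : ℝ) (k : ℕ) : presTime τ (k + 2) = presTime τ (k + 1) + τ := by
  simp only [presTime]
  push_cast
  ring

lemma natCast_mul_mem_Icc {T τ : ℝ} (hτ : 0 ≤ τ) {k N : ℕ} (hk : k ≤ N) (hN : N * τ ≤ T) :
    (k : ℝ) * τ ∈ Icc 0 T := by
  refine ⟨by positivity, le_trans ?_ hN⟩
  gcongr

lemma presTime_mem_Icc {T τ : ℝ} (hτ : 0 ≤ τ) {N : ℕ} (hN : N * τ ≤ T) :
    ∀ k ≤ N, presTime τ k ∈ Icc 0 T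
  | 0, _ => ⟨le_rfl, (mul_nonneg N.cast_nonneg hτ).trans hN⟩
  | k + 1, hk => by
    have hlast := (natCast_mul_mem_Icc hτ hk hN).2
    push_cast at hlast
    simp only [presTime]
    exact ⟨by positivity, by linarith⟩

lemma abs_presTime_succ_sub_le {τ : ℝ} (hτ : 0 ≤ τ) :
    ∀ k, |presTime τ (k + 1) - presTime τ k| ≤ τ
  | 0 => by
    simp only [presTime, Nat.cast_zero, sub_zero]
    rw [abs_of_nonneg (by positivity)]
    linarith
  | k + 1 => by rw [presTime_succ_succ, add_sub_cancel_left, abs_of_nonneg hτ]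

lemma presError_eq (τ : ℝ) (p : ℝ → L2 d) (P : ℕ → L2 d) (k : ℕ) :
    presError τ p P k = p (presTime τ k) - P k := by
  cases k <;> rfl

lemma MemWInfty.exists_incr_presTime {F : Type*} [NormedAddCommGroup F] [NormedSpace ℝ F]
    [CompleteSpace F] {m : ℕ} (hm : 2 ≤ m) {T : ℝ} {g : ℝ → F} (h : MemWInfty m T g) :
    ∃ M : ℝ, 0 ≤ M ∧
      ∀ τ, 0 ≤ τ → ∀ N : ℕ, N * τ ≤ T → let ψ := fun k => g (presTime τ k)
        (∀ k < N, ‖incr ψ (k + 1) - incr ψ k‖ ≤ M * τ) ∧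
        ∀ k, k + 2 < N → ‖incr ψ (k + 3) - incr ψ (k + 2)‖ ≤ M * τ ^ 2 := by
  obtain ⟨M₁, hM₁, hlip⟩ := h.exists_lipschitz (one_le_two.trans hm)
  obtain ⟨M₂, hM₂, hsecond⟩ := h.exists_second_difference hm
  refine ⟨2 * M₁ + M₂, by positivity, fun τ hτ N hN => ⟨fun k hk => ?_, fun k hk => ?_⟩⟩
  · have hincr (l : ℕ) (hl : l ≤ N) : ‖incr (fun k => g (presTime τ k)) l‖ ≤ M₁ * τ := by
      cases l with
      | zero => rw [incr_zero, norm_zero]; positivity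
      | succ l =>
        refine (hlip _ (presTime_mem_Icc hτ hN l (by lia)) _
          (presTime_mem_Icc hτ hN _ hl)).trans ?_
        gcongr
        exact abs_presTime_succ_sub_le hτ l
    have : 0 ≤ M₂ * τ := by positivity
    linarith [norm_sub_le (incr (fun k => g (presTime τ k)) (k + 1))
      (incr (fun k => g (presTime τ k)) k), hincr (k + 1) hk, hincr k hk.le]
  · have hleft : presTime τ (k + 2) - τ = presTime τ (k + 1) := by
      rw [presTime_succ_succ, add_sub_cancel_right]
    have hbound := hsecond (presTime τ (k + 2)) τ hτ
      (hleft ▸ presTime_mem_Icc hτ hN _ (by lia))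
      (presTime_succ_succ τ (k + 1) ▸ presTime_mem_Icc hτ hN _ hk)
    rw [← presTime_succ_succ τ (k + 1), hleft] at hbound
    calc ‖incr (fun k => g (presTime τ k)) (k + 3) - incr (fun k => g (presTime τ k)) (k + 2)‖
        = ‖g (presTime τ (k + 3)) + g (presTime τ (k + 1))
            - (2 : ℝ) • g (presTime τ (k + 2))‖ := by
          congr 1
          rw [incr_succ (fun k => g (presTime τ k)), incr_succ (fun k => g (presTime τ k))]
          module
      _ ≤ M₂ * τ ^ 2 := hbound
      _ ≤ (2 * M₁ + M₂) * τ ^ 2 := by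
        gcongr
        linarith

theorem IsStokesSolution.exists_isConsistentSequence (hd : 2 ≤ d) {T : ℝ} (hT : 0 < T)
    {f : ℝ → VL2 d} {u₀ : VL2 d} {u : ℝ → VL2 d} {p : ℝ → L2 d} (hsol : IsStokesSolution T f u₀ u p)
    (hu : MemWInfty 3 T u) (huB : MemWInftyDB T 2 T u) (hp : MemWInftyY 2 T p) :
    ∃ K : ℝ, 0 ≤ K ∧ ∀ τ, 0 < τ → τ ≤ T → ∀ N : ℕ, N * τ ≤ T →
      ∃ (Q : ℕ → presSpace d) (R : ℕ → VL2 d),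
        IsConsistentSequence τ N f (fun k => u (k * τ)) Q R ∧
        (∀ k ≤ N, (Q k : MixedSpace d) ∅ = p (presTime τ k)) ∧
        (∀ k < N, ‖R k‖ ≤ K * τ ^ 2) ∧
        (∀ k < N, ‖incr Q (k + 1) - incr Q k‖ ≤ K * τ) ∧
        ∀ k, k + 2 < N → ‖incr Q (k + 3) - incr Q (k + 2)‖ ≤ K * τ ^ 2 := by
  obtain ⟨C, hC, htrunc⟩ := hsol.exists_truncation hd hT hu huB
  obtain ⟨q, hqp, hq⟩ := hp.exists_presSpace
  obtain ⟨M, hM, hincr⟩ := hq.exists_incr_presTime le_rfl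
  obtain ⟨-, b, -, hub⟩ := huB
  refine ⟨C + M, by positivity, fun τ hτ hτT N hN => ?_⟩
  have hmem (k : ℕ) (hk : k ≤ N) : (k : ℝ) * τ ∈ Icc 0 T := natCast_mul_mem_Icc hτ.le hk hN
  have hpmem := presTime_mem_Icc hτ.le hN
  have hstart (k : ℕ) : ((k : ℝ) + 1 / 2) * τ - τ / 2 = k * τ := by ring
  have hend (k : ℕ) : ((k : ℝ) + 1 / 2) * τ + τ / 2 = (k + 1 : ℕ) * τ := by push_cast; ring
  choose! R hR hstep using fun k (hk : k < N) => htrunc τ (((k : ℝ) + 1 / 2) * τ) hτ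
    (hstart k ▸ hmem k hk.le) (hend k ▸ hmem (k + 1) hk)
  obtain ⟨hincr₁, hincr₂⟩ := hincr τ hτ.le N hN
  refine ⟨fun k => q (presTime τ k), R, ⟨fun k hk => ?_, fun k hk => ?_, fun k hk => ?_⟩,
    fun k hk => hqp _ (hpmem k hk), fun k hk => (hR k hk).trans ?_,
    fun k hk => (hincr₁ k hk).trans ?_, fun k hk => (hincr₂ k hk).trans ?_⟩
  · exact domB_subset hd hτ.le hτT ⟨_, hub _ (hmem k hk)⟩
  · exact adjoint_presGrad_eq_zero (hub _ (hmem k hk)).1 (hsol.incompressible _ (hmem k hk))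
  · rw [← hstart, ← hend]
    have hgrad : IsWeakGrad (p (presTime τ (k + 1))) (presGrad d (q (presTime τ (k + 1)))) :=
      hqp _ (hpmem (k + 1) hk) ▸ isWeakGrad_presGrad _
    exact hstep k hk _ hgrad
  all_goals
    gcongr
    linarith

lemma IsSchemeSolution.linfNorm_presError {τ : ℝ} (hτ : 0 < τ) {N : ℕ} {f : ℝ → VL2 d}
    {u₀ : VL2 d} (hu₀ : u₀ ∈ domB τ) {p : ℝ → L2 d} {φstar : L2 d} {U : ℕ → VL2 d}
    {P Φ : ℕ → L2 d} (h : IsSchemeSolution 0 τ N f u₀ (p 0) φstar U P Φ) {Q : ℕ → presSpace d}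
    (hQ : ∀ k ≤ N, (Q k : MixedSpace d) ∅ = p (presTime τ k)) :
    linfNorm N normA (incr (presError τ p P)) = linfNorm N normA
      fun k => (incr (fun k => Q k - presLift τ (Q 0) U k) k : MixedSpace d) ∅ := by
  have hQ₀ : (Q 0 : MixedSpace d) ∅ = p 0 := hQ 0 N.zero_le
  have hP := (hQ₀ ▸ h).pressure_eq hτ hu₀
  refine iSup_congr fun k => iSup_congr fun hk => congrArg normA ?_
  have hkN : k ≤ N := (Finset.mem_Icc.1 hk).2
  rw [incr, presError_eq, presError_eq, ← hQ k hkN, ← hQ (k - 1) (by lia), hP k hkN,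
    hP (k - 1) (by lia)]
  rfl

theorem IsConsistentSequence.error_le (hd : 2 ≤ d) {T τ K : ℝ} (hτ : 0 < τ) (hτT : τ ≤ T)
    (hK : 0 ≤ K) {N : ℕ} (hN₀ : 0 < N) (hN : N * τ ≤ T) {f : ℝ → VL2 d} {v U : ℕ → VL2 d}
    {p : ℝ → L2 d} {φstar : L2 d} {P Φ : ℕ → L2 d} {Q : ℕ → presSpace d} {R : ℕ → VL2 d} {G : VL2 d}
    (hv : IsConsistentSequence τ N f v Q R)
    (hQ : ∀ k ≤ N, (Q k : MixedSpace d) ∅ = p (presTime τ k))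
    (hR : ∀ k < N, ‖R k‖ ≤ K * τ ^ 2) (hσ : ∀ k < N, ‖incr Q (k + 1) - incr Q k‖ ≤ K * τ)
    (hσ' : ∀ k, k + 2 < N → ‖incr Q (k + 3) - incr Q (k + 2)‖ ≤ K * τ ^ 2)
    (hG : IsWeakGrad (p (τ / 2) - (p 0 + φstar)) G) (hGK : ‖G‖ ≤ K * τ)
    (hS : IsSchemeSolution 0 τ N f (v 0) (p 0) φstar U P Φ) :
    linfNorm N normL2 (incr fun k => v k - U k) + l2Norm τ N normH1 (incr fun k => v k - U k)
      + ENNReal.ofReal τ * linfNorm N normA (incr (presError τ p P))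
      + ENNReal.ofReal τ * linfNorm N (normB τ) (incr fun k => v k - U k)
      ≤ ENNReal.ofReal (8 * (16 * (1 + T) * K * τ ^ 2)) := by
  have hQ₀ : (Q 0 : MixedSpace d) ∅ = p 0 := hQ 0 N.zero_le
  have hQ₁ : (Q 1 : MixedSpace d) ∅ = p (τ / 2) := by
    rw [hQ 1 hN₀, presTime, Nat.cast_zero, zero_add, one_div_mul_eq_div]
  obtain ⟨Z, herr, hZ⟩ := hv.exists_isErrorSequence hd hτ (hQ₀ ▸ hS)
  have hZG : Z 0 = G := (hZ hN₀).unique (by rwa [hQ₀, hQ₁])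
  rw [hS.linfNorm_presError hτ (hv.mem_domB 0 N.zero_le) hQ]
  exact (herr.isPerturbedScheme hd hτ.le).stability hd hτ
    (sum_incrSource_le hτ.le hτT hK hN hR (hZG ▸ hGK) hσ hσ')

end DirSplit

end

open DirSplit in
theorem mainTheorem2_general (d : ℕ) (hd : d = 2 ∨ d = 3) (T : ℝ) (hT : 0 < T)
    (f : ℝ → VL2 d) (u₀ : VL2 d) (u : ℝ → VL2 d) (p : ℝ → L2 d)
    (hsol : IsStokesSolution T f u₀ u p) (hu : MemWInfty 3 T u) (huB : MemWInftyDB T 2 T u)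
    (hp : MemWInftyY 2 T p) (c₀ : ℝ) :
    ∃ c : ℝ, ∀ τ : ℝ, 0 < τ → τ ≤ T → ∀ N : ℕ, N = ⌊T / τ⌋₊ → ∀ φstar : L2 d,
      (∃ G : VL2 d, IsWeakGrad (p (τ / 2) - (p 0 + φstar)) G ∧ ‖G‖ ≤ c₀ * τ) →
      ∀ (U : ℕ → VL2 d) (P Φ : ℕ → L2 d), IsSchemeSolution 0 τ N f u₀ (p 0) φstar U P Φ →
      linfNorm N normL2 (incr (velError τ u U)) + l2Norm τ N normH1 (incr (velError τ u U))
        + ENNReal.ofReal τ * linfNorm N normA (incr (presError τ p P))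
        + ENNReal.ofReal τ * linfNorm N (normB τ) (incr (velError τ u U))
        ≤ ENNReal.ofReal (c * τ ^ 2) := by
  have hd₂ : 2 ≤ d := by lia
  obtain ⟨K, hK, hcons⟩ := hsol.exists_isConsistentSequence hd₂ hT hu huB hp
  refine ⟨128 * (1 + T) * (K + |c₀|), ?_⟩
  rintro τ hτ hτT N rfl φstar ⟨G, hG, hGc₀⟩ U P Φ hS
  have hN : 0 < ⌊T / τ⌋₊ := Nat.floor_pos.2 ((one_le_div hτ).2 hτT)
  have hNτ : ⌊T / τ⌋₊ * τ ≤ T := (le_div_iff₀ hτ).1 (Nat.floor_le (by positivity))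
  obtain ⟨Q, R, hQR, hQ, hR, hσ, hσ'⟩ := hcons τ hτ hτT _ hNτ
  have hu₀ : u ((0 : ℕ) * τ) = u₀ := by rw [Nat.cast_zero, zero_mul, hsol.initial]
  have hKc₀ : K ≤ K + |c₀| := le_add_of_nonneg_right (abs_nonneg c₀)
  have hc₀K : c₀ ≤ K + |c₀| := (le_abs_self c₀).trans (le_add_of_nonneg_left hK)
  refine (hQR.error_le hd₂ hτ hτT (hK.trans hKc₀) hN hNτ hQ (fun k hk => (hR k hk).trans ?_)
    (fun k hk => (hσ k hk).trans ?_) (fun k hk => (hσ' k hk).trans ?_) hG (hGc₀.trans ?_)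
    (hu₀ ▸ hS)).trans_eq (by ring_nf)
  all_goals gcongr

theorem mainTheorem2 (d : ℕ) (hd : d = 2 ∨ d = 3) (T : ℝ) (hT : 0 < T)
    (f : ℝ → DirSplit.VL2 d) (u₀ : DirSplit.VL2 d)
    (u : ℝ → DirSplit.VL2 d) (p : ℝ → DirSplit.L2 d)
    (hsol : DirSplit.IsStokesSolution T f u₀ u p)
    (huH2 : DirSplit.MemWInftyH2 3 T u)
    (huB : ∀ τ : ℝ, 0 < τ → DirSplit.MemWInftyDB τ 2 T u)
    (hpY : DirSplit.MemWInftyY 3 T p)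
    (c₀ : ℝ) :
    ∃ c : ℝ, ∀ τ : ℝ, 0 < τ → τ ≤ T → ∀ N : ℕ, N = ⌊T / τ⌋₊ →
      ∀ φstar : DirSplit.L2 d,
      (∃ G : DirSplit.VL2 d,
        DirSplit.IsWeakGrad (p (τ / 2) - (p 0 + φstar)) G ∧ ‖G‖ ≤ c₀ * τ) →
      ∀ (U : ℕ → DirSplit.VL2 d) (P Φ : ℕ → DirSplit.L2 d),
      DirSplit.IsSchemeSolution 0 τ N f u₀ (p 0) φstar U P Φ →
      DirSplit.linfNorm N DirSplit.normL2 (DirSplit.incr (DirSplit.velError τ u U))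
        + DirSplit.l2Norm τ N DirSplit.normH1 (DirSplit.incr (DirSplit.velError τ u U))
        + ENNReal.ofReal τ *
            DirSplit.linfNorm N DirSplit.normA (DirSplit.incr (DirSplit.presError τ p P))
        + ENNReal.ofReal τ *
            DirSplit.linfNorm N (DirSplit.normB τ) (DirSplit.incr (DirSplit.velError τ u U))
        ≤ ENNReal.ofReal (c * τ ^ 2) :=
  mainTheorem2_general d hd T hT f u₀ u p hsol huH2.memWInfty (huB T hT) (hpY.mono (by norm_num)) c₀
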